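/- **Model.** A *1qfa verifier* $V$ over a finite input alphabet $\Sigma$ has a finite set $Q=Q_{non}\sqcup Q_{acc}\sqcup Q_{rej}$ of inner states with initial state $q_0\in Q_{non}$, a finite communication alphabet $\Gamma$ containing a blank symbol $\#$, and for each scanned symbol $\sigma\in\Sigma\cup\{\vdash,\$\}$ (where $\vdash,\$\notin\Sigma$ are the left and right endmarkers) a unitary operator $V_\sigma$ (with arbitrary complex entries) on $\mathrm{span}(Q\times\Gamma)$, such that $V_{\$}$ maps $\mathrm{span}(Q_{non}\times\Gamma)$ into $\mathrm{span}((Q_{acc}\cup Q_{rej})\times\Gamma)$. A *prover* $P$ has a finite tape alphabet $\Delta$ with a blank symbol and a one-way infinite private tape (almost all of whose cells are blank); for each input $x$ and each $i\ge 1$ he has a unitary $U^x_{P,i}=S\otimes I$, where $S$ acts on the communication cell and on finitely many initial cells of the private tape. On input $x$ the computation starts with inner state $q_0$, a blank communication cell and a blank private tape. In round $i$, $1\le i\le |x|+2$, the verifier applies $V_\sigma$, where $\sigma$ is the $i$-th symbol of $\vdash x\$$; then it is measured whether the inner state is accepting, rejecting or non-halting; the (unnormalized) non-halting part continues, and the prover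 applies $U^x_{P,i}$ to it. The acceptance (rejection) probability is the sum over all rounds of the squared norm of the accepting (rejecting) part. For an input $x$ let $S_0$ consist of the blank tape and let $S_i$ be the set of all tape contents $y$ such that $|\tau\rangle|y\rangle$ has non-zero amplitude in $U^x_{P,i}|\sigma\rangle|z\rangle$ for some $z\in S_{i-1}$ and $\sigma,\tau\in\Gamma$. The prover $P$ is *committed* if for all $x$, all $i\ge1$ and all $y\in S_{i-1}$ there is a $\psi$ with $U^x_{P,i}|\#\rangle|y\rangle=|\#\rangle|\psi\rangle$. The class $\mathrm{QIP}^{\#}(1qfa)$ consists of the languages $L$ over finite alphabets for which there are a 1qfa verifier $V$, a committed prover $P$ and $\epsilon>0$ such that $(P,V)$ accepts every $x\in L$ with probability at least $\frac12+\epsilon$, and $(P^*,V)$ rejects every $x\notin L$ with probability at least $\frac12+\epsilon$ for every committed prover $P^*$. A *query configuration* is a non-halting global configuration in which the verifier has just written a non-blank symbol in the communication cell. The *number of interactions* of $(P,V)$ on $x$ is the maximum, over all computation paths (sequences of successive transitions of non-zero amplitude through configurations that have non-zero amplitude in the superposition at their time), of the number of query configurations on the path. The class $\mathrm{QIP}^{\#}_k(1qfa)$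 is defined as $\mathrm{QIP}^{\#}(1qfa)$ with the additional requirement that $(P,V)$ makes at most $k$ interactions on every $x\in L$ and $(P^*,V)$ makes at most $k$ interactions on every $x\notin L$ for every committed prover $P^*$. The class $\mathrm{1QFA}$ consists of the languages recognized with error probability bounded by a constant below $\frac12$ by measure-many one-way quantum finite automata (unitary operators on $\mathrm{span}(Q)$, measurement after every step, no communication). **Theorem.** $\mathrm{QIP}^{\#}_0(1qfa)\subsetneqq\mathrm{QIP}^{\#}_1(1qfa)\subsetneqq\mathrm{QIP}^{\#}(1qfa)$. More precisely, both inclusions hold for the languages over any finite alphabet, and over the alphabet $\{0,1\}$ both are proper: the language $Odd=\{0^m1z : m\ge 0,\ z\in\{0,1\}^*,\ z \text{ contains an odd number of } 0\text{s}\}$ belongs to $\mathrm{QIP}^{\#}_1(1qfa)$ but not to $\mathrm{QIP}^{\#}_0(1qfa)$, nor to $\mathrm{1QFA}$, and the language $Zero=\{u0 : u\in\{0,1\}^*\}$ belongs to $\mathrm{QIP}^{\#}(1qfa)$ but not to $\mathrm{QIP}^{\#}_1(1qfa)$. -/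

import Mathlib

namespace QIPSharp

/-- The extended input alphabet: the letters of `α` and the two endmarkers. -/
inductive TapeSym (α : Type) where
  | left : TapeSym α
  | letter : α → TapeSym α
  | right : TapeSym α

/-- The symbol scanned at step `t` (counted from `0`) by a head that starts on the left endmarker
and moves one cell to the right at every step, on input `x`.  Only the steps `t < |x| + 2` are ever
relevant. -/
def scanned {α : Type} (x : List α) : ℕ → TapeSym α
  | 0 => TapeSym.left
  | t + 1 => match x[t]? with
    | some a => TapeSym.letter a
    | none => TapeSym.right

/-- Every inner state is exactly one of: non-halting, accepting, rejecting. -/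
inductive Status where
  | non : Status
  | acc : Status
  | rej : Status
deriving DecidableEq

/-! ### One-way verifiers -/

/-- A one-way measure-many quantum finite automaton acting as a verifier.  As the head moves to the
right in every transition, the transition function needs no direction argument:
`δ q σ γ q' γ'` is the amplitude of passing from inner state `q` and communication symbol `γ` to
`q'` and `γ'` while scanning `σ`. -/
structure Verifier (α : Type) where
  /-- inner states -/
  Q : Type
  /-- communication alphabet -/
  Γ : Type
  [fintypeQ : Fintype Q]
  [fintypeΓ : Fintype Γ]
  [decEqQ : DecidableEq Q]
  [decEqΓ : DecidableEq Γ]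
  /-- the blank communication symbol -/
  blank : Γ
  /-- the partition of the inner states -/
  status : Q → Status
  /-- the initial inner state -/
  q₀ : Q
  q₀_non : status q₀ = Status.non
  /-- the transition function -/
  δ : Q → TapeSym α → Γ → Q → Γ → ℂ
  /-- For every scanned symbol, the operator induced on `span (Q × Γ)` is unitary. -/
  wellFormed : ∀ σ : TapeSym α,
    (Matrix.of fun (r s : Q × Γ) => δ s.1 σ s.2 r.1 r.2) ∈ Matrix.unitaryGroup (Q × Γ) ℂ
  /-- When the head moves off the right endmarker, the verifier enters a halting state. -/
  halts : ∀ q γ q' γ', status q = Status.non → status q' = Status.non →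
    δ q TapeSym.right γ q' γ' = 0

attribute [instance] Verifier.fintypeQ Verifier.fintypeΓ Verifier.decEqQ Verifier.decEqΓ

/-! ### Provers -/

/-- Contents of a one-way infinite tape with only finitely many non-blank cells. -/
def Tape (Δ : Type) (blank : Δ) : Type :=
  {y : ℕ → Δ // {j | y j ≠ blank}.Finite}

namespace Tape

variable {Δ : Type} {blank : Δ}

/-- The tape all of whose cells are blank. -/
def allBlank (Δ : Type) (blank : Δ) : Tape Δ blank :=
  ⟨fun _ => blank, by simp⟩

/-- The contents of the first `m` cells. -/
def initial (m : ℕ) (y : Tape Δ blank) : Fin m → Δ := fun j => y.1 j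

/-- Replace the contents of the first `m` cells by `z`. -/
def overwrite (m : ℕ) (z : Fin m → Δ) (y : Tape Δ blank) : Tape Δ blank :=
  ⟨fun j => if h : j < m then z ⟨j, h⟩ else y.1 j, by
    refine ((Set.finite_lt_nat m).union y.2).subset ?_
    intro j hj
    by_cases h : j < m
    · exact Or.inl h
    · right
      simpa [h] using hj⟩

end Tape

/-- A prover for inputs over `α` and the communication alphabet `Γ`.  On input `x`, his `i`-th
operation (counted from `0`) is `S ⊗ I`, where the unitary `S = S x i` acts on the communication
cell and the first `cells x i` cells of his private tape. -/
structure Prover (α Γ : Type) [Fintype Γ] [DecidableEq Γ] where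
  /-- private tape alphabet -/
  Δ : Type
  [fintypeΔ : Fintype Δ]
  [decEqΔ : DecidableEq Δ]
  /-- the blank tape symbol -/
  blank : Δ
  /-- the number of private tape cells involved in an operation -/
  cells : List α → ℕ → ℕ
  /-- the finite-dimensional unitary operation -/
  S : (x : List α) → (i : ℕ) → Matrix.unitaryGroup (Γ × (Fin (cells x i) → Δ)) ℂ

attribute [instance] Prover.fintypeΔ Prover.decEqΔ

namespace Prover

variable {α Γ : Type} [Fintype Γ] [DecidableEq Γ]

/-- Contents of the private tape. -/
abbrev PTape (P : Prover α Γ) : Type := Tape P.Δ P.blank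

/-- The operator `U = S ⊗ I` on superpositions of pairs (communication symbol, private tape):
`U |γ⟩|y⟩ = ∑ S_{(γ',z),(γ,y₁…yₘ)} |γ'⟩|z yₘ₊₁ yₘ₊₂ …⟩`.  Superpositions that occur in a
computation involve finitely many configurations, hence are finitely supported. -/
noncomputable def U (P : Prover α Γ) (x : List α) (i : ℕ) :
    (Γ × P.PTape →₀ ℂ) →ₗ[ℂ] (Γ × P.PTape →₀ ℂ) :=
  Finsupp.linearCombination ℂ fun c : Γ × P.PTape =>
    ∑ w : Γ × (Fin (P.cells x i) → P.Δ),
      Finsupp.single (w.1, c.2.overwrite (P.cells x i) w.2)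
        ((P.S x i).1 w (c.1, c.2.initial (P.cells x i)))

/-- The tape contents that may appear after `i` operations of the prover, whatever symbols the
communication cell holds before each of them. -/
def reachable (P : Prover α Γ) (x : List α) : ℕ → Set P.PTape
  | 0 => {Tape.allBlank P.Δ P.blank}
  | i + 1 => {y | ∃ z ∈ P.reachable x i, ∃ σ τ : Γ,
      P.U x i (Finsupp.single (σ, z) 1) (τ, y) ≠ 0}

/-- A prover is committed (with respect to the blank communication symbol `blankΓ`) if on every
input he leaves the blank communication symbol unchanged: `U |#⟩|y⟩ = |#⟩|ψ⟩` for all tape contents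
`y` that may appear.  (As `U` is unitary, `ψ` is automatically a unit vector.) -/
def Committed (P : Prover α Γ) (blankΓ : Γ) : Prop :=
  ∀ (x : List α) (i : ℕ), ∀ y ∈ P.reachable x i, ∃ ψ : P.PTape →₀ ℂ,
    P.U x i (Finsupp.single (blankΓ, y) 1) = ψ.mapDomain (Prod.mk blankΓ)

end Prover

/-! ### Computations -/

section Computation

variable {α : Type} (V : Verifier α) (P : Prover α V.Γ) (x : List α)

/-- Global configurations (inner state, communication symbol, private tape).  The head position is
determined by the step number. -/
abbrev Config : Type := V.Q × V.Γ × P.PTape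

/-- The verifier's operation on global superpositions when scanning `σ`. -/
noncomputable def verifierOp (σ : TapeSym α) :
    (Config V P →₀ ℂ) →ₗ[ℂ] (Config V P →₀ ℂ) :=
  Finsupp.linearCombination ℂ fun c : Config V P =>
    ∑ r : V.Q × V.Γ, Finsupp.single (r.1, r.2, c.2.2) (V.δ c.1 σ c.2.1 r.1 r.2)

/-- The prover's `i`-th operation on global superpositions; it does not touch the inner state. -/
noncomputable def proverOp (i : ℕ) :
    (Config V P →₀ ℂ) →ₗ[ℂ] (Config V P →₀ ℂ) :=
  Finsupp.linearCombination ℂ fun c : Config V P =>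
    (P.U x i (Finsupp.single c.2 1)).mapDomain (Prod.mk c.1)

/-- The initial global configuration. -/
def initialConfig : Config V P := (V.q₀, V.blank, Tape.allBlank P.Δ P.blank)

/-- The (unnormalized) non-halting part of a global superposition. -/
noncomputable def nonHaltingPart (ψ : Config V P →₀ ℂ) : Config V P →₀ ℂ :=
  ψ.filter fun c => V.status c.1 = Status.non

/-- The superposition just before the verifier's step `t` (counted from `0`).  In each round the
verifier moves, his measurement retains the non-halting part, and the prover moves. -/
noncomputable def stateBefore : ℕ → (Config V P →₀ ℂ)
  | 0 => Finsupp.single (initialConfig V P) 1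
  | t + 1 => proverOp V P x t
      (nonHaltingPart V P (verifierOp V P (scanned x t) (stateBefore t)))

/-- The superposition just after the verifier's move at step `t`, before the measurement. -/
noncomputable def stateMoved (t : ℕ) : Config V P →₀ ℂ :=
  verifierOp V P (scanned x t) (stateBefore V P x t)

/-- The superposition that remains after the measurement at step `t`. -/
noncomputable def stateMeasured (t : ℕ) : Config V P →₀ ℂ :=
  nonHaltingPart V P (stateMoved V P x t)

/-- The probability that the measurement at step `t` yields status `s`. -/
noncomputable def probAt (s : Status) (t : ℕ) : ℝ :=
  (stateMoved V P x t).sum fun c a => if V.status c.1 = s then ‖a‖ ^ 2 else 0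

/-- The probability that the protocol accepts `x`; a one-way verifier halts within `|x| + 2`
steps. -/
noncomputable def accProb : ℝ :=
  ∑ t ∈ Finset.range (x.length + 2), probAt V P x Status.acc t

/-- The probability that the protocol rejects `x`. -/
noncomputable def rejProb : ℝ :=
  ∑ t ∈ Finset.range (x.length + 2), probAt V P x Status.rej t

/-- A computation path through `rounds` rounds.  At round `t` the verifier moves from
`before t` to the non-halting configuration `after t`, and then the prover moves from `after t` to
`before (t + 1)`.  All transitions have non-zero amplitude, and so have all configurations in the
superposition at their time.  (The values of the two functions at later rounds are meaningless.) -/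
structure ComputationPath where
  /-- the number of rounds -/
  rounds : ℕ
  /-- the configurations before the verifier's moves -/
  before : ℕ → Config V P
  /-- the configurations after the verifier's moves and measurements -/
  after : ℕ → Config V P
  start : before 0 = initialConfig V P
  verifier_move : ∀ t < rounds,
    verifierOp V P (scanned x t) (Finsupp.single (before t) 1) (after t) ≠ 0
  after_ne_zero : ∀ t < rounds, stateMeasured V P x t (after t) ≠ 0
  prover_move : ∀ t, t + 1 < rounds →
    proverOp V P x t (Finsupp.single (after t) 1) (before (t + 1)) ≠ 0
  before_ne_zero : ∀ t < rounds, stateBefore V P x t (before t) ≠ 0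

/-- The number of query configurations along a path: the non-halting configurations in which the
verifier has just written a non-blank symbol in the communication cell. -/
def ComputationPath.queries {V : Verifier α} {P : Prover α V.Γ} {x : List α}
    (γ : ComputationPath V P x) : ℕ :=
  ((Finset.range γ.rounds).filter fun t => (γ.after t).2.1 ≠ V.blank).card

/-- The number of interactions of the protocol on input `x`: the maximum, over all computation
paths, of the number of query configurations. -/
noncomputable def interactions : ℕ∞ :=
  ⨆ γ : ComputationPath V P x, (γ.queries : ℕ∞)

end Computation

/-! ### Language classes -/

section Classes

variable {α : Type}

/-- The interaction-bounded system `(P, V)` recognizes `L` with completeness and soundness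
probability at least `a`; both the honest and the dishonest provers are committed. -/
def Recognizes (V : Verifier α) (P : Prover α V.Γ) (L : Language α) (a : ℝ) : Prop :=
  P.Committed V.blank ∧
  (∀ x ∈ L, a ≤ accProb V P x) ∧
  (∀ x ∉ L, ∀ P' : Prover α V.Γ, P'.Committed V.blank → a ≤ rejProb V P' x)

/-- The system `(P, V)` for the language `L` is `k`-interaction bounded. -/
def InteractionBounded (V : Verifier α) (P : Prover α V.Γ) (L : Language α) (k : ℕ) : Prop :=
  (∀ x ∈ L, interactions V P x ≤ k) ∧
  (∀ x ∉ L, ∀ P' : Prover α V.Γ, P'.Committed V.blank → interactions V P' x ≤ k)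

end Classes

/-- The languages over `α` recognized with bounded error by interaction-bounded QIP systems with
1qfa verifiers. -/
def QIPsharp (α : Type) : Set (Language α) :=
  {L | ∃ (V : Verifier α) (P : Prover α V.Γ) (ε : ℝ), 0 < ε ∧ Recognizes V P L (1 / 2 + ε)}

/-- The languages over `α` recognized with bounded error by `k`-interaction bounded QIP systems
with 1qfa verifiers. -/
def QIPsharpBounded (k : ℕ) (α : Type) : Set (Language α) :=
  {L | ∃ (V : Verifier α) (P : Prover α V.Γ) (ε : ℝ), 0 < ε ∧
    Recognizes V P L (1 / 2 + ε) ∧ InteractionBounded V P L k}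

/-! ### One-way quantum finite automata -/

/-- A one-way measure-many quantum finite automaton. -/
structure OneWayQFA (α : Type) where
  /-- inner states -/
  Q : Type
  [fintypeQ : Fintype Q]
  [decEqQ : DecidableEq Q]
  /-- the partition of the inner states -/
  status : Q → Status
  /-- the initial inner state -/
  q₀ : Q
  q₀_non : status q₀ = Status.non
  /-- the unitary operator applied when scanning a symbol -/
  op : TapeSym α → Matrix.unitaryGroup Q ℂ

attribute [instance] OneWayQFA.fintypeQ OneWayQFA.decEqQ

namespace OneWayQFA

variable {α : Type} (M : OneWayQFA α) (x : List α)

/-- The (unnormalized) non-halting superposition before step `t`. -/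
noncomputable def stateBefore : ℕ → (M.Q → ℂ)
  | 0 => Pi.single M.q₀ 1
  | t + 1 => fun q => if M.status q = Status.non then
      ((M.op (scanned x t)).1.mulVec (stateBefore t)) q else 0

/-- The probability that the computation on `x` ends with status `s`. -/
noncomputable def prob (s : Status) : ℝ :=
  ∑ t ∈ Finset.range (x.length + 2), ∑ q : M.Q,
    if M.status q = s then ‖((M.op (scanned x t)).1.mulVec (M.stateBefore x t)) q‖ ^ 2 else 0

end OneWayQFA

/-- The languages over `α` recognized by bounded-error 1qfa's. -/
def OneQFA (α : Type) : Set (Language α) :=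
  {L | ∃ (M : OneWayQFA α) (ε : ℝ), 0 < ε ∧
    (∀ x ∈ L, 1 / 2 + ε ≤ M.prob x Status.acc) ∧
    (∀ x ∉ L, 1 / 2 + ε ≤ M.prob x Status.rej)}

/-! ### The two languages -/

/-- The binary strings `0ᵐ1z` such that `z` contains an odd number of `0`s. -/
def oddLang : Language (Fin 2) :=
  {w | ∃ (m : ℕ) (z : List (Fin 2)), w = List.replicate m 0 ++ 1 :: z ∧ Odd (z.count 0)}

/-- The binary strings that end in `0`. -/
def zeroLang : Language (Fin 2) :=
  {w | ∃ u : List (Fin 2), w = u ++ [0]}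

end QIPSharp

/-! Both inclusions merely drop or weaken the interaction bound; the content is two memberships and
two impossibility results.

Memberships. A deterministic automaton can merge states, which a unitary verifier cannot. The
verifier writes the lost information into the communication cell, and the honest prover exchanges
that cell with a fresh blank cell of his tape (`archiver`). A cell that comes back non-blank makes
the verifier reject, so no prover can gain anything. For `oddLang` only the first `1` merges states,
hence one query; for `zeroLang` a query is made whenever the remembered bit changes.

Impossibility. Both arguments rest on one fact about contractions of a finite-dimensional Hilbert
space. The space splits orthogonally into `isoSub`, on which all words are isometric, and its
complement, and both are invariant. Some word `z` is uniformly small on the complement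
(`exists_wordOp_uniformly_small`), and on `isoSub` each letter has a positive power close to the
identity (`exists_replicate_recurrent`).

Without queries a committed prover acts on his tape alone, so his operations commute with the
verifier's and the system is a 1qfa (`QIPsharpBounded_zero_subset_OneQFA`). A 1qfa cannot recognize
`oddLang`: the blocks `1` and `010` both contain an even number of zeros, and suitable powers of
them followed by a common `z` lead to nearly equal states; yet appending `0` must raise the
acceptance probability in one case and lower it in the other.

For `zeroLang` the interaction bound holds against every committed prover on words outside the
language, and every word becomes one by appending `1`. A prover who marks his reply on his tape
shows that after one reply, whatever it is, the verifier never queries again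
(`block_mem_repliedSub`). After `z0z` the superposition is therefore nearly isometric and free of
queries, so a block of zeros and a block of ones of suitable lengths both leave it almost unchanged.
The verdicts on `z0z0…0` and `z0z1…1` then nearly agree when the honest prover for the first word is
used on both, against completeness and soundness. -/

namespace QIPSharp

/-! ### Semigroups of contractions on a finite-dimensional Hilbert space -/

section Contractions

open scoped InnerProductSpace

variable {H ι : Type*} [NormedAddCommGroup H] [InnerProductSpace ℂ H]

/-- The composition of the operators indexed by the letters of a word, the first letter acting
first. -/
noncomputable def wordOp (T : ι → H →L[ℂ] H) : List ι → (H →L[ℂ] H)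
  | [] => ContinuousLinearMap.id ℂ H
  | a :: w => (wordOp T w).comp (T a)

lemma wordOp_append (T : ι → H →L[ℂ] H) (u w : List ι) (v : H) :
    wordOp T (u ++ w) v = wordOp T w (wordOp T u v) := by
  induction u generalizing v with
  | nil => rfl
  | cons a u ih => exact ih (T a v)

lemma norm_wordOp_le {T : ι → H →L[ℂ] H} (hT : ∀ i v, ‖T i v‖ ≤ ‖v‖) (w : List ι) (v : H) :
    ‖wordOp T w v‖ ≤ ‖v‖ := by
  induction w generalizing v with
  | nil => exact le_rfl
  | cons a w ih => exact (ih (T a v)).trans (hT a v)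

/-- The vectors whose norm is preserved by all words. -/
noncomputable def isoSub (T : ι → H →L[ℂ] H) (hT : ∀ i v, ‖T i v‖ ≤ ‖v‖) : Submodule ℂ H where
  carrier := {v | ∀ w, ‖wordOp T w v‖ = ‖v‖}
  zero_mem' := by intro w; simp
  add_mem' := by
    intro u v hu hv w
    -- By the parallelogram law the squared norms of the images of `u + v` and `u - v` have the same
    -- sum as the originals; as neither can grow, neither can shrink.
    have h1 := norm_wordOp_le hT w (u + v)
    have h2 := norm_wordOp_le hT w (u - v)
    have h3 := parallelogram_law_with_norm ℂ (wordOp T w u) (wordOp T w v)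
    have h4 := parallelogram_law_with_norm ℂ u v
    rw [hu w, hv w, ← map_add, ← map_sub] at h3
    refine le_antisymm h1 ?_
    by_contra hlt
    push Not at hlt
    nlinarith [norm_nonneg (wordOp T w (u + v)), norm_nonneg (wordOp T w (u - v)),
      norm_nonneg (u + v), norm_nonneg (u - v)]
  smul_mem' := by
    intro c v hv w
    simp [norm_smul, hv w]

variable {T : ι → H →L[ℂ] H} {hT : ∀ i v, ‖T i v‖ ≤ ‖v‖}

lemma norm_apply_of_mem_isoSub {v : H} (hv : v ∈ isoSub T hT) (a : ι) : ‖T a v‖ = ‖v‖ :=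
  hv [a]

lemma apply_mem_isoSub {v : H} (hv : v ∈ isoSub T hT) (a : ι) : T a v ∈ isoSub T hT := by
  intro w
  rw [norm_apply_of_mem_isoSub hv]
  exact hv (a :: w)

lemma wordOp_mem_isoSub {v : H} (hv : v ∈ isoSub T hT) (w : List ι) :
    wordOp T w v ∈ isoSub T hT := by
  induction w generalizing v with
  | nil => exact hv
  | cons a w ih => exact ih (apply_mem_isoSub hv a)

variable [FiniteDimensional ℂ H]

/-- A contraction that preserves the norm of `v` satisfies `A† A v = v`. -/
lemma adjoint_apply_of_norm_eq {A : H →L[ℂ] H} (hA : ∀ v, ‖A v‖ ≤ ‖v‖) {v : H}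
    (hv : ‖A v‖ = ‖v‖) : ContinuousLinearMap.adjoint A (A v) = v := by
  have := FiniteDimensional.complete ℂ H
  have hle : ‖ContinuousLinearMap.adjoint A (A v)‖ ≤ ‖v‖ := by
    have h1 : ‖A‖ ≤ 1 := A.opNorm_le_bound zero_le_one (by simpa using hA)
    have h2 : ‖ContinuousLinearMap.adjoint A‖ ≤ 1 := by simpa using h1
    calc _ ≤ ‖ContinuousLinearMap.adjoint A‖ * ‖A v‖ := ContinuousLinearMap.le_opNorm _ _
      _ ≤ 1 * ‖v‖ := by gcongr; exact hA v
      _ = ‖v‖ := one_mul _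
  -- `‖A†Av - v‖² = ‖A†Av‖² - 2‖Av‖² + ‖v‖²`, which is at most `0` because `‖A†Av‖ ≤ ‖v‖ = ‖Av‖`.
  rw [← sub_eq_zero, ← norm_eq_zero, ← sq_eq_zero_iff]
  refine le_antisymm ?_ (sq_nonneg _)
  rw [@norm_sub_sq ℂ, ContinuousLinearMap.adjoint_inner_left, inner_self_eq_norm_sq (𝕜 := ℂ), hv]
  nlinarith [norm_nonneg (ContinuousLinearMap.adjoint A (A v)), norm_nonneg v]

/-- In finite dimension the isometry `T a` maps `isoSub` onto itself, and `⟪T a v, T a u⟫ = ⟪T a† (T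
a v), u⟫ = ⟪v, u⟫` for `v` in `isoSub`. -/
lemma apply_mem_isoSub_orthogonal {u : H} (hu : u ∈ (isoSub T hT)ᗮ) (a : ι) :
    T a u ∈ (isoSub T hT)ᗮ := by
  have := FiniteDimensional.complete ℂ H
  let f : isoSub T hT →ₗ[ℂ] isoSub T hT :=
    (T a : H →ₗ[ℂ] H).restrict fun v hv => apply_mem_isoSub hv a
  have hinj : Function.Injective f := by
    rw [injective_iff_map_eq_zero]
    intro v hv
    have h1 : T a v = 0 := congrArg Subtype.val hv
    have h2 := norm_apply_of_mem_isoSub v.2 a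
    rw [h1, norm_zero, eq_comm, norm_eq_zero] at h2
    exact Subtype.ext h2
  have hsurj := LinearMap.injective_iff_surjective.mp hinj
  rw [Submodule.mem_orthogonal] at hu ⊢
  intro v' hv'
  obtain ⟨v, hv⟩ := hsurj ⟨v', hv'⟩
  have h1 : T a v = v' := congrArg Subtype.val hv
  rw [← h1, ← ContinuousLinearMap.adjoint_inner_left,
    adjoint_apply_of_norm_eq (hT a) (norm_apply_of_mem_isoSub v.2 a)]
  exact hu v v.2

lemma wordOp_mem_isoSub_orthogonal {u : H} (hu : u ∈ (isoSub T hT)ᗮ) (w : List ι) :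
    wordOp T w u ∈ (isoSub T hT)ᗮ := by
  induction w generalizing u with
  | nil => exact hu
  | cons a w ih => exact ih (apply_mem_isoSub_orthogonal hu a)

/-- Outside the isometric subspace, every vector is made arbitrarily small by some word. -/
lemma exists_wordOp_small {u : H} (hu : u ∈ (isoSub T hT)ᗮ) {δ : ℝ} (hδ : 0 < δ) :
    ∃ w, ‖wordOp T w u‖ ≤ δ := by
  have := FiniteDimensional.complete ℂ H
  have := FiniteDimensional.proper ℂ H
  set O : Set H := closure (Set.range fun w => wordOp T w u) with hO
  have hsub : Set.range (fun w => wordOp T w u) ⊆ Metric.closedBall 0 ‖u‖ := by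
    rintro _ ⟨w, rfl⟩
    simpa using norm_wordOp_le hT w u
  have hcomp : IsCompact O :=
    (isCompact_closedBall (0 : H) ‖u‖).of_isClosed_subset isClosed_closure
      (closure_minimal hsub Metric.isClosed_closedBall)
  obtain ⟨m, hmO, hmin⟩ := hcomp.exists_isMinOn
    ⟨u, subset_closure ⟨[], rfl⟩⟩ continuous_norm.continuousOn
  have hmE : m ∈ (isoSub T hT)ᗮ := by
    refine closure_minimal ?_ (Submodule.isClosed_orthogonal _) hmO
    rintro _ ⟨w, rfl⟩
    exact wordOp_mem_isoSub_orthogonal hu w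
  -- The orbit closure is invariant under all words and `m` has the least norm in it, so no word can
  -- shorten `m`.
  have hiso : m ∈ isoSub T hT := by
    intro w
    refine le_antisymm (norm_wordOp_le hT w m) ?_
    refine hmin (a := wordOp T w m) ?_
    refine map_mem_closure (wordOp T w).continuous hmO ?_
    rintro _ ⟨z, rfl⟩
    exact ⟨z ++ w, wordOp_append T z w u⟩
  have hm0 : m = 0 := by
    have := (Submodule.mem_orthogonal _ _).1 hmE m hiso
    exact inner_self_eq_zero.1 this
  rw [hm0] at hmO
  obtain ⟨_, ⟨w, rfl⟩, hw⟩ := Metric.mem_closure_iff.1 hmO δ hδ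
  refine ⟨w, ?_⟩
  rw [dist_zero_left] at hw
  exact hw.le

/-- The vectors are treated one after the other: the word for a new vector is appended, and
contractions keep the earlier images small. -/
lemma exists_wordOp_small_finset (F : Finset H) (hF : ∀ u ∈ F, u ∈ (isoSub T hT)ᗮ) {δ : ℝ}
    (hδ : 0 < δ) : ∃ w, ∀ u ∈ F, ‖wordOp T w u‖ ≤ δ := by
  classical
  induction F using Finset.induction_on with
  | empty => exact ⟨[], by simp⟩
  | insert a F _ ih =>
    obtain ⟨w, hw⟩ := ih fun u hu => hF u (Finset.mem_insert_of_mem hu)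
    obtain ⟨z, hz⟩ := exists_wordOp_small
      (wordOp_mem_isoSub_orthogonal (hF a (Finset.mem_insert_self a F)) w) hδ
    refine ⟨w ++ z, fun u hu => ?_⟩
    rw [wordOp_append]
    rcases Finset.mem_insert.1 hu with rfl | hu
    · exact hz
    · exact (norm_wordOp_le hT z _).trans (hw u hu)

variable (T hT) in
/-- The orthogonal projection onto the isometric subspace. -/
noncomputable def isoProj : H →L[ℂ] H := (isoSub T hT).starProjection

lemma isoProj_mem (v : H) : isoProj T hT v ∈ isoSub T hT :=
  Submodule.starProjection_apply_mem _ v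

lemma sub_isoProj_mem (v : H) : v - isoProj T hT v ∈ (isoSub T hT)ᗮ :=
  Submodule.sub_starProjection_mem_orthogonal v

lemma norm_isoProj_le (v : H) : ‖isoProj T hT v‖ ≤ ‖v‖ :=
  Submodule.norm_starProjection_apply_le _ v

/-- Words commute with the projection, since `isoSub` and its complement are both invariant. -/
lemma wordOp_sub_isoProj (w : List ι) (v : H) :
    wordOp T w v - isoProj T hT (wordOp T w v) = wordOp T w (v - isoProj T hT v) := by
  have h : isoProj T hT (wordOp T w v) = wordOp T w (isoProj T hT v) := by
    refine Submodule.eq_starProjection_of_mem_orthogonal (K := isoSub T hT)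
      (wordOp_mem_isoSub (isoProj_mem v) w) ?_
    rw [← map_sub]
    exact wordOp_mem_isoSub_orthogonal (sub_isoProj_mem v) w
  rw [h, map_sub]

/-- Some word is uniformly small outside the isometric subspace. -/
lemma exists_wordOp_uniformly_small {δ : ℝ} (hδ : 0 < δ) :
    ∃ w, ∀ v : H, ‖wordOp T w (v - isoProj T hT v)‖ ≤ δ * ‖v‖ := by
  classical
  let b := stdOrthonormalBasis ℂ H
  set n : ℕ := Module.finrank ℂ H with hn
  obtain ⟨w, hw⟩ := exists_wordOp_small_finset (T := T) (hT := hT)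
    (Finset.univ.image fun i => b i - isoProj T hT (b i))
    (by
      intro u hu
      obtain ⟨i, _, rfl⟩ := Finset.mem_image.1 hu
      exact sub_isoProj_mem _)
    -- Each of the `n` basis vectors contributes at most this multiple of `‖v‖`; the `+ 1` covers
    -- dimension `0`.
    (δ := δ / (n + 1)) (by positivity)
  refine ⟨w, fun v => ?_⟩
  have hexp : v - isoProj T hT v = ∑ i, ⟪b i, v⟫_ℂ • (b i - isoProj T hT (b i)) := by
    conv_lhs => rw [← b.sum_repr' v]
    rw [map_sum, ← Finset.sum_sub_distrib]
    refine Finset.sum_congr rfl fun i _ => ?_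
    rw [map_smul, smul_sub]
  rw [hexp, map_sum]
  calc _ ≤ ∑ i, ‖wordOp T w (⟪b i, v⟫_ℂ • (b i - isoProj T hT (b i)))‖ := norm_sum_le _ _
    _ ≤ ∑ _i : Fin n, ‖v‖ * (δ / (n + 1)) := by
      refine Finset.sum_le_sum fun i _ => ?_
      rw [map_smul, norm_smul]
      gcongr
      · calc _ ≤ ‖b i‖ * ‖v‖ := norm_inner_le_norm _ _
          _ = ‖v‖ := by simp
      · exact hw _ (Finset.mem_image_of_mem _ (Finset.mem_univ i))
    _ = n * (‖v‖ * (δ / (n + 1))) := by simp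
    _ = (n / (n + 1)) * (δ * ‖v‖) := by ring
    _ ≤ 1 * (δ * ‖v‖) := by
      gcongr
      rw [div_le_one (by positivity)]
      linarith
    _ = δ * ‖v‖ := one_mul _

/-- On the isometric subspace, some positive power of each operator is close to the identity. -/
lemma exists_replicate_recurrent (a : ι) {δ : ℝ} (hδ : 0 < δ) :
    ∃ k, 0 < k ∧ ∀ v ∈ isoSub T hT, ‖wordOp T (List.replicate k a) v - v‖ ≤ δ * ‖v‖ := by
  have := FiniteDimensional.complete ℂ H
  have : ProperSpace (H →L[ℂ] H) := FiniteDimensional.proper ℂ _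
  let s : ℕ → H →L[ℂ] H := fun n => wordOp T (List.replicate n a)
  have hs : ∀ n, s n ∈ Metric.closedBall (0 : H →L[ℂ] H) 1 := by
    intro n
    rw [mem_closedBall_zero_iff]
    exact (s n).opNorm_le_bound zero_le_one fun v => by
      simpa using norm_wordOp_le hT (List.replicate n a) v
  -- The powers lie in a compact ball, so two of them are `δ`-close. The smaller power preserves
  -- norms on `isoSub` and can be cancelled, which leaves the power with the difference as exponent.
  obtain ⟨l, _, φ, hφ, hlim⟩ := tendsto_subseq_of_bounded Metric.isBounded_closedBall hs
  obtain ⟨N, hN⟩ := Metric.cauchySeq_iff.1 hlim.cauchySeq δ hδ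
  have hlt : φ N < φ (N + 1) := hφ (Nat.lt_succ_self N)
  refine ⟨φ (N + 1) - φ N, Nat.sub_pos_of_lt hlt, fun v hv => ?_⟩
  set k := φ (N + 1) - φ N with hk
  have hsplit : s (φ (N + 1)) v = s (φ N) (wordOp T (List.replicate k a) v) := by
    have : φ (N + 1) = k + φ N := by omega
    change wordOp T (List.replicate (φ (N + 1)) a) v = _
    rw [this, List.replicate_add, wordOp_append]
  have hmem : wordOp T (List.replicate k a) v - v ∈ isoSub T hT :=
    Submodule.sub_mem _ (wordOp_mem_isoSub hv _) hv
  rw [← hmem (List.replicate (φ N) a), map_sub]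
  change ‖s (φ N) (wordOp T (List.replicate k a) v) - s (φ N) v‖ ≤ _
  rw [← hsplit, ← sub_apply]
  refine (ContinuousLinearMap.le_opNorm _ _).trans ?_
  gcongr
  have := hN (N + 1) (Nat.le_succ N) N le_rfl
  rw [dist_eq_norm] at this
  exact this.le

end Contractions

/-- A unitary matrix preserves the sum of the squared moduli of the entries. -/
lemma sum_norm_sq_mulVec {R : Type*} [Fintype R] [DecidableEq R] {M : Matrix R R ℂ}
    (hM : M ∈ Matrix.unitaryGroup R ℂ) (v : R → ℂ) :
    ∑ r, ‖(M.mulVec v) r‖ ^ 2 = ∑ r, ‖v r‖ ^ 2 := by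
  have key : ∀ u : R → ℂ, ((∑ r, ‖u r‖ ^ 2 : ℝ) : ℂ) = dotProduct (star u) u := by
    intro u
    simp only [dotProduct, Pi.star_apply, Complex.ofReal_sum, Complex.ofReal_pow]
    exact Finset.sum_congr rfl fun r _ => (Complex.conj_mul' (u r)).symm
  have h : dotProduct (star (M.mulVec v)) (M.mulVec v) = dotProduct (star v) v := by
    rw [Matrix.star_mulVec, ← Matrix.dotProduct_mulVec, Matrix.mulVec_mulVec,
      ← Matrix.star_eq_conjTranspose, Matrix.UnitaryGroup.star_mul_self ⟨M, hM⟩, Matrix.one_mulVec]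
  rw [← key, ← key] at h
  exact_mod_cast h

end QIPSharp

namespace QIPSharp

/-! ### Square norms of finitely supported amplitude functions -/

section NormSq

variable {ι κ : Type*}

/-- The squared `ℓ²` norm. -/
noncomputable def normSq (f : ι →₀ ℂ) : ℝ := f.sum fun _ a => ‖a‖ ^ 2

/-- The `ℓ²` norm. -/
noncomputable def l2 (f : ι →₀ ℂ) : ℝ := √(normSq f)

lemma normSq_eq_sum (f : ι →₀ ℂ) {s : Finset ι} (h : f.support ⊆ s) :
    normSq f = ∑ i ∈ s, ‖f i‖ ^ 2 :=
  Finsupp.sum_of_support_subset f h _ (by simp)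

lemma normSq_nonneg (f : ι →₀ ℂ) : 0 ≤ normSq f :=
  Finset.sum_nonneg fun _ _ => by positivity

lemma l2_nonneg (f : ι →₀ ℂ) : 0 ≤ l2 f := Real.sqrt_nonneg _

lemma l2_sq (f : ι →₀ ℂ) : l2 f ^ 2 = normSq f := Real.sq_sqrt (normSq_nonneg f)

lemma normSq_zero : normSq (0 : ι →₀ ℂ) = 0 := by simp [normSq]

lemma normSq_single (i : ι) (a : ℂ) : normSq (Finsupp.single i a) = ‖a‖ ^ 2 :=
  Finsupp.sum_single_index (by simp)

lemma eq_zero_of_normSq_eq_zero {f : ι →₀ ℂ} (h : normSq f = 0) : f = 0 := by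
  ext i
  by_contra hi
  have h1 := (Finset.sum_eq_zero_iff_of_nonneg fun j _ => by positivity).1 h i
    (Finsupp.mem_support_iff.2 hi)
  exact hi (by simpa using h1)

lemma l2_add_le (f g : ι →₀ ℂ) : l2 (f + g) ≤ l2 f + l2 g := by
  classical
  set s := f.support ∪ g.support
  have key : ∀ h : ι →₀ ℂ, h.support ⊆ s →
      l2 h = ‖(WithLp.toLp 2 fun i : s => h i : EuclideanSpace ℂ s)‖ := by
    intro h hs
    rw [l2, normSq_eq_sum h hs, EuclideanSpace.norm_eq, ← Finset.sum_coe_sort]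
  rw [key f Finset.subset_union_left, key g Finset.subset_union_right,
    key (f + g) Finsupp.support_add]
  exact norm_add_le (WithLp.toLp 2 fun i : s => f i : EuclideanSpace ℂ s)
    (WithLp.toLp 2 fun i : s => g i)

lemma normSq_filter_add (f : ι →₀ ℂ) (p : ι → Prop) [DecidablePred p] :
    normSq (f.filter p) + normSq (f.filter fun i => ¬ p i) = normSq f := by
  classical
  rw [normSq_eq_sum (f.filter p) (s := f.support) (by
      rw [Finsupp.support_filter]; exact Finset.filter_subset _ _),
    normSq_eq_sum (f.filter fun i => ¬ p i) (s := f.support) (by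
      rw [Finsupp.support_filter]; exact Finset.filter_subset _ _),
    normSq_eq_sum f subset_rfl, ← Finset.sum_add_distrib]
  refine Finset.sum_congr rfl fun i _ => ?_
  by_cases hi : p i <;> simp [hi]

lemma normSq_filter_le (f : ι →₀ ℂ) (p : ι → Prop) [DecidablePred p] :
    normSq (f.filter p) ≤ normSq f := by
  have := normSq_filter_add f p
  have := normSq_nonneg (f.filter fun i => ¬ p i)
  linarith

lemma normSq_add_le (f g : ι →₀ ℂ) {a b : ℝ} (ha : l2 f ≤ a) (hb : l2 g ≤ b) :
    normSq (f + g) ≤ normSq f + 2 * a * b + normSq g := by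
  rw [← l2_sq, ← l2_sq f, ← l2_sq g]
  have h1 : l2 (f + g) ^ 2 ≤ (l2 f + l2 g) ^ 2 :=
    pow_le_pow_left₀ (l2_nonneg _) (l2_add_le f g) 2
  have h2 : l2 f * l2 g ≤ a * b :=
    mul_le_mul ha hb (l2_nonneg g) ((l2_nonneg f).trans ha)
  nlinarith

/-- Two finitely supported functions are covered by finitely many common slices. -/
lemma exists_slices {R B : Type*} [Fintype R] (e : ι ≃ R × B) (f g : ι →₀ ℂ) :
    ∃ S : Finset B, normSq f = ∑ b ∈ S, ∑ r, ‖f (e.symm (r, b))‖ ^ 2 ∧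
      normSq g = ∑ b ∈ S, ∑ r, ‖g (e.symm (r, b))‖ ^ 2 := by
  classical
  set S : Finset B := (f.support ∪ g.support).image fun i => (e i).2
  have key : ∀ h : ι →₀ ℂ, h.support ⊆ f.support ∪ g.support →
      normSq h = ∑ b ∈ S, ∑ r, ‖h (e.symm (r, b))‖ ^ 2 := by
    intro h hs
    have hsub : h.support ⊆ (Finset.univ ×ˢ S).map e.symm.toEmbedding := by
      intro i hi
      rw [Finset.mem_map]
      refine ⟨e i, ?_, by simp⟩
      rw [Finset.mem_product]
      exact ⟨Finset.mem_univ _, Finset.mem_image_of_mem _ (hs hi)⟩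
    rw [normSq_eq_sum h hsub, Finset.sum_map, Finset.sum_product_right]
    rfl
  exact ⟨S, key f Finset.subset_union_left, key g Finset.subset_union_right⟩

lemma normSq_le_of_slices {R B : Type*} [Fintype R] (e : ι ≃ R × B) {f g : ι →₀ ℂ} {c : ℝ}
    (h : ∀ b, ∑ r, ‖g (e.symm (r, b))‖ ^ 2 ≤ c * ∑ r, ‖f (e.symm (r, b))‖ ^ 2) :
    normSq g ≤ c * normSq f := by
  obtain ⟨S, hf, hg⟩ := exists_slices e f g
  rw [hf, hg, Finset.mul_sum]
  exact Finset.sum_le_sum fun b _ => h b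

lemma normSq_eq_of_slices {R B : Type*} [Fintype R] (e : ι ≃ R × B) {f g : ι →₀ ℂ}
    (h : ∀ b, ∑ r, ‖g (e.symm (r, b))‖ ^ 2 = ∑ r, ‖f (e.symm (r, b))‖ ^ 2) :
    normSq g = normSq f := by
  obtain ⟨S, hf, hg⟩ := exists_slices e f g
  rw [hf, hg]
  exact Finset.sum_congr rfl fun b _ => h b

end NormSq

/-! ### The operators of the verifier and of the prover in coordinates -/

namespace Tape

variable {Δ : Type} {blank : Δ}

/-- The tapes whose first `m` cells are blank. -/
def Tail (Δ : Type) (blank : Δ) (m : ℕ) : Type :=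
  {y : Tape Δ blank // ∀ j < m, y.1 j = blank}

lemma ext' {y y' : Tape Δ blank} (h : ∀ j, y.1 j = y'.1 j) : y = y' :=
  Subtype.ext (funext h)

lemma overwrite_apply (m : ℕ) (z : Fin m → Δ) (y : Tape Δ blank) (j : ℕ) :
    (y.overwrite m z).1 j = if h : j < m then z ⟨j, h⟩ else y.1 j := rfl

lemma initial_overwrite (m : ℕ) (z : Fin m → Δ) (y : Tape Δ blank) :
    (y.overwrite m z).initial m = z := by
  funext j
  simp [initial, overwrite_apply]

lemma overwrite_overwrite (m : ℕ) (z z' : Fin m → Δ) (y : Tape Δ blank) :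
    (y.overwrite m z).overwrite m z' = y.overwrite m z' := by
  refine ext' fun j => ?_
  by_cases h : j < m <;> simp [overwrite_apply, h]

lemma overwrite_initial (m : ℕ) (y : Tape Δ blank) : y.overwrite m (y.initial m) = y := by
  refine ext' fun j => ?_
  by_cases h : j < m <;> simp [overwrite_apply, h, initial]

/-- Separate the first `m` cells from the rest of the tape. -/
def splitEquiv (Γ : Type) (Δ : Type) (blank : Δ) (m : ℕ) :
    Γ × Tape Δ blank ≃ (Γ × (Fin m → Δ)) × Tail Δ blank m where
  toFun c := ((c.1, c.2.initial m), ⟨c.2.overwrite m fun _ => blank, fun j hj => by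
    simp [overwrite_apply, hj]⟩)
  invFun d := (d.1.1, d.2.1.overwrite m d.1.2)
  left_inv := by
    rintro ⟨γ, y⟩
    simp [overwrite_overwrite, overwrite_initial]
  right_inv := by
    rintro ⟨⟨γ, z⟩, ⟨y, hy⟩⟩
    have h : (y.overwrite m z).overwrite m (fun _ => blank) = y := by
      refine ext' fun j => ?_
      by_cases h : j < m
      · simp [overwrite_apply, h, hy j h]
      · simp [overwrite_apply, h]
    simp [initial_overwrite, h]

lemma splitEquiv_symm (Γ : Type) (m : ℕ)
    (r : Γ × (Fin m → Δ)) (b : Tail Δ blank m) :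
    (splitEquiv Γ Δ blank m).symm (r, b) = (r.1, b.1.overwrite m r.2) := rfl

end Tape

section Operators

variable {α : Type} (V : Verifier α) (P : Prover α V.Γ) (x : List α)

/-- The position of a configuration in coordinates (verifier part, private tape). -/
def configEquiv : Config V P ≃ (V.Q × V.Γ) × P.PTape := (Equiv.prodAssoc _ _ _).symm

lemma verifierOp_apply (σ : TapeSym α) (Ψ : Config V P →₀ ℂ) (q : V.Q) (γ : V.Γ) (y : P.PTape) :
    verifierOp V P σ Ψ (q, γ, y) = ∑ s : V.Q × V.Γ, V.δ s.1 σ s.2 q γ * Ψ (s.1, s.2, y) := by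
  classical
  induction Ψ using Finsupp.induction_linear with
  | zero => simp
  | add f g hf hg => simp only [map_add, Finsupp.add_apply, hf, hg, mul_add, Finset.sum_add_distrib]
  | single c a =>
    obtain ⟨q', γ', y'⟩ := c
    rw [verifierOp, Finsupp.linearCombination_single, Finsupp.smul_apply, Finsupp.finsetSum_apply]
    have h1 : ∀ r : V.Q × V.Γ, (Finsupp.single (r.1, r.2, y') (V.δ q' σ γ' r.1 r.2) :
        Config V P →₀ ℂ) (q, γ, y) = if r = (q, γ) then (if y' = y then V.δ q' σ γ' q γ else 0)
          else 0 := by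
      rintro ⟨r1, r2⟩
      rw [Finsupp.single_apply]
      by_cases h : (r1, r2) = (q, γ)
      · obtain ⟨rfl, rfl⟩ := Prod.mk.inj h
        simp
      · rw [if_neg h, if_neg]
        rintro ⟨⟩
        exact h rfl
    have h2 : ∀ s : V.Q × V.Γ, V.δ s.1 σ s.2 q γ * (Finsupp.single (q', γ', y') a :
        Config V P →₀ ℂ) (s.1, s.2, y) = if s = (q', γ') then
          (if y' = y then V.δ q' σ γ' q γ * a else 0) else 0 := by
      rintro ⟨r1, r2⟩
      rw [Finsupp.single_apply]
      by_cases h : (r1, r2) = (q', γ')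
      · obtain ⟨rfl, rfl⟩ := Prod.mk.inj h
        by_cases hy : y' = y <;> simp [hy]
      · rw [if_neg h, if_neg, mul_zero]
        rintro ⟨⟩
        exact h rfl
    rw [Finset.sum_congr rfl fun r _ => h1 r, Finset.sum_congr rfl fun r _ => h2 r]
    simp only [Finset.sum_ite_eq', Finset.mem_univ, if_true, smul_eq_mul]
    split_ifs <;> ring

lemma normSq_verifierOp (σ : TapeSym α) (Ψ : Config V P →₀ ℂ) :
    normSq (verifierOp V P σ Ψ) = normSq Ψ := by
  refine normSq_eq_of_slices (configEquiv V P) fun y => ?_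
  have h := sum_norm_sq_mulVec (V.wellFormed σ) fun s => Ψ (s.1, s.2, y)
  refine Eq.trans ?_ h
  refine Finset.sum_congr rfl fun r _ => ?_
  change ‖verifierOp V P σ Ψ (r.1, r.2, y)‖ ^ 2 = _
  rw [verifierOp_apply]
  rfl

/-- For each fixed content of the untouched cells the prover acts by the finite matrix `S`; this
reduces statements about infinite tapes to finite unitary matrices. -/
lemma Prover.U_apply {Γ : Type} [Fintype Γ] [DecidableEq Γ] (P : Prover α Γ) (i : ℕ)
    (f : Γ × P.PTape →₀ ℂ) (r : Γ × (Fin (P.cells x i) → P.Δ))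
    (b : Tape.Tail P.Δ P.blank (P.cells x i)) :
    P.U x i f ((Tape.splitEquiv Γ P.Δ P.blank (P.cells x i)).symm (r, b)) =
      ∑ s, (P.S x i).1 r s * f ((Tape.splitEquiv Γ P.Δ P.blank (P.cells x i)).symm (s, b)) := by
  classical
  set e := Tape.splitEquiv Γ P.Δ P.blank (P.cells x i) with he
  induction f using Finsupp.induction_linear with
  | zero => simp
  | add f g hf hg => simp only [map_add, Finsupp.add_apply, hf, hg, mul_add, Finset.sum_add_distrib]
  | single c a =>
    obtain ⟨⟨s0, b0⟩, rfl⟩ := e.symm.surjective c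
    have h0 : P.U x i (Finsupp.single (e.symm (s0, b0)) a) =
        a • ∑ w, Finsupp.single (e.symm (w, b0)) ((P.S x i).1 w s0) := by
      rw [Prover.U, Finsupp.linearCombination_single]
      congr 1
      refine Finset.sum_congr rfl fun w _ => ?_
      rw [he, Tape.splitEquiv_symm, Tape.splitEquiv_symm]
      simp only [Tape.overwrite_overwrite, Tape.initial_overwrite]
    rw [h0, Finsupp.smul_apply, Finsupp.finsetSum_apply]
    simp only [Finsupp.single_apply, EmbeddingLike.apply_eq_iff_eq, Prod.mk.injEq]
    by_cases hb : b0 = b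
    · simp [hb, mul_comm]
    · simp [hb]

lemma proverOp_single (i : ℕ) (q : V.Q) (c : V.Γ × P.PTape) (a : ℂ) (q' : V.Q)
    (c' : V.Γ × P.PTape) :
    proverOp V P x i (Finsupp.single (q, c) a) (q', c') =
      if q = q' then a * P.U x i (Finsupp.single c 1) c' else 0 := by
  classical
  rw [proverOp, Finsupp.linearCombination_single, Finsupp.smul_apply]
  by_cases h : q = q'
  · subst h
    rw [Finsupp.mapDomain_apply (Prod.mk_right_injective q), if_pos rfl, smul_eq_mul]
  · rw [if_neg h, Finsupp.mapDomain_of_notMem_range, smul_zero]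
    rintro ⟨d, hd⟩
    exact h (congrArg Prod.fst hd)

lemma proverOp_apply (i : ℕ) (Ψ : Config V P →₀ ℂ) (q : V.Q)
    (r : V.Γ × (Fin (P.cells x i) → P.Δ)) (b : Tape.Tail P.Δ P.blank (P.cells x i)) :
    proverOp V P x i Ψ (q, (Tape.splitEquiv V.Γ P.Δ P.blank (P.cells x i)).symm (r, b)) =
      ∑ s, (P.S x i).1 r s *
        Ψ (q, (Tape.splitEquiv V.Γ P.Δ P.blank (P.cells x i)).symm (s, b)) := by
  classical
  induction Ψ using Finsupp.induction_linear with
  | zero => simp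
  | add f g hf hg => simp only [map_add, Finsupp.add_apply, hf, hg, mul_add, Finset.sum_add_distrib]
  | single c a =>
    obtain ⟨q0, c0⟩ := c
    rw [proverOp_single, Prover.U_apply]
    simp only [Finsupp.single_apply, Prod.mk.injEq]
    by_cases hq : q0 = q
    · simp only [hq, true_and, if_true, Finset.mul_sum]
      refine Finset.sum_congr rfl fun s _ => ?_
      split_ifs <;> ring
    · simp [hq]

lemma normSq_proverOp (i : ℕ) (Ψ : Config V P →₀ ℂ) :
    normSq (proverOp V P x i Ψ) = normSq Ψ := by
  set e := Tape.splitEquiv V.Γ P.Δ P.blank (P.cells x i) with he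
  -- The inner state joins the untouched cells as part of the slice index, so that each slice is
  -- transformed by the single matrix `S`.
  let e' : Config V P ≃ (V.Γ × (Fin (P.cells x i) → P.Δ)) ×
      (Tape.Tail P.Δ P.blank (P.cells x i) × V.Q) :=
    ((Equiv.prodComm _ _).trans (e.prodCongr (Equiv.refl _))).trans (Equiv.prodAssoc _ _ _)
  refine normSq_eq_of_slices e' fun bq => ?_
  obtain ⟨b, q⟩ := bq
  have h := sum_norm_sq_mulVec (P.S x i).2 fun s => Ψ (q, e.symm (s, b))
  refine Eq.trans ?_ h
  refine Finset.sum_congr rfl fun r _ => ?_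
  change ‖proverOp V P x i Ψ (q, e.symm (r, b))‖ ^ 2 = _
  rw [proverOp_apply]
  rfl

/-- A configuration with non-zero amplitude after the prover's move has a predecessor. -/
lemma exists_of_proverOp_ne_zero {i : ℕ} {Ψ : Config V P →₀ ℂ} {c' : Config V P}
    (h : proverOp V P x i Ψ c' ≠ 0) :
    ∃ c, Ψ c ≠ 0 ∧ proverOp V P x i (Finsupp.single c 1) c' ≠ 0 := by
  by_contra hcon
  push Not at hcon
  apply h
  rw [← Finsupp.sum_single Ψ, Finsupp.sum, map_sum, Finsupp.finsetSum_apply]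
  refine Finset.sum_eq_zero fun c hc => ?_
  have := hcon c (Finsupp.mem_support_iff.1 hc)
  rw [← mul_one (Ψ c), ← smul_eq_mul, ← Finsupp.smul_single, map_smul, Finsupp.smul_apply, this,
    smul_zero]

/-- A configuration with non-zero amplitude after the verifier's move has a predecessor. -/
lemma exists_of_verifierOp_ne_zero {σ : TapeSym α} {Ψ : Config V P →₀ ℂ} {c' : Config V P}
    (h : verifierOp V P σ Ψ c' ≠ 0) :
    ∃ c, Ψ c ≠ 0 ∧ verifierOp V P σ (Finsupp.single c 1) c' ≠ 0 := by
  by_contra hcon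
  push Not at hcon
  apply h
  rw [← Finsupp.sum_single Ψ, Finsupp.sum, map_sum, Finsupp.finsetSum_apply]
  refine Finset.sum_eq_zero fun c hc => ?_
  have := hcon c (Finsupp.mem_support_iff.1 hc)
  rw [← mul_one (Ψ c), ← smul_eq_mul, ← Finsupp.smul_single, map_smul, Finsupp.smul_apply, this,
    smul_zero]

lemma verifierOp_single_apply (σ : TapeSym α) (c c' : Config V P) :
    verifierOp V P σ (Finsupp.single c 1) c' =
      open Classical in if c.2.2 = c'.2.2 then V.δ c.1 σ c.2.1 c'.1 c'.2.1 else 0 := by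
  classical
  obtain ⟨q', γ', y'⟩ := c
  obtain ⟨q, γ, y⟩ := c'
  rw [verifierOp_apply, Fintype.sum_eq_single (q', γ')]
  · by_cases h : y' = y <;> simp [h]
  · rintro ⟨r1, r2⟩ hne
    rw [Finsupp.single_apply, if_neg, mul_zero]
    rintro ⟨⟩
    exact hne rfl

end Operators

end QIPSharp

namespace QIPSharp

lemma normSq_eq_sum_filter {ι K : Type*} [Fintype K] [DecidableEq K] (f : ι →₀ ℂ) (g : ι → K) :
    normSq f = ∑ k, normSq (f.filter fun i => g i = k) := by
  classical
  have h : ∀ k, normSq (f.filter fun i => g i = k) =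
      ∑ i ∈ f.support, if g i = k then ‖f i‖ ^ 2 else 0 := by
    intro k
    rw [normSq_eq_sum _ (s := f.support) (by
      rw [Finsupp.support_filter]; exact Finset.filter_subset _ _)]
    refine Finset.sum_congr rfl fun i _ => ?_
    by_cases hi : g i = k <;> simp [hi]
  rw [Finset.sum_congr rfl fun k _ => h k, Finset.sum_comm, normSq_eq_sum f subset_rfl]
  exact Finset.sum_congr rfl fun i _ => by simp

/-! ### Rounds, and the weights of halting -/

section Rounds

variable {α : Type} (V : Verifier α) (P : Prover α V.Γ) (x : List α)

/-- The part of a superposition with a given status. -/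
noncomputable def statusPart (s : Status) (Ψ : Config V P →₀ ℂ) : Config V P →₀ ℂ :=
  Ψ.filter fun c => V.status c.1 = s

/-- One round: the verifier scans `σ`, the measurement retains the non-halting part, and the prover
applies his `i`-th operation. -/
noncomputable def round (i : ℕ) (σ : TapeSym α) (Ψ : Config V P →₀ ℂ) : Config V P →₀ ℂ :=
  proverOp V P x i (nonHaltingPart V P (verifierOp V P σ Ψ))

/-- The rounds in which the verifier scans the symbols of a list, the prover starting with his
`i`-th operation. -/
noncomputable def rounds : ℕ → List (TapeSym α) → (Config V P →₀ ℂ) → (Config V P →₀ ℂ)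
  | _, [], Ψ => Ψ
  | i, σ :: w, Ψ => rounds (i + 1) w (round V P x i σ Ψ)

/-- The total squared norm of the parts that halt with status `s` during the rounds in which the
verifier scans the symbols of a list. -/
noncomputable def weight (s : Status) : ℕ → List (TapeSym α) → (Config V P →₀ ℂ) → ℝ
  | _, [], _ => 0
  | i, σ :: w, Ψ =>
    normSq (statusPart V P s (verifierOp V P σ Ψ)) + weight s (i + 1) w (round V P x i σ Ψ)

lemma round_add (i : ℕ) (σ : TapeSym α) (Ψ Φ : Config V P →₀ ℂ) :
    round V P x i σ (Ψ + Φ) = round V P x i σ Ψ + round V P x i σ Φ := by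
  simp only [round, nonHaltingPart, map_add, Finsupp.filter_add]

lemma rounds_add (i : ℕ) (w : List (TapeSym α)) (Ψ Φ : Config V P →₀ ℂ) :
    rounds V P x i w (Ψ + Φ) = rounds V P x i w Ψ + rounds V P x i w Φ := by
  induction w generalizing i Ψ Φ with
  | nil => rfl
  | cons σ w ih => simp only [rounds, round_add, ih]

lemma rounds_append (i : ℕ) (u w : List (TapeSym α)) (Ψ : Config V P →₀ ℂ) :
    rounds V P x i (u ++ w) Ψ = rounds V P x (i + u.length) w (rounds V P x i u Ψ) := by
  induction u generalizing i Ψ with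
  | nil => rfl
  | cons σ u ih =>
    simp only [List.cons_append, rounds, ih, List.length_cons]
    congr 1
    omega

lemma weight_append (s : Status) (i : ℕ) (u w : List (TapeSym α)) (Ψ : Config V P →₀ ℂ) :
    weight V P x s i (u ++ w) Ψ =
      weight V P x s i u Ψ + weight V P x s (i + u.length) w (rounds V P x i u Ψ) := by
  induction u generalizing i Ψ with
  | nil => simp [weight, rounds]
  | cons σ u ih =>
    simp only [List.cons_append, rounds, weight, ih, List.length_cons, add_assoc]
    rw [add_comm u.length 1]

lemma weight_nonneg (s : Status) (i : ℕ) (w : List (TapeSym α)) (Ψ : Config V P →₀ ℂ) :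
    0 ≤ weight V P x s i w Ψ := by
  induction w generalizing i Ψ with
  | nil => exact le_rfl
  | cons σ w ih => exact add_nonneg (normSq_nonneg _) (ih _ _)

instance : Fintype Status where
  elems := {Status.non, Status.acc, Status.rej}
  complete := by rintro ⟨⟩ <;> simp

lemma sum_status (f : Status → ℝ) : ∑ s, f s = f Status.non + f Status.acc + f Status.rej := by
  change ∑ s ∈ ({Status.non, Status.acc, Status.rej} : Finset Status), f s = _
  rw [Finset.sum_insert (by simp), Finset.sum_insert (by simp), Finset.sum_singleton, add_assoc]

lemma normSq_round (i : ℕ) (σ : TapeSym α) (Ψ : Config V P →₀ ℂ) :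
    normSq (statusPart V P Status.acc (verifierOp V P σ Ψ)) +
      normSq (statusPart V P Status.rej (verifierOp V P σ Ψ)) +
      normSq (round V P x i σ Ψ) = normSq Ψ := by
  rw [round, normSq_proverOp, ← normSq_verifierOp V P σ Ψ,
    normSq_eq_sum_filter (verifierOp V P σ Ψ) fun c => V.status c.1, sum_status]
  simp only [statusPart, nonHaltingPart]
  ring

/-- Conservation of probability. -/
lemma weight_add_weight_add_normSq (i : ℕ) (w : List (TapeSym α)) (Ψ : Config V P →₀ ℂ) :
    weight V P x Status.acc i w Ψ + weight V P x Status.rej i w Ψ +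
      normSq (rounds V P x i w Ψ) = normSq Ψ := by
  induction w generalizing i Ψ with
  | nil => simp [weight, rounds]
  | cons σ w ih =>
    have h1 := ih (i + 1) (round V P x i σ Ψ)
    have h2 := normSq_round V P x i σ Ψ
    simp only [weight, rounds]
    linarith

lemma normSq_rounds_le (i : ℕ) (w : List (TapeSym α)) (Ψ : Config V P →₀ ℂ) :
    normSq (rounds V P x i w Ψ) ≤ normSq Ψ := by
  have := weight_add_weight_add_normSq V P x i w Ψ
  have := weight_nonneg V P x Status.acc i w Ψ
  have := weight_nonneg V P x Status.rej i w Ψ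
  linarith

lemma l2_rounds_le (i : ℕ) (w : List (TapeSym α)) (Ψ : Config V P →₀ ℂ) :
    l2 (rounds V P x i w Ψ) ≤ l2 Ψ :=
  Real.sqrt_le_sqrt (normSq_rounds_le V P x i w Ψ)

/-- The input enclosed by the endmarkers. -/
def tapeWord (x : List α) : List (TapeSym α) :=
  TapeSym.left :: x.map TapeSym.letter ++ [TapeSym.right]

lemma scanned_of_lt {x : List α} {t : ℕ} (h : t < x.length) :
    scanned x (t + 1) = TapeSym.letter x[t] := by
  simp [scanned, h]

lemma scanned_of_ge {x : List α} {t : ℕ} (h : x.length ≤ t) :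
    scanned x (t + 1) = TapeSym.right := by
  simp [scanned, h]

lemma map_scanned_range (x : List α) :
    (List.range (x.length + 2)).map (scanned x) = tapeWord x := by
  refine List.ext_getElem (by simp [tapeWord]) fun t h1 h2 => ?_
  rw [List.getElem_map, List.getElem_range]
  rcases t with _ | t
  · rfl
  · simp only [tapeWord, List.cons_append, List.getElem_cons_succ]
    by_cases ht : t < x.length
    · rw [scanned_of_lt ht, List.getElem_append_left (by simpa using ht), List.getElem_map]
    · rw [scanned_of_ge (not_lt.1 ht), List.getElem_append_right (by simpa using ht)]
      simp

lemma stateBefore_eq_rounds (t : ℕ) :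
    stateBefore V P x t = rounds V P x 0 ((List.range t).map (scanned x))
      (Finsupp.single (initialConfig V P) 1) := by
  induction t with
  | zero => rfl
  | succ t ih =>
    rw [List.range_succ, List.map_append, rounds_append, ← ih]
    simp [rounds, round, stateBefore]

lemma probAt_eq (s : Status) (t : ℕ) :
    probAt V P x s t =
      normSq (statusPart V P s (verifierOp V P (scanned x t) (stateBefore V P x t))) := by
  classical
  rw [statusPart, normSq_eq_sum _ (s := (stateMoved V P x t).support) (by
    rw [Finsupp.support_filter]; exact Finset.filter_subset _ _)]
  refine Finset.sum_congr rfl fun c _ => ?_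
  by_cases h : V.status c.1 = s <;> simp [h, stateMoved]

lemma sum_probAt_eq_weight (s : Status) (n : ℕ) :
    ∑ t ∈ Finset.range n, probAt V P x s t =
      weight V P x s 0 ((List.range n).map (scanned x))
        (Finsupp.single (initialConfig V P) 1) := by
  induction n with
  | zero => rfl
  | succ n ih =>
    rw [Finset.sum_range_succ, ih, List.range_succ, List.map_append, weight_append,
      ← stateBefore_eq_rounds, probAt_eq]
    simp [weight]

lemma accProb_eq_weight : accProb V P x =
    weight V P x Status.acc 0 (tapeWord x) (Finsupp.single (initialConfig V P) 1) := by
  rw [accProb, sum_probAt_eq_weight, map_scanned_range]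

lemma rejProb_eq_weight : rejProb V P x =
    weight V P x Status.rej 0 (tapeWord x) (Finsupp.single (initialConfig V P) 1) := by
  rw [rejProb, sum_probAt_eq_weight, map_scanned_range]

/-- All configurations in a round start are non-halting. -/
lemma status_of_stateBefore_ne_zero {t : ℕ} {c : Config V P} (h : stateBefore V P x t c ≠ 0) :
    V.status c.1 = Status.non := by
  classical
  rcases t with _ | t
  · rw [stateBefore, Finsupp.single_apply] at h
    have : initialConfig V P = c := by by_contra hc; simp [hc] at h
    rw [← this]
    exact V.q₀_non
  · obtain ⟨c', h1, h2⟩ := exists_of_proverOp_ne_zero V P x h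
    obtain ⟨q', d'⟩ := c'
    obtain ⟨q, d⟩ := c
    rw [proverOp_single] at h2
    have hq : q' = q := by by_contra hq; simp [hq] at h2
    by_contra hs
    exact h1 (Finsupp.filter_apply_neg _ _ (by rw [hq]; exact hs))

lemma stateMeasured_eq_zero_of_right {t : ℕ} (h : scanned x t = TapeSym.right) :
    stateMeasured V P x t = 0 := by
  ext c
  by_contra hc
  rw [stateMeasured, nonHaltingPart, Finsupp.coe_zero, Pi.zero_apply, ← ne_eq,
    Finsupp.filter_apply] at hc
  have hs : V.status c.1 = Status.non := by by_contra hs; simp [hs] at hc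
  rw [if_pos hs] at hc
  obtain ⟨c', h1, h2⟩ := exists_of_verifierOp_ne_zero V P hc
  rw [verifierOp_single_apply, h, V.halts _ _ _ _ (status_of_stateBefore_ne_zero V P x h1) hs] at h2
  simp at h2

/-- The protocol halts with probability one. -/
lemma accProb_add_rejProb : accProb V P x + rejProb V P x = 1 := by
  have h := weight_add_weight_add_normSq V P x 0 (tapeWord x)
    (Finsupp.single (initialConfig V P) 1)
  rw [← accProb_eq_weight, ← rejProb_eq_weight, normSq_single, norm_one, one_pow,
    ← map_scanned_range, ← stateBefore_eq_rounds] at h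
  have h0 : stateBefore V P x (x.length + 2) = 0 := by
    have := stateMeasured_eq_zero_of_right V P x (t := x.length + 1) (scanned_of_ge le_rfl)
    change proverOp V P x _ (stateMeasured V P x (x.length + 1)) = 0
    rw [this, map_zero]
  rw [h0, normSq_zero, add_zero] at h
  exact h

/-- Every configuration that survives the measurement with non-zero amplitude lies on a path. -/
lemma exists_computationPath (t : ℕ) {c : Config V P} (hc : stateMeasured V P x t c ≠ 0) :
    ∃ γ : ComputationPath V P x, γ.rounds = t + 1 ∧ γ.after t = c := by
  have hpred : ∀ {t : ℕ} {c : Config V P}, stateMeasured V P x t c ≠ 0 →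
      ∃ b, stateBefore V P x t b ≠ 0 ∧
        verifierOp V P (scanned x t) (Finsupp.single b 1) c ≠ 0 := by
    intro t c hc
    rw [stateMeasured, nonHaltingPart, Finsupp.filter_apply] at hc
    refine exists_of_verifierOp_ne_zero V P (Ψ := stateBefore V P x t) ?_
    intro h0
    rw [stateMoved, h0] at hc
    simp at hc
  induction t generalizing c with
  | zero =>
    obtain ⟨b, hb, hbc⟩ := hpred hc
    have hbegin : b = initialConfig V P := by
      classical
      rw [stateBefore, Finsupp.single_apply] at hb
      by_contra hne
      exact hb (if_neg (Ne.symm hne))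
    exact ⟨{ rounds := 1, before := fun _ => b, after := fun _ => c, start := hbegin
             verifier_move := fun t ht => by obtain rfl : t = 0 := by omega
                                             exact hbc
             after_ne_zero := fun t ht => by obtain rfl : t = 0 := by omega
                                             exact hc
             prover_move := fun t ht => by omega
             before_ne_zero := fun t ht => by obtain rfl : t = 0 := by omega
                                              exact hb }, rfl, rfl⟩
  | succ t ih =>
    obtain ⟨b, hb, hbc⟩ := hpred hc
    obtain ⟨a, ha, hab⟩ := exists_of_proverOp_ne_zero V P x
      (Ψ := stateMeasured V P x t) (i := t) (c' := b) hb
    obtain ⟨γ, hγ, hγa⟩ := ih ha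
    refine ⟨{ rounds := t + 2
              before := Function.update γ.before (t + 1) b
              after := Function.update γ.after (t + 1) c
              start := by rw [Function.update_of_ne (by omega)]; exact γ.start
              verifier_move := ?_
              after_ne_zero := ?_
              prover_move := ?_
              before_ne_zero := ?_ }, rfl, by simp⟩
    · intro s hs
      rcases eq_or_ne s (t + 1) with rfl | hne
      · simpa using hbc
      · rw [Function.update_of_ne hne, Function.update_of_ne hne]
        exact γ.verifier_move s (by omega)
    · intro s hs
      rcases eq_or_ne s (t + 1) with rfl | hne
      · simpa using hc
      · rw [Function.update_of_ne hne]
        exact γ.after_ne_zero s (by omega)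
    · intro s hs
      rw [Function.update_of_ne (by omega : s ≠ t + 1)]
      rcases eq_or_ne s t with rfl | hne
      · simpa [hγa] using hab
      · rw [Function.update_of_ne (by omega)]
        exact γ.prover_move s (by omega)
    · intro s hs
      rcases eq_or_ne s (t + 1) with rfl | hne
      · simpa using hb
      · rw [Function.update_of_ne hne]
        exact γ.before_ne_zero s (by omega)

end Rounds

end QIPSharp

namespace QIPSharp

/-! ### Slices of superpositions, and operators on the inner state -/

section Slices

variable {α : Type} (V : Verifier α) (P : Prover α V.Γ) (x : List α)

/-- The amplitudes of the inner states for given contents of the communication cell and of the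
private tape. -/
noncomputable def slice {V : Verifier α} {P : Prover α V.Γ} (Ψ : Config V P →₀ ℂ)
    (c : V.Γ × P.PTape) : EuclideanSpace ℂ V.Q :=
  WithLp.toLp 2 fun q => Ψ (q, c)

lemma slice_apply {V : Verifier α} {P : Prover α V.Γ} (Ψ : Config V P →₀ ℂ)
    (c : V.Γ × P.PTape) (q : V.Q) : slice Ψ c q = Ψ (q, c) := rfl

lemma slice_add {V : Verifier α} {P : Prover α V.Γ} (Ψ Φ : Config V P →₀ ℂ)
    (c : V.Γ × P.PTape) : slice (Ψ + Φ) c = slice Ψ c + slice Φ c := rfl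

lemma slice_ext {V : Verifier α} {P : Prover α V.Γ} {Ψ Φ : Config V P →₀ ℂ}
    (h : ∀ c, slice Ψ c = slice Φ c) : Ψ = Φ := by
  ext ⟨q, c⟩
  rw [← slice_apply Ψ, h, slice_apply]

/-- The operator `A` acting on the inner state only. -/
noncomputable def liftQ (A : EuclideanSpace ℂ V.Q →L[ℂ] EuclideanSpace ℂ V.Q) :
    (Config V P →₀ ℂ) →ₗ[ℂ] (Config V P →₀ ℂ) :=
  Finsupp.linearCombination ℂ fun c : Config V P =>
    ∑ q, Finsupp.single (q, c.2) (A (EuclideanSpace.single c.1 1) q)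

lemma slice_liftQ (A : EuclideanSpace ℂ V.Q →L[ℂ] EuclideanSpace ℂ V.Q) (Ψ : Config V P →₀ ℂ)
    (c : V.Γ × P.PTape) : slice (liftQ V P A Ψ) c = A (slice Ψ c) := by
  classical
  induction Ψ using Finsupp.induction_linear with
  | zero =>
    rw [map_zero]
    have h0 : slice (0 : Config V P →₀ ℂ) c = 0 := by ext q; rfl
    rw [h0, map_zero]
  | add f g hf hg => rw [map_add, slice_add, hf, hg, slice_add, map_add]
  | single d a =>
    obtain ⟨q0, c0⟩ := d
    have h1 : liftQ V P A (Finsupp.single (q0, c0) a) =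
        a • ∑ q, Finsupp.single (q, c0) (A (EuclideanSpace.single q0 1) q) := by
      rw [liftQ, Finsupp.linearCombination_single]
    have h2 : slice (Finsupp.single (q0, c0) a : Config V P →₀ ℂ) c =
        (if c0 = c then a else 0) • EuclideanSpace.single q0 (1 : ℂ) := by
      ext q
      rw [slice_apply, Finsupp.single_apply]
      by_cases hc : c0 = c
      · by_cases hq : q0 = q
        · simp [hc, hq]
        · simp [hc, hq, Ne.symm hq]
      · simp [hc]
    rw [h1, h2, map_smul]
    ext q
    rw [slice_apply, Finsupp.smul_apply, Finsupp.finsetSum_apply]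
    simp only [Finsupp.single_apply, Prod.mk.injEq]
    by_cases hc : c0 = c <;> simp [hc]

lemma liftQ_comp (A B : EuclideanSpace ℂ V.Q →L[ℂ] EuclideanSpace ℂ V.Q)
    (Ψ : Config V P →₀ ℂ) : liftQ V P (A.comp B) Ψ = liftQ V P A (liftQ V P B Ψ) :=
  slice_ext fun c => by simp only [slice_liftQ, ContinuousLinearMap.comp_apply]

lemma normSq_liftQ_le (A : EuclideanSpace ℂ V.Q →L[ℂ] EuclideanSpace ℂ V.Q)
    (Ψ : Config V P →₀ ℂ) {k : ℝ} (hA : ∀ c, ‖A (slice Ψ c)‖ ≤ k * ‖slice Ψ c‖) :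
    normSq (liftQ V P A Ψ) ≤ k ^ 2 * normSq Ψ := by
  refine normSq_le_of_slices (Equiv.refl (V.Q × (V.Γ × P.PTape))) fun c => ?_
  have h1 : ∑ q, ‖Ψ (q, c)‖ ^ 2 = ‖slice Ψ c‖ ^ 2 := by
    rw [EuclideanSpace.norm_sq_eq]; rfl
  have h2 : ∑ q, ‖liftQ V P A Ψ (q, c)‖ ^ 2 = ‖A (slice Ψ c)‖ ^ 2 := by
    rw [← slice_liftQ, EuclideanSpace.norm_sq_eq]; rfl
  change ∑ q, ‖liftQ V P A Ψ (q, c)‖ ^ 2 ≤ k ^ 2 * ∑ q, ‖Ψ (q, c)‖ ^ 2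
  rw [h1, h2, ← mul_pow]
  exact pow_le_pow_left₀ (norm_nonneg _) (hA c) 2

lemma l2_liftQ_le (A : EuclideanSpace ℂ V.Q →L[ℂ] EuclideanSpace ℂ V.Q)
    (Ψ : Config V P →₀ ℂ) {k : ℝ} (hk : 0 ≤ k) (hA : ∀ c, ‖A (slice Ψ c)‖ ≤ k * ‖slice Ψ c‖) :
    l2 (liftQ V P A Ψ) ≤ k * l2 Ψ := by
  rw [l2, l2, ← Real.sqrt_sq hk, ← Real.sqrt_mul (sq_nonneg k)]
  exact Real.sqrt_le_sqrt (normSq_liftQ_le V P A Ψ hA)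

lemma slice_proverOp (i : ℕ) (Ψ : Config V P →₀ ℂ)
    (r : V.Γ × (Fin (P.cells x i) → P.Δ)) (b : Tape.Tail P.Δ P.blank (P.cells x i)) :
    slice (proverOp V P x i Ψ) ((Tape.splitEquiv V.Γ P.Δ P.blank (P.cells x i)).symm (r, b)) =
      ∑ s, (P.S x i).1 r s •
        slice Ψ ((Tape.splitEquiv V.Γ P.Δ P.blank (P.cells x i)).symm (s, b)) := by
  ext q
  rw [slice_apply, proverOp_apply]
  simp [slice_apply]

/-- The two operators act on different tensor factors: the prover forms linear combinations of
slices with scalar coefficients, and `A` is linear on each slice. The argument that a silent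
verifier cannot be influenced rests on this. -/
lemma liftQ_proverOp (A : EuclideanSpace ℂ V.Q →L[ℂ] EuclideanSpace ℂ V.Q) (i : ℕ)
    (Ψ : Config V P →₀ ℂ) :
    liftQ V P A (proverOp V P x i Ψ) = proverOp V P x i (liftQ V P A Ψ) := by
  refine slice_ext fun c => ?_
  obtain ⟨⟨r, b⟩, rfl⟩ := (Tape.splitEquiv V.Γ P.Δ P.blank (P.cells x i)).symm.surjective c
  simp only [slice_liftQ, slice_proverOp, map_sum, map_smul]

/-- All slices lie in the subspace `C`. -/
def SlicesIn {V : Verifier α} {P : Prover α V.Γ}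
    (C : Submodule ℂ (EuclideanSpace ℂ V.Q)) (Ψ : Config V P →₀ ℂ) : Prop :=
  ∀ c, slice Ψ c ∈ C

lemma SlicesIn.prover {V : Verifier α} {P : Prover α V.Γ} {x : List α}
    {C : Submodule ℂ (EuclideanSpace ℂ V.Q)} {Ψ : Config V P →₀ ℂ}
    (h : SlicesIn C Ψ) (i : ℕ) : SlicesIn C (proverOp V P x i Ψ) := by
  intro c
  obtain ⟨⟨r, b⟩, rfl⟩ := (Tape.splitEquiv V.Γ P.Δ P.blank (P.cells x i)).symm.surjective c
  rw [slice_proverOp]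
  exact Submodule.sum_mem _ fun s _ => Submodule.smul_mem _ _ (h _)

lemma SlicesIn.mono {V : Verifier α} {P : Prover α V.Γ}
    {C D : Submodule ℂ (EuclideanSpace ℂ V.Q)} {Ψ : Config V P →₀ ℂ}
    (h : SlicesIn C Ψ) (hCD : C ≤ D) : SlicesIn D Ψ := fun c => hCD (h c)

lemma SlicesIn.add {V : Verifier α} {P : Prover α V.Γ}
    {C : Submodule ℂ (EuclideanSpace ℂ V.Q)} {Ψ Φ : Config V P →₀ ℂ}
    (h : SlicesIn C Ψ) (h' : SlicesIn C Φ) : SlicesIn C (Ψ + Φ) := fun c => by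
  rw [slice_add]
  exact C.add_mem (h c) (h' c)

/-- The communication cell is blank in all configurations of non-zero amplitude. -/
def BlankComm {V : Verifier α} {P : Prover α V.Γ} (Ψ : Config V P →₀ ℂ) : Prop :=
  ∀ c : Config V P, Ψ c ≠ 0 → c.2.1 = V.blank

/-- The private tape holds only contents that may appear after `i` operations. -/
def TapeIn {V : Verifier α} {P : Prover α V.Γ} (x : List α) (i : ℕ) (Ψ : Config V P →₀ ℂ) : Prop :=
  ∀ c : Config V P, Ψ c ≠ 0 → c.2.2 ∈ P.reachable x i

lemma BlankComm.add {V : Verifier α} {P : Prover α V.Γ} {Ψ Φ : Config V P →₀ ℂ}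
    (h : BlankComm Ψ) (h' : BlankComm Φ) : BlankComm (Ψ + Φ) := by
  intro c hc
  by_contra hb
  have h1 : Ψ c = 0 := by by_contra h1; exact hb (h c h1)
  have h2 : Φ c = 0 := by by_contra h2; exact hb (h' c h2)
  exact hc (by rw [Finsupp.add_apply, h1, h2, add_zero])

lemma TapeIn.add {V : Verifier α} {P : Prover α V.Γ} {x : List α} {i : ℕ}
    {Ψ Φ : Config V P →₀ ℂ} (h : TapeIn x i Ψ) (h' : TapeIn x i Φ) : TapeIn x i (Ψ + Φ) := by
  intro c hc
  by_contra hb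
  have h1 : Ψ c = 0 := by by_contra h1; exact hb (h c h1)
  have h2 : Φ c = 0 := by by_contra h2; exact hb (h' c h2)
  exact hc (by rw [Finsupp.add_apply, h1, h2, add_zero])

variable {V P x}

lemma BlankComm.slice_eq_zero {Ψ : Config V P →₀ ℂ} (h : BlankComm Ψ) {γ : V.Γ}
    (hγ : γ ≠ V.blank) (y : P.PTape) : slice Ψ (γ, y) = 0 := by
  ext q
  by_contra hq
  exact hγ (h (q, γ, y) hq)

lemma TapeIn.prover {i : ℕ} {Ψ : Config V P →₀ ℂ} (h : TapeIn x i Ψ) :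
    TapeIn x (i + 1) (proverOp V P x i Ψ) := by
  rintro ⟨q, γ, y⟩ hc
  obtain ⟨⟨q', γ', y'⟩, h1, h2⟩ := exists_of_proverOp_ne_zero V P x hc
  rw [proverOp_single] at h2
  refine ⟨y', h _ h1, γ', γ, fun h0 => h2 ?_⟩
  rw [h0, mul_zero, ite_self]

/-- Committedness speaks only of tape contents that may appear; this is why `TapeIn` is carried
along together with `BlankComm`. -/
lemma BlankComm.prover (hP : P.Committed V.blank) {i : ℕ} {Ψ : Config V P →₀ ℂ}
    (h : BlankComm Ψ) (ht : TapeIn x i Ψ) : BlankComm (proverOp V P x i Ψ) := by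
  classical
  rintro ⟨q, γ, y⟩ hc
  obtain ⟨⟨q', γ', y'⟩, h1, h2⟩ := exists_of_proverOp_ne_zero V P x hc
  obtain rfl : γ' = V.blank := h _ h1
  rw [proverOp_single] at h2
  obtain ⟨ψ, hψ⟩ := hP x i y' (ht _ h1)
  rw [hψ] at h2
  by_contra hb
  apply h2
  rw [Finsupp.mapDomain_of_notMem_range, mul_zero, ite_self]
  rintro ⟨d, hd⟩
  exact hb (congrArg Prod.fst hd).symm

lemma TapeIn.verifier {i : ℕ} {Ψ : Config V P →₀ ℂ} (h : TapeIn x i Ψ) (σ : TapeSym α) :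
    TapeIn x i (verifierOp V P σ Ψ) := by
  intro c hc
  obtain ⟨c', h1, h2⟩ := exists_of_verifierOp_ne_zero V P hc
  rw [verifierOp_single_apply] at h2
  have : c'.2.2 = c.2.2 := by by_contra hne; simp [hne] at h2
  exact this ▸ h _ h1

lemma TapeIn.filter {i : ℕ} {Ψ : Config V P →₀ ℂ} (h : TapeIn x i Ψ)
    (p : Config V P → Prop) [DecidablePred p] : TapeIn x i (Ψ.filter p) := by
  intro c hc
  refine h c fun h0 => hc ?_
  rw [Finsupp.filter_apply, h0, ite_self]

lemma TapeIn.lift {i : ℕ} {Ψ : Config V P →₀ ℂ} (h : TapeIn x i Ψ)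
    (A : EuclideanSpace ℂ V.Q →L[ℂ] EuclideanSpace ℂ V.Q) : TapeIn x i (liftQ V P A Ψ) := by
  rintro ⟨q, c⟩ hc
  by_contra hb
  have h0 : slice Ψ c = 0 := by
    ext q'
    by_contra hq
    exact hb (h (q', c) hq)
  rw [← slice_apply, slice_liftQ, h0, map_zero] at hc
  exact hc rfl

lemma BlankComm.lift {Ψ : Config V P →₀ ℂ} (h : BlankComm Ψ)
    (A : EuclideanSpace ℂ V.Q →L[ℂ] EuclideanSpace ℂ V.Q) : BlankComm (liftQ V P A Ψ) := by
  rintro ⟨q, γ, y⟩ hc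
  by_contra hb
  rw [← slice_apply, slice_liftQ, h.slice_eq_zero hb, map_zero] at hc
  exact hc rfl

end Slices

/-! ### The verifier's action on a blank communication cell -/

section Emit

variable {α : Type} (V : Verifier α)

/-- The amplitudes after the verifier's move from a blank communication cell. -/
noncomputable def emit (σ : TapeSym α) (v : EuclideanSpace ℂ V.Q) (r : V.Q × V.Γ) : ℂ :=
  ∑ q, V.δ q σ V.blank r.1 r.2 * v q

lemma sum_norm_sq_emit (σ : TapeSym α) (v : EuclideanSpace ℂ V.Q) :
    ∑ r, ‖emit V σ v r‖ ^ 2 = ‖v‖ ^ 2 := by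
  have h := sum_norm_sq_mulVec (V.wellFormed σ) fun s => if s.2 = V.blank then v s.1 else 0
  rw [EuclideanSpace.norm_sq_eq]
  convert h using 1
  · refine Finset.sum_congr rfl fun r _ => ?_
    congr 2
    simp [emit, Matrix.mulVec, dotProduct, Fintype.sum_prod_type]
  · rw [Fintype.sum_prod_type]
    refine Finset.sum_congr rfl fun q _ => ?_
    rw [Fintype.sum_eq_single V.blank]
    · simp
    · intro γ hγ
      simp [hγ]

/-- The verifier's move from a blank communication cell to the symbol `γ`, restricted to the inner
states with a property `p`. -/
noncomputable def block (σ : TapeSym α) (γ : V.Γ) (p : V.Q → Prop) [DecidablePred p] :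
    EuclideanSpace ℂ V.Q →L[ℂ] EuclideanSpace ℂ V.Q :=
  LinearMap.toContinuousLinearMap
    { toFun := fun v => WithLp.toLp 2 fun q => if p q then emit V σ v (q, γ) else 0
      map_add' := fun u v => by
        ext q
        by_cases h : p q <;> simp [h, emit, mul_add, Finset.sum_add_distrib]
      map_smul' := fun c v => by
        ext q
        by_cases h : p q <;> simp [h, emit, Finset.mul_sum, mul_left_comm] }

lemma block_apply (σ : TapeSym α) (γ : V.Γ) (p : V.Q → Prop) [DecidablePred p]
    (v : EuclideanSpace ℂ V.Q) (q : V.Q) :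
    block V σ γ p v q = if p q then emit V σ v (q, γ) else 0 := rfl

/-- The verifier's move that keeps the communication cell blank and does not halt. -/
noncomputable def silent (σ : TapeSym α) : EuclideanSpace ℂ V.Q →L[ℂ] EuclideanSpace ℂ V.Q :=
  block V σ V.blank fun q => V.status q = Status.non

lemma silent_apply (σ : TapeSym α) (v : EuclideanSpace ℂ V.Q) (q : V.Q) :
    silent V σ v q = if V.status q = Status.non then emit V σ v (q, V.blank) else 0 := rfl

lemma norm_sq_silent_eq (σ : TapeSym α) (v : EuclideanSpace ℂ V.Q) :
    ‖silent V σ v‖ ^ 2 = ∑ r : V.Q × V.Γ,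
      if V.status r.1 = Status.non ∧ r.2 = V.blank then ‖emit V σ v r‖ ^ 2 else 0 := by
  rw [EuclideanSpace.norm_sq_eq, Fintype.sum_prod_type]
  refine Finset.sum_congr rfl fun q _ => ?_
  rw [Fintype.sum_eq_single V.blank, silent_apply]
  · by_cases h : V.status q = Status.non <;> simp [h]
  · intro γ hγ
    simp [hγ]

lemma norm_silent_le (σ : TapeSym α) (v : EuclideanSpace ℂ V.Q) : ‖silent V σ v‖ ≤ ‖v‖ := by
  refine le_of_sq_le_sq ?_ (norm_nonneg v)
  rw [norm_sq_silent_eq, ← sum_norm_sq_emit V σ v]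
  refine Finset.sum_le_sum fun r _ => ?_
  split_ifs
  · exact le_rfl
  · positivity

/-- If the silent move preserves the norm, then the verifier neither halts nor queries. -/
lemma emit_eq_zero_of_norm_silent {σ : TapeSym α} {v : EuclideanSpace ℂ V.Q}
    (h : ‖silent V σ v‖ = ‖v‖) {r : V.Q × V.Γ}
    (hr : ¬ (V.status r.1 = Status.non ∧ r.2 = V.blank)) : emit V σ v r = 0 := by
  have h1 := norm_sq_silent_eq V σ v
  rw [h, ← sum_norm_sq_emit V σ v] at h1
  have h2 := (Finset.sum_eq_sum_iff_of_le fun r _ => by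
    show (if V.status r.1 = Status.non ∧ r.2 = V.blank then ‖emit V σ v r‖ ^ 2 else 0) ≤
      ‖emit V σ v r‖ ^ 2
    split_ifs
    · exact le_rfl
    · positivity).1 h1.symm r (Finset.mem_univ r)
  rw [if_neg hr] at h2
  simpa using h2.symm

variable {V} {P : Prover α V.Γ} {x : List α}

lemma BlankComm.verifierOp_apply {Ψ : Config V P →₀ ℂ} (h : BlankComm Ψ) (σ : TapeSym α)
    (q : V.Q) (γ : V.Γ) (y : P.PTape) :
    verifierOp V P σ Ψ (q, γ, y) = emit V σ (slice Ψ (V.blank, y)) (q, γ) := by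
  rw [QIPSharp.verifierOp_apply, Fintype.sum_prod_type, emit]
  refine Finset.sum_congr rfl fun q' _ => ?_
  rw [Fintype.sum_eq_single V.blank]
  · rfl
  · intro γ' hγ'
    have : Ψ (q', γ', y) = 0 := by
      by_contra hne
      exact hγ' (h _ hne)
    rw [this, mul_zero]

/-- An isometric operator that commutes with all operators on the inner state. -/
structure IsLocal (R : (Config V P →₀ ℂ) → (Config V P →₀ ℂ)) : Prop where
  comm : ∀ A Ψ, liftQ V P A (R Ψ) = R (liftQ V P A Ψ)
  norm : ∀ Ψ, normSq (R Ψ) = normSq Ψ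

lemma IsLocal.id : IsLocal (V := V) (P := P) fun Ψ => Ψ := ⟨fun _ _ => rfl, fun _ => rfl⟩

lemma IsLocal.prover {R : (Config V P →₀ ℂ) → (Config V P →₀ ℂ)} (hR : IsLocal R) (i : ℕ) :
    IsLocal fun Ψ => proverOp V P x i (R Ψ) where
  comm A Ψ := by rw [liftQ_proverOp, hR.comm]
  norm Ψ := by rw [normSq_proverOp, hR.norm]

/-- Sorted by the symbol written, the move is a family of operators on the inner state alone, and
these commute with local operations. -/
lemma BlankComm.normSq_filter_verifierOp {Ψ : Config V P →₀ ℂ} (h : BlankComm Ψ)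
    (σ : TapeSym α) (p : V.Q × V.Γ → Prop) [DecidablePred p] :
    normSq ((verifierOp V P σ Ψ).filter fun c => p (c.1, c.2.1)) =
      ∑ γ, normSq (liftQ V P (block V σ γ fun q => p (q, γ)) Ψ) := by
  classical
  rw [normSq_eq_sum_filter _ fun c => c.2.1]
  refine Finset.sum_congr rfl fun γ _ => ?_
  refine normSq_eq_of_slices (configEquiv V P) fun y => ?_
  change ∑ r : V.Q × V.Γ, ‖(((verifierOp V P σ Ψ).filter fun c => p (c.1, c.2.1)).filter
      fun c => c.2.1 = γ) (r.1, r.2, y)‖ ^ 2 =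
    ∑ r : V.Q × V.Γ, ‖slice (liftQ V P (block V σ γ fun q => p (q, γ)) Ψ) (r.2, y) r.1‖ ^ 2
  rw [Fintype.sum_prod_type, Fintype.sum_prod_type]
  refine Finset.sum_congr rfl fun q _ => ?_
  rw [Fintype.sum_eq_single γ, Fintype.sum_eq_single V.blank]
  · rw [slice_liftQ, block_apply]
    simp only [Finsupp.filter_apply, if_true]
    rw [h.verifierOp_apply]
  · intro γ' hγ'
    rw [slice_liftQ, h.slice_eq_zero hγ', map_zero]
    simp
  · intro γ' hγ'
    simp [hγ']

/-- The prover's local operations do not influence the verifier's next move. -/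
lemma IsLocal.normSq_filter_verifierOp {R : (Config V P →₀ ℂ) → (Config V P →₀ ℂ)}
    (hR : IsLocal R) {Ψ : Config V P →₀ ℂ} (h : BlankComm Ψ) (h' : BlankComm (R Ψ))
    (σ : TapeSym α) (p : V.Q × V.Γ → Prop) [DecidablePred p] :
    normSq ((verifierOp V P σ (R Ψ)).filter fun c => p (c.1, c.2.1)) =
      normSq ((verifierOp V P σ Ψ).filter fun c => p (c.1, c.2.1)) := by
  rw [h.normSq_filter_verifierOp, h'.normSq_filter_verifierOp]
  refine Finset.sum_congr rfl fun γ _ => ?_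
  rw [hR.comm, hR.norm]

end Emit

end QIPSharp

namespace QIPSharp

/-! ### The language `oddLang` -/

lemma nil_notMem_oddLang : [] ∉ oddLang := by
  rintro ⟨m, z, h, -⟩
  have := congrArg List.length h
  simp at this

lemma cons_one_mem_oddLang {z : List (Fin 2)} : 1 :: z ∈ oddLang ↔ Odd (z.count 0) := by
  constructor
  · rintro ⟨m, z', h, ho⟩
    rcases m with _ | m
    · simp only [List.replicate_zero, List.nil_append, List.cons.injEq, true_and] at h
      rwa [h]
    · simp [List.replicate_succ] at h
  · intro h
    exact ⟨0, z, rfl, h⟩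

lemma cons_zero_mem_oddLang {w : List (Fin 2)} : 0 :: w ∈ oddLang ↔ w ∈ oddLang := by
  constructor
  · rintro ⟨m, z, h, ho⟩
    rcases m with _ | m
    · simp at h
    · simp only [List.replicate_succ, List.cons_append, List.cons.injEq, true_and] at h
      exact ⟨m, z, h, ho⟩
  · rintro ⟨m, z, rfl, ho⟩
    exact ⟨m + 1, z, rfl, ho⟩

/-! ### One-way quantum finite automata -/

namespace OneWayQFA

variable {α : Type} (M : OneWayQFA α)

/-- The part with status `s` after the operator for `σ`. -/
noncomputable def part (s : Status) (σ : TapeSym α) :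
    EuclideanSpace ℂ M.Q →L[ℂ] EuclideanSpace ℂ M.Q :=
  LinearMap.toContinuousLinearMap
    { toFun := fun v => WithLp.toLp 2 fun q =>
        if M.status q = s then (M.op σ).1.mulVec v q else 0
      map_add' := fun u v => by
        ext q
        by_cases h : M.status q = s <;> simp [h, Matrix.mulVec_add]
      map_smul' := fun c v => by
        ext q
        by_cases h : M.status q = s <;> simp [h, Matrix.mulVec_smul] }

lemma part_apply (s : Status) (σ : TapeSym α) (v : EuclideanSpace ℂ M.Q) (q : M.Q) :
    M.part s σ v q = if M.status q = s then (M.op σ).1.mulVec v q else 0 := rfl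

lemma norm_sq_part (s : Status) (σ : TapeSym α) (v : EuclideanSpace ℂ M.Q) :
    ‖M.part s σ v‖ ^ 2 = ∑ q, if M.status q = s then ‖(M.op σ).1.mulVec v q‖ ^ 2 else 0 := by
  rw [EuclideanSpace.norm_sq_eq]
  refine Finset.sum_congr rfl fun q _ => ?_
  rw [part_apply]
  split_ifs <;> simp

lemma norm_sq_part_add (σ : TapeSym α) (v : EuclideanSpace ℂ M.Q) :
    ‖M.part Status.non σ v‖ ^ 2 + ‖M.part Status.acc σ v‖ ^ 2 + ‖M.part Status.rej σ v‖ ^ 2 =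
      ‖v‖ ^ 2 := by
  rw [← sum_status fun s => ‖M.part s σ v‖ ^ 2]
  simp only [norm_sq_part]
  rw [Finset.sum_comm, EuclideanSpace.norm_sq_eq, ← sum_norm_sq_mulVec (M.op σ).2]
  exact Finset.sum_congr rfl fun q _ => by simp

lemma norm_part_le (s : Status) (σ : TapeSym α) (v : EuclideanSpace ℂ M.Q) :
    ‖M.part s σ v‖ ≤ ‖v‖ := by
  refine le_of_sq_le_sq ?_ (norm_nonneg v)
  have h := M.norm_sq_part_add σ v
  rcases s <;> nlinarith [sq_nonneg ‖M.part Status.non σ v‖, sq_nonneg ‖M.part Status.acc σ v‖,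
    sq_nonneg ‖M.part Status.rej σ v‖]

/-- The non-halting evolution for one scanned symbol. -/
noncomputable abbrev survive (σ : TapeSym α) :
    EuclideanSpace ℂ M.Q →L[ℂ] EuclideanSpace ℂ M.Q := M.part Status.non σ

/-- The total probability of halting with status `s` while the symbols of a list are scanned. -/
noncomputable def weight (s : Status) : List (TapeSym α) → EuclideanSpace ℂ M.Q → ℝ
  | [], _ => 0
  | σ :: w, v => ‖M.part s σ v‖ ^ 2 + weight s w (M.survive σ v)

lemma weight_append (s : Status) (u w : List (TapeSym α)) (v : EuclideanSpace ℂ M.Q) :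
    M.weight s (u ++ w) v = M.weight s u v + M.weight s w (wordOp M.survive u v) := by
  induction u generalizing v with
  | nil => simp [weight, wordOp]
  | cons σ u ih =>
    simp only [List.cons_append, weight, ih, wordOp, add_assoc]
    rfl

lemma weight_add_weight_le (w : List (TapeSym α)) (v : EuclideanSpace ℂ M.Q) :
    M.weight Status.acc w v + M.weight Status.rej w v ≤ ‖v‖ ^ 2 := by
  induction w generalizing v with
  | nil => simp [weight]
  | cons σ w ih =>
    have h1 := ih (M.survive σ v)
    have h2 := M.norm_sq_part_add σ v
    simp only [weight]
    linarith

/-- Each scanned symbol contributes at most `2‖u - v‖`, from `a² - b² = (a + b)(a - b)` with `a + b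
≤ 2`. -/
lemma abs_weight_sub_le (s : Status) (w : List (TapeSym α)) {u v : EuclideanSpace ℂ M.Q}
    (hu : ‖u‖ ≤ 1) (hv : ‖v‖ ≤ 1) :
    |M.weight s w u - M.weight s w v| ≤ w.length * (2 * ‖u - v‖) := by
  induction w generalizing u v with
  | nil => simp [weight]
  | cons σ w ih =>
    have h1 := ih ((M.norm_part_le Status.non σ u).trans hu)
      ((M.norm_part_le Status.non σ v).trans hv)
    have h2 : ‖M.survive σ u - M.survive σ v‖ ≤ ‖u - v‖ := by
      rw [← map_sub]; exact M.norm_part_le _ _ _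
    have h3 : |‖M.part s σ u‖ ^ 2 - ‖M.part s σ v‖ ^ 2| ≤ 2 * ‖u - v‖ := by
      rw [sq_sub_sq, abs_mul]
      have h4 : |‖M.part s σ u‖ - ‖M.part s σ v‖| ≤ ‖u - v‖ := by
        refine (abs_norm_sub_norm_le _ _).trans ?_
        rw [← map_sub]; exact M.norm_part_le _ _ _
      have h5 : |‖M.part s σ u‖ + ‖M.part s σ v‖| ≤ 2 := by
        rw [abs_of_nonneg (by positivity)]
        linarith [M.norm_part_le s σ u, M.norm_part_le s σ v]
      exact mul_le_mul h5 h4 (abs_nonneg _) (by norm_num)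
    have h6 : (w.length : ℝ) * (2 * ‖M.survive σ u - M.survive σ v‖) ≤
        w.length * (2 * ‖u - v‖) := by gcongr
    simp only [weight, List.length_cons, Nat.cast_add, Nat.cast_one]
    have h7 := abs_add_le (‖M.part s σ u‖ ^ 2 - ‖M.part s σ v‖ ^ 2)
      (M.weight s w (M.survive σ u) - M.weight s w (M.survive σ v))
    rw [show ‖M.part s σ u‖ ^ 2 + M.weight s w (M.survive σ u) -
        (‖M.part s σ v‖ ^ 2 + M.weight s w (M.survive σ v)) =
      (‖M.part s σ u‖ ^ 2 - ‖M.part s σ v‖ ^ 2) +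
      (M.weight s w (M.survive σ u) - M.weight s w (M.survive σ v)) by ring]
    linarith

lemma stateBefore_eq (x : List α) (t : ℕ) : M.stateBefore x t =
    (wordOp M.survive ((List.range t).map (scanned x)) (EuclideanSpace.single M.q₀ 1)).ofLp := by
  induction t with
  | zero =>
    simp [stateBefore, wordOp]
  | succ t ih =>
    rw [List.range_succ, List.map_append, wordOp_append]
    funext q
    rw [stateBefore, ih]
    rfl

lemma prob_eq_weight (x : List α) (s : Status) :
    M.prob x s = M.weight s (tapeWord x) (EuclideanSpace.single M.q₀ 1) := by
  rw [← map_scanned_range, prob]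
  induction x.length + 2 with
  | zero => rfl
  | succ n ih =>
    rw [Finset.sum_range_succ, ih, List.range_succ, List.map_append, weight_append,
      stateBefore_eq]
    congr 1
    simp only [List.map_cons, List.map_nil, weight, add_zero, norm_sq_part]

end OneWayQFA

/-- Encode words over two letters by words over `{0, 1}` that preserve the parity of the number of
zeros. -/
def parityCode : List Bool → List (Fin 2)
  | [] => []
  | true :: w => 1 :: parityCode w
  | false :: w => 0 :: 1 :: 0 :: parityCode w

lemma even_count_parityCode (w : List Bool) : Even ((parityCode w).count 0) := by
  induction w with
  | nil => simp [parityCode]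
  | cons b w ih =>
    cases b
    · simp only [parityCode, List.count_cons]
      simpa [Nat.even_add_one, add_assoc] using ih
    · simpa [parityCode] using ih

/-- Two codewords that drive the automaton into almost the same state are found such that appending
`0` takes one into the language and the other out of it. -/
theorem oddLang_notMem_OneQFA : oddLang ∉ OneQFA (Fin 2) := by
  rintro ⟨M, ε, hε, hacc, hrej⟩
  set T : TapeSym (Fin 2) → EuclideanSpace ℂ M.Q →L[ℂ] EuclideanSpace ℂ M.Q := M.survive with hTdef
  have hT : ∀ σ v, ‖T σ v‖ ≤ ‖v‖ := M.norm_part_le Status.non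
  let F : Bool → EuclideanSpace ℂ M.Q →L[ℂ] EuclideanSpace ℂ M.Q := fun b =>
    wordOp T ((parityCode [b]).map TapeSym.letter)
  have hF : ∀ b v, ‖F b v‖ ≤ ‖v‖ := fun b v => norm_wordOp_le hT _ v
  have hFT : ∀ w v, wordOp F w v = wordOp T ((parityCode w).map TapeSym.letter) v := by
    intro w
    induction w with
    | nil => intro v; rfl
    | cons b w ih =>
      intro v
      cases b <;> exact ih _
  set ψ : EuclideanSpace ℂ M.Q := T TapeSym.left (EuclideanSpace.single M.q₀ 1) with hψ
  have hψ1 : ‖ψ‖ ≤ 1 := (hT _ _).trans (by simp)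
  -- The function `g` below has Lipschitz constant `6` and the two states differ by at most `4δ`, so
  -- its values differ by at most `24δ = 3ε`, whereas recognition forces a gap of `4ε`.
  set δ : ℝ := ε / 8 with hδdef
  have hδ : 0 < δ := by positivity
  set ψ₁ := isoProj F hF ψ with hψ₁
  have hψ₁1 : ‖ψ₁‖ ≤ 1 := (norm_isoProj_le ψ).trans hψ1
  obtain ⟨k, hk0, hk⟩ := exists_replicate_recurrent (T := F) (hT := hF) true hδ
  obtain ⟨l, hl0, hl⟩ := exists_replicate_recurrent (T := F) (hT := hF) false hδ
  have horth := sub_isoProj_mem (T := F) (hT := hF) ψ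
  classical
  -- The word `z` is chosen after `k` and `l`, so that it shrinks what either block leaves outside
  -- the isometric subspace.
  obtain ⟨z, hz⟩ := exists_wordOp_small_finset (T := F) (hT := hF)
    {wordOp F (List.replicate k true) (ψ - ψ₁), wordOp F (List.replicate l false) (ψ - ψ₁)}
    (by
      intro u hu
      rcases Finset.mem_insert.1 hu with rfl | hu
      · exact wordOp_mem_isoSub_orthogonal horth _
      · rw [Finset.mem_singleton.1 hu]
        exact wordOp_mem_isoSub_orthogonal horth _) hδ
  have hclose : ∀ b n, (∀ v ∈ isoSub F hF, ‖wordOp F (List.replicate n b) v - v‖ ≤ δ * ‖v‖) →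
      ‖wordOp F z (wordOp F (List.replicate n b) (ψ - ψ₁))‖ ≤ δ →
      ‖wordOp F (List.replicate n b ++ z) ψ - wordOp F z ψ₁‖ ≤ 2 * δ := by
    intro b n h1 h2
    have h3 := h1 ψ₁ (isoProj_mem ψ)
    have h4 : wordOp F (List.replicate n b ++ z) ψ - wordOp F z ψ₁ =
        wordOp F z (wordOp F (List.replicate n b) ψ₁ - ψ₁) +
          wordOp F z (wordOp F (List.replicate n b) (ψ - ψ₁)) := by
      rw [wordOp_append, ← map_add, ← map_sub]
      congr 1
      rw [map_sub (wordOp F (List.replicate n b))]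
      abel
    rw [h4]
    refine (norm_add_le _ _).trans ?_
    have h5 := norm_wordOp_le hF z (wordOp F (List.replicate n b) ψ₁ - ψ₁)
    have h6 : δ * ‖ψ₁‖ ≤ δ := mul_le_of_le_one_right hδ.le hψ₁1
    linarith
  have hu := hclose true k hk (hz _ (by simp))
  have hv := hclose false l hl (hz _ (by simp))
  set u := List.replicate k true ++ z
  set v := List.replicate l false ++ z
  -- In this difference the acceptance weight collected while the word itself is read cancels;
  -- closeness of the final states gives no control over it.
  set g : EuclideanSpace ℂ M.Q → ℝ := fun φ =>
    M.weight Status.acc [TapeSym.letter 0, TapeSym.right] φ -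
      M.weight Status.acc [TapeSym.right] φ with hg
  have hdiff : ∀ w : List Bool, M.prob (parityCode w ++ [0]) Status.acc -
      M.prob (parityCode w) Status.acc = g (wordOp F w ψ) := by
    intro w
    rw [M.prob_eq_weight, M.prob_eq_weight, hFT]
    have e1 : tapeWord (parityCode w ++ [0]) =
        (TapeSym.left :: (parityCode w).map TapeSym.letter) ++
          [TapeSym.letter 0, TapeSym.right] := by simp [tapeWord]
    rw [e1, M.weight_append, tapeWord, M.weight_append]
    have e2 : wordOp M.survive (TapeSym.left :: (parityCode w).map TapeSym.letter)
        (EuclideanSpace.single M.q₀ 1) = wordOp T ((parityCode w).map TapeSym.letter) ψ := rfl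
    rw [e2, hg]
    ring
  have hle : ∀ x, M.prob x Status.acc + M.prob x Status.rej ≤ 1 := by
    intro x
    rw [M.prob_eq_weight, M.prob_eq_weight]
    simpa using M.weight_add_weight_le (tapeWord x) (EuclideanSpace.single M.q₀ 1)
  -- Since `k` and `l` are positive, the codewords begin with `1` and with `010`. In the second the
  -- leading `0` precedes the first `1` and is not counted, so the parities after the first `1`
  -- differ.
  obtain ⟨k', rfl⟩ := Nat.exists_eq_succ_of_ne_zero hk0.ne'
  obtain ⟨l', rfl⟩ := Nat.exists_eq_succ_of_ne_zero hl0.ne'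
  have hupos : 2 * ε ≤ g (wordOp F u ψ) := by
    rw [← hdiff]
    have e : parityCode u = 1 :: parityCode (List.replicate k' true ++ z) := rfl
    have hev := even_count_parityCode (List.replicate k' true ++ z)
    have m1 : parityCode u ∉ oddLang := by
      rw [e, cons_one_mem_oddLang, Nat.not_odd_iff_even]
      exact hev
    have m2 : parityCode u ++ [0] ∈ oddLang := by
      rw [e, List.cons_append, cons_one_mem_oddLang, List.count_append]
      exact hev.add_one
    linarith [hacc _ m2, hrej _ m1, hle (parityCode u)]
  have hvneg : g (wordOp F v ψ) ≤ -(2 * ε) := by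
    rw [← hdiff]
    have e : parityCode v = 0 :: 1 :: 0 :: parityCode (List.replicate l' false ++ z) := rfl
    have hev := even_count_parityCode (List.replicate l' false ++ z)
    have m1 : parityCode v ∈ oddLang := by
      rw [e, cons_zero_mem_oddLang, cons_one_mem_oddLang, List.count_cons_self]
      exact hev.add_one
    have m2 : parityCode v ++ [0] ∉ oddLang := by
      rw [e, List.cons_append, cons_zero_mem_oddLang, List.cons_append, cons_one_mem_oddLang,
        List.cons_append, List.count_cons_self, List.count_append, Nat.not_odd_iff_even]
      exact hev.add_one.add_one
    linarith [hacc _ m1, hrej _ m2, hle (parityCode v ++ [0])]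
  have hnorm : ∀ w, ‖wordOp F w ψ‖ ≤ 1 := fun w => (norm_wordOp_le hF w ψ).trans hψ1
  have hsub : ‖wordOp F u ψ - wordOp F v ψ‖ ≤ 4 * δ := by
    have := norm_sub_le_norm_sub_add_norm_sub (wordOp F u ψ) (wordOp F z ψ₁) (wordOp F v ψ)
    rw [norm_sub_rev (wordOp F z ψ₁)] at this
    linarith
  have h1 := M.abs_weight_sub_le Status.acc [TapeSym.letter 0, TapeSym.right] (hnorm u) (hnorm v)
  have h2 := M.abs_weight_sub_le Status.acc [TapeSym.right] (hnorm u) (hnorm v)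
  rw [abs_le] at h1 h2
  simp only [hg] at hupos hvneg
  norm_num at h1 h2
  linarith [h1.1, h1.2, h2.1, h2.2]

/-! ### Systems without interaction -/

section ZeroInteraction

variable {α : Type} (V : Verifier α) (P : Prover α V.Γ) {x : List α}

/-- The verifier together with the communication cell as a quantum finite automaton. -/
abbrev Verifier.toQFA : OneWayQFA α where
  Q := V.Q × V.Γ
  status r := V.status r.1
  q₀ := (V.q₀, V.blank)
  q₀_non := V.q₀_non
  op σ := ⟨_, V.wellFormed σ⟩

/-- A superposition of verifier configurations with a blank private tape. -/
noncomputable def embed (φ : V.Q × V.Γ → ℂ) : Config V P →₀ ℂ :=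
  ∑ r : V.Q × V.Γ, Finsupp.single (r.1, r.2, Tape.allBlank P.Δ P.blank) (φ r)

lemma embed_apply (φ : V.Q × V.Γ → ℂ) (q : V.Q) (γ : V.Γ) (y : P.PTape) :
    embed V P φ (q, γ, y) =
      open Classical in if y = Tape.allBlank P.Δ P.blank then φ (q, γ) else 0 := by
  classical
  rw [embed, Finsupp.finsetSum_apply, Fintype.sum_eq_single (q, γ)]
  · by_cases h : y = Tape.allBlank P.Δ P.blank
    · simp [h]
    · simp [h]
  · rintro ⟨r1, r2⟩ hne
    rw [Finsupp.single_apply, if_neg]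
    rintro ⟨⟩
    exact hne rfl

lemma normSq_embed (φ : V.Q × V.Γ → ℂ) : normSq (embed V P φ) = ∑ r, ‖φ r‖ ^ 2 := by
  classical
  let j : V.Q × V.Γ ↪ Config V P :=
    ⟨fun r => (r.1, r.2, Tape.allBlank P.Δ P.blank), fun r s h => by
      obtain ⟨r1, r2⟩ := r
      obtain ⟨s1, s2⟩ := s
      cases h
      rfl⟩
  rw [normSq_eq_sum _ (s := Finset.univ.map j), Finset.sum_map]
  · refine Finset.sum_congr rfl fun r _ => ?_
    change ‖embed V P φ (r.1, r.2, Tape.allBlank P.Δ P.blank)‖ ^ 2 = _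
    rw [embed_apply, if_pos rfl]
  · rintro ⟨q, γ, y⟩ hc
    rw [Finsupp.mem_support_iff, embed_apply] at hc
    have hy : y = Tape.allBlank P.Δ P.blank := by by_contra hy; simp [hy] at hc
    rw [hy]
    exact Finset.mem_map_of_mem j (Finset.mem_univ (q, γ))

lemma verifierOp_embed (σ : TapeSym α) (φ : V.Q × V.Γ → ℂ) :
    verifierOp V P σ (embed V P φ) = embed V P ((V.toQFA.op σ).1.mulVec φ) := by
  ext ⟨q, γ, y⟩
  rw [verifierOp_apply, embed_apply]
  simp only [embed_apply]
  split_ifs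
  · rfl
  · simp

lemma filter_embed (φ : V.Q × V.Γ → ℂ) (p : V.Q × V.Γ → Prop) [DecidablePred p] :
    (embed V P φ).filter (fun c => p (c.1, c.2.1)) = embed V P fun r => if p r then φ r else 0 := by
  ext ⟨q, γ, y⟩
  rw [Finsupp.filter_apply, embed_apply, embed_apply]
  split_ifs <;> rfl

variable {V P}

/-- A move that neither halts nor queries is the silent move. -/
lemma nonHaltingPart_eq_liftQ {σ : TapeSym α} {Ψ : Config V P →₀ ℂ} (h : BlankComm Ψ)
    (h' : BlankComm (nonHaltingPart V P (verifierOp V P σ Ψ))) :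
    nonHaltingPart V P (verifierOp V P σ Ψ) = liftQ V P (silent V σ) Ψ := by
  ext ⟨q, γ, y⟩
  by_cases hγ : γ = V.blank
  · rw [hγ, ← slice_apply (liftQ V P _ Ψ), slice_liftQ, silent_apply, ← h.verifierOp_apply]
    rfl
  · have h1 : nonHaltingPart V P (verifierOp V P σ Ψ) (q, γ, y) = 0 := by
      by_contra hne
      exact hγ (h' _ hne)
    rw [h1, ← slice_apply (liftQ V P _ Ψ), slice_liftQ, h.slice_eq_zero hγ, map_zero]
    rfl

lemma blankComm_stateMeasured (h0 : interactions V P x ≤ (0 : ℕ)) (t : ℕ) :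
    BlankComm (stateMeasured V P x t) := by
  intro c hc
  obtain ⟨γ, hγ, hγc⟩ := exists_computationPath V P x t hc
  by_contra hb
  have h1 : ((γ.queries : ℕ) : ℕ∞) ≤ ((0 : ℕ) : ℕ∞) :=
    (le_iSup (fun γ : ComputationPath V P x => (γ.queries : ℕ∞)) γ).trans h0
  have h2 : γ.queries ≤ 0 := by exact_mod_cast h1
  have h3 : 0 < γ.queries := by
    refine Finset.card_pos.2 ⟨t, ?_⟩
    rw [Finset.mem_filter, Finset.mem_range, hγ, hγc]
    exact ⟨Nat.lt_succ_self t, hb⟩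
  omega

/-- As long as nothing is queried, a committed prover changes only his tape, so the state is that of
the automaton up to a local isometry `R`. The last three conjuncts carry the induction. -/
lemma stateBefore_eq_local_embed (hP : P.Committed V.blank)
    (h0 : interactions V P x ≤ (0 : ℕ)) (t : ℕ) :
    ∃ R, IsLocal R ∧ stateBefore V P x t = R (embed V P (V.toQFA.stateBefore x t)) ∧
      BlankComm (embed V P (V.toQFA.stateBefore x t)) ∧
      BlankComm (stateBefore V P x t) ∧ TapeIn x t (stateBefore V P x t) := by
  induction t with
  | zero =>
    have h1 : embed V P (V.toQFA.stateBefore x 0) = stateBefore V P x 0 := by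
      classical
      ext ⟨q, γ, y⟩
      rw [embed_apply, stateBefore, OneWayQFA.stateBefore, Finsupp.single_apply]
      change (if y = _ then (Pi.single (V.q₀, V.blank) 1 : V.Q × V.Γ → ℂ) (q, γ) else 0) = _
      rw [Pi.single_apply, initialConfig]
      simp only [Prod.mk.injEq]
      by_cases a : q = V.q₀ <;> by_cases b : γ = V.blank <;>
        by_cases c : y = Tape.allBlank P.Δ P.blank <;> simp [a, b, c, eq_comm]
    have h2 : ∀ c, stateBefore V P x 0 c ≠ 0 → c = initialConfig V P := by
      classical
      intro c hc
      rw [stateBefore, Finsupp.single_apply] at hc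
      by_contra hne
      exact hc (if_neg (Ne.symm hne))
    have h3 : BlankComm (stateBefore V P x 0) := fun c hc => by rw [h2 c hc]; rfl
    refine ⟨fun Ψ => Ψ, IsLocal.id, h1.symm, h1 ▸ h3, h3, fun c hc => ?_⟩
    rw [h2 c hc]
    rfl
  | succ t ih =>
    obtain ⟨R, hR, hΨ, hb, hbΨ, htape⟩ := ih
    set φ := V.toQFA.stateBefore x t with hφ
    set σ := scanned x t with hσ
    have hm : BlankComm (nonHaltingPart V P (verifierOp V P σ (stateBefore V P x t))) :=
      blankComm_stateMeasured h0 t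
    have hnext : nonHaltingPart V P (verifierOp V P σ (embed V P φ)) =
        embed V P (V.toQFA.stateBefore x (t + 1)) := by
      rw [verifierOp_embed]
      exact filter_embed V P _ fun r => V.status r.1 = Status.non
    -- The interaction bound concerns the true superposition; it passes to the simulated one because
    -- `R` preserves the norm of the querying part.
    have hm' : BlankComm (nonHaltingPart V P (verifierOp V P σ (embed V P φ))) := by
      have h1 := hR.normSq_filter_verifierOp hb (hΨ ▸ hbΨ) σ
        fun r => V.status r.1 = Status.non ∧ r.2 ≠ V.blank
      have h2 : (verifierOp V P σ (R (embed V P φ))).filter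
          (fun c => V.status c.1 = Status.non ∧ c.2.1 ≠ V.blank) = 0 := by
        ext c
        rw [← hΨ, Finsupp.filter_apply]
        split_ifs with hc
        · by_contra hne
          refine hc.2 (hm c ?_)
          rw [nonHaltingPart, Finsupp.filter_apply, if_pos hc.1]
          exact hne
        · rfl
      rw [h2, normSq_zero] at h1
      have h3 := eq_zero_of_normSq_eq_zero h1.symm
      intro c hc
      by_contra hne
      have h4 := DFunLike.congr_fun h3 c
      rw [nonHaltingPart, Finsupp.filter_apply] at hc
      have hs : V.status c.1 = Status.non := by by_contra hs; simp [hs] at hc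
      rw [if_pos hs] at hc
      rw [Finsupp.filter_apply, if_pos ⟨hs, hne⟩] at h4
      exact hc h4
    have hstep : stateBefore V P x (t + 1) =
        proverOp V P x t (R (embed V P (V.toQFA.stateBefore x (t + 1)))) := by
      rw [← hnext, nonHaltingPart_eq_liftQ hb hm', ← hR.comm, ← hΨ,
        ← nonHaltingPart_eq_liftQ hbΨ hm]
      rfl
    have htm : TapeIn x t (nonHaltingPart V P (verifierOp V P σ (stateBefore V P x t))) :=
      (htape.verifier σ).filter _
    exact ⟨_, hR.prover t, hstep, hnext ▸ hm', hm.prover hP htm, htm.prover⟩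

lemma prob_toQFA_eq (hP : P.Committed V.blank) (h0 : interactions V P x ≤ (0 : ℕ)) (s : Status) :
    V.toQFA.prob x s = ∑ t ∈ Finset.range (x.length + 2), probAt V P x s t := by
  refine Finset.sum_congr rfl fun t _ => ?_
  obtain ⟨R, hR, hΨ, hb, hbΨ, -⟩ := stateBefore_eq_local_embed hP h0 t
  rw [probAt_eq]
  have h1 := hR.normSq_filter_verifierOp hb (hΨ ▸ hbΨ) (scanned x t) fun r => V.status r.1 = s
  rw [hΨ]
  refine Eq.trans ?_ h1.symm
  rw [verifierOp_embed, filter_embed V P _ fun r => V.status r.1 = s, normSq_embed]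
  refine Finset.sum_congr rfl fun r _ => ?_
  change (if V.status r.1 = s then _ else _) = _
  split_ifs
  · rfl
  · simp

end ZeroInteraction

/-- The automaton includes the communication cell in its inner state. For words outside the language
the honest prover serves as the dishonest one. -/
theorem QIPsharpBounded_zero_subset_OneQFA (α : Type) : QIPsharpBounded 0 α ⊆ OneQFA α := by
  rintro L ⟨V, P, ε, hε, ⟨hP, hacc, hrej⟩, hin, hout⟩
  refine ⟨V.toQFA, ε, hε, fun x hx => ?_, fun x hx => ?_⟩
  · rw [prob_toQFA_eq hP (hin x hx)]
    exact hacc x hx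
  · rw [prob_toQFA_eq hP (hout x hx P hP)]
    exact hrej x hx P hP

end QIPSharp

namespace QIPSharp

/-! ### Permutations as unitary operators -/

lemma perm_mem_unitaryGroup {R : Type*} [Fintype R] [DecidableEq R] (π : Equiv.Perm R) :
    (Matrix.of fun r s => if π s = r then (1 : ℂ) else 0) ∈ Matrix.unitaryGroup R ℂ := by
  rw [Matrix.mem_unitaryGroup_iff']
  ext r s
  rw [Matrix.mul_apply, Finset.sum_eq_single (π r)]
  · rw [Matrix.one_apply]
    by_cases h : r = s
    · simp [h]
    · simp [h, Ne.symm h]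
  · intro t _ ht
    simp [Matrix.star_apply, Ne.symm ht]
  · simp

section PermProver

variable {α Γ : Type}

/-- The action of a permutation of the contents of the first cells on whole tapes. -/
def tapePerm (blank : Γ) {m : ℕ} (π : Equiv.Perm (Γ × (Fin m → Γ))) :
    Equiv.Perm (Γ × Tape Γ blank) :=
  ((Tape.splitEquiv Γ Γ blank m).trans (π.prodCongr (Equiv.refl _))).trans
    (Tape.splitEquiv Γ Γ blank m).symm

lemma tapePerm_apply (blank : Γ) {m : ℕ} (π : Equiv.Perm (Γ × (Fin m → Γ)))
    (c : Γ × Tape Γ blank) : tapePerm blank π c =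
      ((π (c.1, c.2.initial m)).1, c.2.overwrite m (π (c.1, c.2.initial m)).2) := by
  refine (Tape.splitEquiv_symm Γ m _ _).trans (Prod.ext rfl ?_)
  exact Tape.overwrite_overwrite m (fun _ => blank) (π (c.1, c.2.initial m)).2 c.2

/-- Exchange the communication cell with the last of the cells. -/
def archive (i : ℕ) : Equiv.Perm (Γ × (Fin (i + 1) → Γ)) :=
  Function.Involutive.toPerm
    (fun c => (c.2 (Fin.last i), Function.update c.2 (Fin.last i) c.1))
    fun c => by simp

lemma tapePerm_archive_fst (i : ℕ) {blank : Γ} (c : Γ × Tape Γ blank) :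
    (tapePerm blank (archive i) c).1 = c.2.1 i := by
  rw [tapePerm_apply]
  rfl

lemma tapePerm_archive_snd (i : ℕ) {blank : Γ} (c : Γ × Tape Γ blank) (j : ℕ) :
    (tapePerm blank (archive i) c).2.1 j = if j = i then c.1 else c.2.1 j := by
  rw [tapePerm_apply]
  change (if h : j < i + 1 then
    Function.update (c.2.initial (i + 1)) (Fin.last i) c.1 ⟨j, h⟩ else c.2.1 j) = _
  by_cases h : j < i + 1
  · rw [dif_pos h]
    by_cases hj : j = i
    · subst hj
      rw [if_pos rfl]
      exact Function.update_self (β := fun _ => Γ) (Fin.last j) c.1 _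
    · rw [if_neg hj, Function.update_of_ne]
      · rfl
      · intro h'
        exact hj (congrArg Fin.val h')
  · rw [dif_neg h, if_neg (by omega)]

variable [Fintype Γ] [DecidableEq Γ]

/-- The prover whose `i`-th operation permutes the contents of the communication cell and of the
first `i + 1` cells of his tape. -/
abbrev permProver (α : Type) (blank : Γ) (π : ∀ i : ℕ, Equiv.Perm (Γ × (Fin (i + 1) → Γ))) :
    Prover α Γ where
  Δ := Γ
  blank := blank
  cells _ i := i + 1
  S _ i := ⟨_, perm_mem_unitaryGroup (π i)⟩

variable {blank : Γ} {π : ∀ i : ℕ, Equiv.Perm (Γ × (Fin (i + 1) → Γ))}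

lemma permProver_U (x : List α) (i : ℕ) (f : Γ × Tape Γ blank →₀ ℂ) (c : Γ × Tape Γ blank) :
    (permProver α blank π).U x i f c = f ((tapePerm blank (π i)).symm c) := by
  obtain ⟨⟨r, b⟩, rfl⟩ := (Tape.splitEquiv Γ Γ blank (i + 1)).symm.surjective c
  refine (Prover.U_apply x (permProver α blank π) i f r b).trans ?_
  rw [Fintype.sum_eq_single ((π i).symm r)]
  · have h1 : ((permProver α blank π).S x i).1 r ((π i).symm r) = 1 := by
      simp
    refine (congrArg (· * _) h1).trans ?_
    rw [one_mul]
    congr 1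
    simp [tapePerm]
  · intro s hs
    have h1 : ((permProver α blank π).S x i).1 r s = 0 := by
      simp only [Matrix.of_apply]
      rw [if_neg]
      rintro rfl
      exact hs (by simp)
    rw [h1, zero_mul]

lemma permProver_proverOp {V : Verifier α} {blank : V.Γ}
    {π : ∀ i : ℕ, Equiv.Perm (V.Γ × (Fin (i + 1) → V.Γ))} (x : List α) (i : ℕ)
    (Ψ : Config V (permProver α blank π) →₀ ℂ) (q : V.Q) (c : V.Γ × Tape V.Γ blank) :
    proverOp V (permProver α blank π) x i Ψ (q, c) = Ψ (q, (tapePerm blank (π i)).symm c) := by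
  classical
  induction Ψ using Finsupp.induction_linear with
  | zero => simp
  | add f g hf hg => rw [map_add, Finsupp.add_apply, hf, hg, Finsupp.add_apply]
  | single d a =>
    obtain ⟨q', d⟩ := d
    rw [proverOp_single, permProver_U, Finsupp.single_apply, Finsupp.single_apply]
    by_cases hq : q' = q
    · by_cases hd : d = (tapePerm blank (π i)).symm c <;> simp [hq, hd]
    · rw [if_neg hq, if_neg]
      rintro ⟨⟩
      exact hq rfl

lemma permProver_U_single (x : List α) (i : ℕ) (c c' : Γ × Tape Γ blank) :
    (permProver α blank π).U x i (Finsupp.single c 1) c' ≠ 0 ↔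
      tapePerm blank (π i) c = c' := by
  classical
  rw [permProver_U, Finsupp.single_apply, ← Equiv.eq_symm_apply]
  by_cases h : c = (tapePerm blank (π i)).symm c' <;> simp [h]

lemma permProver_committed
    (h : ∀ (x : List α) (i : ℕ), ∀ y ∈ (permProver α blank π).reachable x i,
      (tapePerm blank (π i) (blank, y)).1 = blank) :
    (permProver α blank π).Committed blank := by
  classical
  intro x i y hy
  refine ⟨Finsupp.single (tapePerm blank (π i) (blank, y)).2 1, ?_⟩
  ext c
  rw [Finsupp.mapDomain_single, permProver_U, Finsupp.single_apply, Finsupp.single_apply]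
  have : tapePerm blank (π i) (blank, y) = (blank, (tapePerm blank (π i) (blank, y)).2) :=
    Prod.ext (h x i y hy) rfl
  refine if_congr ?_ rfl rfl
  rw [Equiv.eq_symm_apply]
  exact ⟨fun hc => this ▸ hc, fun hc => this.trans hc⟩

/-- The `j`-th archiving operation changes no tape cell but cell `j`, so cell `i` is still fresh
when the `i`-th operation begins. -/
lemma reachable_of_archive (x : List α) {i : ℕ} (hπ : ∀ j < i, π j = archive j)
    {y : Tape Γ blank} (hy : y ∈ (permProver α blank π).reachable x i) :
    ∀ j, i ≤ j → y.1 j = blank := by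
  induction i generalizing y with
  | zero =>
    intro j _
    have : y = Tape.allBlank Γ blank := hy
    rw [this]
    rfl
  | succ i ih =>
    intro j hj
    obtain ⟨z, hz, σ, τ, h⟩ := hy
    have h1 : tapePerm blank (π i) (σ, z) = (τ, y) := (permProver_U_single x i _ _).1 h
    rw [hπ i (Nat.lt_succ_self i)] at h1
    have h2 := tapePerm_archive_snd i (σ, z) j
    rw [h1, if_neg (by omega)] at h2
    exact h2.trans (ih (fun j hj => hπ j (by omega)) hz j (by omega))

/-- The prover who stores the contents of the communication cell in a fresh cell of his tape. -/
abbrev archiver (α : Type) (blank : Γ) : Prover α Γ := permProver α blank archive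

/-- The communication cell receives the content of a fresh cell, which is blank. -/
lemma archiver_committed (α : Type) (blank : Γ) : (archiver α blank).Committed blank := by
  refine permProver_committed fun x i y hy => ?_
  rw [tapePerm_archive_fst]
  exact reachable_of_archive x (fun _ _ => rfl) hy i le_rfl

end PermProver

/-- All private tapes in the superposition have contents that may appear. -/
lemma tapeIn_stateBefore {α : Type} (V : Verifier α) (P : Prover α V.Γ) (x : List α) (t : ℕ) :
    TapeIn x t (stateBefore V P x t) := by
  induction t with
  | zero =>
    classical
    intro c hc
    rw [stateBefore, Finsupp.single_apply] at hc
    have : initialConfig V P = c := by by_contra hne; exact hc (if_neg hne)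
    rw [← this]
    rfl
  | succ t ih => exact ((ih.verifier _).filter _).prover

/-! ### Deterministic verifiers -/

section Deterministic

variable {α N : Type}

/-- The configuration entered from the inner state `n` with a blank communication cell. -/
def detTarget (step : α → N → N × Bool) (fin : N → Bool) :
    TapeSym α → N → (N × Status) × Bool
  | TapeSym.left, n => ((n, Status.non), false)
  | TapeSym.letter a, n => (((step a n).1, Status.non), (step a n).2)
  | TapeSym.right, n => ((n, if fin n then Status.acc else Status.rej), false)

/-- The transitions of a deterministic verifier from the non-halting inner states: he rejects if
the communication cell is not blank. -/
def detMap (step : α → N → N × Bool) (fin : N → Bool) (σ : TapeSym α)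
    (r : (N × Status) × Bool) : (N × Status) × Bool :=
  if r.2 then ((r.1.1, Status.rej), true) else detTarget step fin σ r.1.1

variable {step : α → N → N × Bool}

/-- Moves from a blank and from a non-blank cell have different images: the latter reject with the
bit `true`, while the former do not halt or, at the right endmarker, write the bit `false`. -/
lemma detMap_injOn [Fintype N] (hstep : ∀ a, Function.Injective (step a)) (fin : N → Bool)
    (σ : TapeSym α) :
    Set.InjOn (detMap step fin σ)
      ((Finset.univ.filter fun r : (N × Status) × Bool => r.1.2 = Status.non :
        Finset ((N × Status) × Bool)) : Set ((N × Status) × Bool)) := by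
  rintro ⟨⟨n, s⟩, b⟩ hr ⟨⟨n', s'⟩, b'⟩ hr' h
  simp only [Finset.coe_filter, Finset.mem_univ, true_and, Set.mem_ofPred_eq] at hr hr'
  subst hr hr'
  cases b <;> cases b' <;> cases σ <;>
    simp only [detMap, detTarget, if_true, Bool.false_eq_true, if_false, Prod.mk.injEq,
      reduceCtorEq, and_false, false_and, and_true] at h ⊢
  · exact h
  · exact hstep _ (Prod.ext h.1 h.2)
  · exact h.1
  · exact h
  · exact h
  · exact h

/-- A partial injection of a finite set into itself extends to a permutation; transitions out of
halting states are irrelevant. -/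
lemma exists_detPerm [Fintype N] [DecidableEq N]
    (hstep : ∀ a, Function.Injective (step a)) (fin : N → Bool)
    (σ : TapeSym α) :
    ∃ π : Equiv.Perm ((N × Status) × Bool), ∀ r, r.1.2 = Status.non →
      π r = detMap step fin σ r := by
  obtain ⟨g, hg⟩ := Finset.exists_equiv_extend_of_card_eq (t := Finset.univ)
    (Finset.card_univ (α := (N × Status) × Bool)).symm (Finset.subset_univ _)
    (detMap_injOn hstep fin σ)
  refine ⟨g.trans (Equiv.subtypeUnivEquiv fun r => Finset.mem_univ r), fun r hr => ?_⟩
  exact hg r (by simpa using hr)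

/-- The inner state of the simulated automaton before step `t`. -/
def detRun (step : α → N → N × Bool) (n₀ : N) (x : List α) : ℕ → N
  | 0 => n₀
  | t + 1 => (detTarget step (fun _ => true) (scanned x t) (detRun step n₀ x t)).1.1

lemma detTarget_fst (fin : N → Bool) (σ : TapeSym α) (n : N) :
    (detTarget step fin σ n).1.1 = (detTarget step (fun _ => true) σ n).1.1 := by
  cases σ <;> rfl

/-- The index is shifted by one because step `0` scans the left endmarker. -/
lemma detRun_eq_foldl (n₀ : N) (x : List α) {t : ℕ} (ht : t ≤ x.length) :
    detRun step n₀ x (t + 1) = (x.take t).foldl (fun n a => (step a n).1) n₀ := by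
  induction t with
  | zero => simp [detRun, scanned, detTarget]
  | succ t ih =>
    rw [detRun, ih (by omega), scanned_of_lt (by omega),
      List.take_succ_eq_append_getElem (by omega),
      List.foldl_append]
    rfl

variable [Fintype N] [DecidableEq N] (hstep : ∀ a, Function.Injective (step a)) (fin : N → Bool)

/-- The verifier that simulates a deterministic automaton, passing the information that would be
lost to the prover. -/
noncomputable abbrev detVerifier (n₀ : N) : Verifier α where
  Q := N × Status
  Γ := Bool
  blank := false
  status q := q.2
  q₀ := (n₀, Status.non)
  q₀_non := rfl
  δ q σ γ q' γ' := if (exists_detPerm hstep fin σ).choose (q, γ) = (q', γ') then 1 else 0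
  wellFormed σ := perm_mem_unitaryGroup _
  halts q γ q' γ' hq hq' := by
    rw [(exists_detPerm hstep fin TapeSym.right).choose_spec _ hq, if_neg]
    intro h
    have h1 : (detMap step fin TapeSym.right (q, γ)).1.2 = Status.non := by rw [h]; exact hq'
    cases γ <;> simp only [detMap, detTarget, if_true, Bool.false_eq_true, if_false] at h1
    · split_ifs at h1
    · cases h1

variable {fin} {n₀ : N} {P : Prover α Bool} {x : List α}

lemma detVerifier_move {σ : TapeSym α} {c c' : Config (detVerifier hstep fin n₀) P}
    (hc : c.1.2 = Status.non)
    (h : verifierOp (detVerifier hstep fin n₀) P σ (Finsupp.single c 1) c' ≠ 0) :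
    (c'.1, c'.2.1) = detMap step fin σ (c.1, c.2.1) := by
  rw [verifierOp_single_apply] at h
  rw [← (exists_detPerm hstep fin σ).choose_spec (c.1, c.2.1) hc]
  by_contra hne
  apply h
  have hδ : (detVerifier hstep fin n₀).δ c.1 σ c.2.1 c'.1 c'.2.1 = 0 := if_neg (Ne.symm hne)
  rw [hδ, ite_self]

lemma detVerifier_moved {t : ℕ}
    (hrun : ∀ c, stateBefore (detVerifier hstep fin n₀) P x t c ≠ 0 →
      c.1 = (detRun step n₀ x t, Status.non))
    {c : Config (detVerifier hstep fin n₀) P}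
    (h : verifierOp (detVerifier hstep fin n₀) P (scanned x t)
      (stateBefore (detVerifier hstep fin n₀) P x t) c ≠ 0) :
    ∃ b, stateBefore (detVerifier hstep fin n₀) P x t b ≠ 0 ∧
      (c.1, c.2.1) = detMap step fin (scanned x t) ((detRun step n₀ x t, Status.non), b.2.1) := by
  obtain ⟨b, hb, hbc⟩ := exists_of_verifierOp_ne_zero (detVerifier hstep fin n₀) P h
  have h1 := hrun b hb
  refine ⟨b, hb, ?_⟩
  rw [← h1]
  exact detVerifier_move hstep (by rw [h1]) hbc

lemma detVerifier_state (P : Prover α Bool) (t : ℕ) :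
    ∀ c, stateBefore (detVerifier hstep fin n₀) P x t c ≠ 0 →
      c.1 = (detRun step n₀ x t, Status.non) := by
  induction t with
  | zero =>
    classical
    intro c hc
    rw [stateBefore, Finsupp.single_apply] at hc
    have : initialConfig (detVerifier hstep fin n₀) P = c := by
      by_contra hne; exact hc (if_neg hne)
    rw [← this]
    rfl
  | succ t ih =>
    rintro ⟨q, d⟩ hc
    obtain ⟨⟨q', d'⟩, h1, h2⟩ := exists_of_proverOp_ne_zero (detVerifier hstep fin n₀) P x hc
    rw [proverOp_single] at h2
    have hq : q' = q := by by_contra hq; simp [hq] at h2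
    subst hq
    rw [nonHaltingPart, Finsupp.filter_apply] at h1
    have hs : q'.2 = Status.non := by
      by_contra hs
      exact h1 (if_neg hs)
    have h3 := fun h0 => h1 ((ite_congr rfl (fun _ => h0) fun _ => rfl).trans (ite_self 0))
    obtain ⟨b, hb, hbc⟩ := detVerifier_moved hstep ih h3
    have h4 : q' = (detMap step fin (scanned x t)
      ((detRun step n₀ x t, Status.non), b.2.1)).1 := congrArg Prod.fst hbc
    refine Prod.ext ?_ hs
    change q'.1 = (detTarget step _ (scanned x t) (detRun step n₀ x t)).1.1
    rw [← detTarget_fst fin]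
    cases hb' : (b.2.1 : Bool)
    · rw [h4, hb', detMap]
      rfl
    · rw [h4, hb', detMap] at hs
      cases hs

lemma probAt_eq_zero {V : Verifier α} {P : Prover α V.Γ} {s : Status} {t : ℕ}
    (h : ∀ c, verifierOp V P (scanned x t) (stateBefore V P x t) c ≠ 0 → V.status c.1 ≠ s) :
    probAt V P x s t = 0 := by
  rw [probAt_eq]
  have : statusPart V P s (verifierOp V P (scanned x t) (stateBefore V P x t)) = 0 := by
    ext c
    rw [statusPart, Finsupp.filter_apply]
    split_ifs with hc
    · by_contra hne
      exact h c hne hc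
    · rfl
  rw [this, normSq_zero]

lemma scanned_eq_right {t : ℕ} (ht : t < x.length + 2) (h : scanned x t = TapeSym.right) :
    t = x.length + 1 := by
  rcases t with _ | t
  · cases h
  · by_contra hne
    rw [scanned_of_lt (by omega)] at h
    cases h

/-- Acceptance is possible only at the right endmarker, from a state that the input alone
determines; replies can cause nothing but rejection. The total halting probability is one. -/
lemma detVerifier_rejProb (P : Prover α Bool)
    (hx : fin (x.foldl (fun n a => (step a n).1) n₀) = false) :
    rejProb (detVerifier hstep fin n₀) P x = 1 := by
  rw [← accProb_add_rejProb (detVerifier hstep fin n₀) P x, accProb, Finset.sum_eq_zero, zero_add]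
  intro t ht
  refine probAt_eq_zero fun c hc hs => ?_
  obtain ⟨b, -, hbc⟩ := detVerifier_moved hstep (detVerifier_state hstep P t) hc
  have h1 : c.1.2 = (detMap step fin (scanned x t)
      ((detRun step n₀ x t, Status.non), b.2.1)).1.2 := congrArg (fun r => r.1.2) hbc
  have hs' : c.1.2 = Status.acc := hs
  rw [hs'] at h1
  cases hb : (b.2.1 : Bool) <;> rw [hb] at h1
  · cases hσ : scanned x t <;> rw [hσ] at h1
    · cases h1
    · cases h1
    · have ht' := scanned_eq_right (Finset.mem_range.1 ht) hσ
      rw [ht', detRun_eq_foldl n₀ x le_rfl, List.take_length] at h1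
      simp [detMap, detTarget, hx] at h1
  · cases h1

/-- The archiving prover always returns a blank cell, so the rejection on a non-blank cell never
occurs. -/
lemma detVerifier_accProb (hx : fin (x.foldl (fun n a => (step a n).1) n₀) = true) :
    accProb (detVerifier hstep fin n₀) (archiver α (false : Bool)) x = 1 := by
  set V := detVerifier hstep fin n₀ with hV
  have hblank : ∀ t c, stateBefore V (archiver α (false : Bool)) x t c ≠ 0 →
      c.2.1 = (false : Bool) := by
    intro t c hc
    rcases t with _ | t
    · classical
      rw [stateBefore, Finsupp.single_apply] at hc
      have : initialConfig V (archiver α (false : Bool)) = c := by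
        by_contra hne; exact hc (if_neg hne)
      rw [← this]
      rfl
    · obtain ⟨q, d⟩ := c
      obtain ⟨⟨q', d'⟩, h1, h2⟩ := exists_of_proverOp_ne_zero V _ x hc
      rw [proverOp_single] at h2
      have h3 : tapePerm false (archive t) d' = d := by
        rw [← permProver_U_single (α := α) (π := archive) x t]
        intro h0
        apply h2
        change (if q' = q then 1 * ((permProver α false archive).U x t (Finsupp.single d' 1)) d
          else 0) = 0
        rw [h0, mul_zero, ite_self]
      have h4 := ((tapeIn_stateBefore V (archiver α (false : Bool)) x t).verifier
        (scanned x t)).filter (fun c => V.status c.1 = Status.non) (q', d') h1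
      have h5 := reachable_of_archive x (fun _ _ => rfl) h4 t le_rfl
      change d.1 = false
      rw [← h3, tapePerm_archive_fst]
      exact h5
  rw [← accProb_add_rejProb V (archiver α (false : Bool)) x, rejProb, Finset.sum_eq_zero, add_zero]
  intro t ht
  refine probAt_eq_zero fun c hc hs => ?_
  obtain ⟨b, hb, hbc⟩ := detVerifier_moved hstep (detVerifier_state hstep _ t) hc
  have h1 : c.1.2 = (detMap step fin (scanned x t)
      ((detRun step n₀ x t, Status.non), b.2.1)).1.2 := congrArg (fun r => r.1.2) hbc
  have hs' : c.1.2 = Status.rej := hs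
  rw [hs', hblank t b hb] at h1
  cases hσ : scanned x t <;> rw [hσ] at h1
  · cases h1
  · cases h1
  · have ht' := scanned_eq_right (Finset.mem_range.1 ht) hσ
    rw [ht', detRun_eq_foldl n₀ x le_rfl, List.take_length] at h1
    simp [detMap, detTarget, hx] at h1

/-- Deterministic verifiers recognize without error. -/
lemma detVerifier_recognizes {L : Language α}
    (hL : ∀ x, x ∈ L ↔ fin (x.foldl (fun n a => (step a n).1) n₀) = true) :
    Recognizes (detVerifier hstep fin n₀) (archiver α (false : Bool)) L (1 / 2 + 1 / 2) := by
  refine ⟨archiver_committed α (false : Bool), fun x hx => ?_, fun x hx P _ => ?_⟩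
  · rw [detVerifier_accProb hstep ((hL x).1 hx)]
    norm_num
  · rw [detVerifier_rejProb hstep P]
    · norm_num
    · rw [hL] at hx
      simpa using hx

/-- If at most one step of every run queries, then there is at most one interaction. -/
lemma detVerifier_interactions (P : Prover α Bool)
    (hq : ∀ t s a b, t < s → scanned x t = TapeSym.letter a → scanned x s = TapeSym.letter b →
      (step a (detRun step n₀ x t)).2 = true → (step b (detRun step n₀ x s)).2 = false) :
    interactions (detVerifier hstep fin n₀) P x ≤ (1 : ℕ) := by
  refine iSup_le fun γ => ?_
  have key : ∀ t ∈ (Finset.range γ.rounds).filter fun t =>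
      (γ.after t).2.1 ≠ (detVerifier hstep fin n₀).blank, ∃ a, scanned x t = TapeSym.letter a ∧
        (step a (detRun step n₀ x t)).2 = true := by
    intro t ht
    rw [Finset.mem_filter, Finset.mem_range] at ht
    have h1 := γ.after_ne_zero t ht.1
    rw [stateMeasured, nonHaltingPart, Finsupp.filter_apply] at h1
    have hs : (γ.after t).1.2 = Status.non := by
      by_contra hs
      exact h1 (if_neg hs)
    have h3 : stateMoved (detVerifier hstep fin n₀) P x t (γ.after t) ≠ 0 :=
      fun h0 => h1 ((ite_congr rfl (fun _ => h0) fun _ => rfl).trans (ite_self 0))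
    obtain ⟨b, -, hbc⟩ := detVerifier_moved hstep (detVerifier_state hstep P t) h3
    have e1 := congrArg (fun r => r.1.2) hbc
    have e2 := congrArg (fun r => r.2) hbc
    simp only at e1 e2
    have hne : ((γ.after t).2.1 : Bool) = true := by
      have : ((γ.after t).2.1 : Bool) ≠ false := ht.2
      simpa using this
    rw [hs] at e1
    rw [hne] at e2
    cases hb : (b.2.1 : Bool) <;> rw [hb] at e1 e2
    · cases hσ : scanned x t with
      | left => rw [hσ] at e2; cases e2
      | letter a => rw [hσ] at e2; exact ⟨a, rfl, e2.symm⟩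
      | right => rw [hσ] at e2; cases e2
    · cases e1
  have hcard : γ.queries ≤ 1 := by
    refine Finset.card_le_one.2 fun t ht s hs => ?_
    obtain ⟨a, ha, ha'⟩ := key t ht
    obtain ⟨b, hb, hb'⟩ := key s hs
    rcases lt_trichotomy t s with h | h | h
    · rw [hq t s a b h ha hb ha'] at hb'
      cases hb'
    · exact h
    · rw [hq s t b a h hb ha hb'] at ha'
      cases ha'
  exact_mod_cast hcard

end Deterministic

/-- The automaton that remembers whether the last letter is `0`. -/
def zeroStep (a : Fin 2) (n : Bool) : Bool × Bool := (decide (a = 0), n != decide (a = 0))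

/-- The query bit is the exclusive or of the old and the new state, hence the pair determines the
old state. -/
lemma zeroStep_injective (a : Fin 2) : Function.Injective (zeroStep a) := by
  revert a; unfold Function.Injective zeroStep; decide

theorem zeroLang_mem_QIPsharp : zeroLang ∈ QIPsharp (Fin 2) := by
  refine ⟨detVerifier zeroStep_injective (fun n => n) false, archiver _ _, 1 / 2, by norm_num,
    detVerifier_recognizes zeroStep_injective fun x => ?_⟩
  constructor
  · rintro ⟨u, rfl⟩
    simp [zeroStep]
  · intro h
    rcases List.eq_nil_or_concat x with rfl | ⟨u, a, rfl⟩
    · cases h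
    · rw [List.concat_eq_append, List.foldl_append] at h
      have ha : a = 0 := by simpa [zeroStep] using h
      exact ⟨u, by rw [ha, List.concat_eq_append]⟩

/-- The automaton for `oddLang`: state `0` before the first `1`, then the parity of the number of
zeros. -/
def oddStep (a : Fin 2) (n : Fin 3) : Fin 3 × Bool :=
  if a = 0 then (-n, false) else if n = 0 then (1, true) else (n, false)

/-- Letter `0` acts by negation in `Fin 3`, which fixes `0` and exchanges `1` and `2`. Letter `1`
merges the states `0` and `1`, and the query bit separates them. -/
lemma oddStep_injective (a : Fin 2) : Function.Injective (oddStep a) := by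
  revert a; unfold Function.Injective oddStep; decide

lemma foldl_oddStep_of_ne_zero (z : List (Fin 2)) :
    (z.foldl (fun n a => (oddStep a n).1) 1 = 2 ↔ Odd (z.count 0)) ∧
      (z.foldl (fun n a => (oddStep a n).1) 2 = 2 ↔ Even (z.count 0)) := by
  induction z with
  | nil => simp
  | cons a z ih =>
    rw [List.foldl_cons, List.foldl_cons]
    fin_cases a
    · have e1 : (oddStep 0 1).1 = 2 := by decide
      have e2 : (oddStep 0 2).1 = 1 := by decide
      simp only [Fin.zero_eta, e1, e2, ih, List.count_cons_self, Nat.odd_add_one,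
        Nat.even_add_one, Nat.not_odd_iff_even, Nat.not_even_iff_odd, and_self]
    · have e1 : (oddStep 1 1).1 = 1 := by decide
      have e2 : (oddStep 1 2).1 = 2 := by decide
      simp [e1, e2, ih]

lemma foldl_oddStep (x : List (Fin 2)) :
    x.foldl (fun n a => (oddStep a n).1) 0 = 2 ↔ x ∈ oddLang := by
  induction x with
  | nil => simpa using nil_notMem_oddLang
  | cons a z ih =>
    rw [List.foldl_cons]
    fin_cases a
    · have e1 : (oddStep 0 0).1 = 0 := by decide
      simp only [Fin.zero_eta, e1, ih, cons_zero_mem_oddLang]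
    · have e1 : (oddStep 1 0).1 = 1 := by decide
      simp only [Fin.mk_one, e1, (foldl_oddStep_of_ne_zero z).1, cons_one_mem_oddLang]

/-- A query is made only when state `0` is left, and no letter leads back to it. -/
lemma oddStep_interactions (P : Prover (Fin 2) Bool) (x : List (Fin 2)) :
    interactions (detVerifier oddStep_injective (fun n => decide (n = 2)) 0) P x ≤ (1 : ℕ) := by
  refine detVerifier_interactions oddStep_injective P fun t s a b hts ha hb hq => ?_
  have hmono : ∀ r, t + 1 ≤ r → detRun oddStep 0 x r ≠ 0 := by
    intro r hr
    induction r, hr using Nat.le_induction with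
    | base =>
      rw [detRun, ha]
      revert hq
      generalize detRun oddStep 0 x t = n
      clear ha
      change (oddStep a n).2 = true → (oddStep a n).1 ≠ 0
      revert a n
      decide
    | succ r _ ih =>
      rw [detRun]
      cases scanned x r with
      | left => exact ih
      | right => exact ih
      | letter c =>
        revert ih
        generalize detRun oddStep 0 x r = n
        change n ≠ 0 → (oddStep c n).1 ≠ 0
        revert c n
        decide
  have := hmono s hts
  revert this
  generalize detRun oddStep 0 x s = n
  clear hb
  revert b n
  decide

theorem oddLang_mem_QIPsharpBounded : oddLang ∈ QIPsharpBounded 1 (Fin 2) := by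
  refine ⟨detVerifier oddStep_injective (fun n => decide (n = 2)) 0, archiver _ _, 1 / 2,
    by norm_num, detVerifier_recognizes oddStep_injective fun x => ?_, fun x _ => ?_,
    fun x _ P _ => ?_⟩
  · rw [decide_eq_true_iff, foldl_oddStep]
  · exact oddStep_interactions _ x
  · exact oddStep_interactions P x

end QIPSharp

namespace QIPSharp

/-! ### Moves of the verifier without the prover -/

section Solo

variable {α : Type} (V : Verifier α)

/-- The non-halting part after the verifier's move on inner state and communication cell. -/
noncomputable def soloStep (σ : TapeSym α) : (V.Q × V.Γ → ℂ) →ₗ[ℂ] (V.Q × V.Γ → ℂ) where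
  toFun v r := if V.status r.1 = Status.non then ∑ s, V.δ s.1 σ s.2 r.1 r.2 * v s else 0
  map_add' u v := by
    funext r
    by_cases h : V.status r.1 = Status.non <;> simp [h, mul_add, Finset.sum_add_distrib]
  map_smul' c v := by
    funext r
    by_cases h : V.status r.1 = Status.non <;> simp [h, Finset.mul_sum, mul_left_comm]

/-- The non-halting part after several moves. -/
noncomputable def soloWord : List (TapeSym α) → (V.Q × V.Γ → ℂ) →ₗ[ℂ] (V.Q × V.Γ → ℂ)
  | [] => LinearMap.id
  | σ :: w => soloWord w ∘ₗ soloStep V σ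

lemma soloWord_append (u w : List (TapeSym α)) (v : V.Q × V.Γ → ℂ) :
    soloWord V (u ++ w) v = soloWord V w (soloWord V u v) := by
  induction u generalizing v with
  | nil => rfl
  | cons σ u ih => exact ih _

/-- Inner state amplitudes `v` with the symbol `γ` in the communication cell. -/
noncomputable def withComm (γ : V.Γ) : EuclideanSpace ℂ V.Q →ₗ[ℂ] (V.Q × V.Γ → ℂ) where
  toFun v r := if r.2 = γ then v r.1 else 0
  map_add' u v := by
    funext r
    by_cases h : r.2 = γ <;> simp [h]
  map_smul' c v := by
    funext r
    by_cases h : r.2 = γ <;> simp [h]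

lemma withComm_apply (γ : V.Γ) (v : EuclideanSpace ℂ V.Q) (r : V.Q × V.Γ) :
    withComm V γ v r = if r.2 = γ then v r.1 else 0 := rfl

lemma soloStep_withComm_blank (σ : TapeSym α) (v : EuclideanSpace ℂ V.Q) (r : V.Q × V.Γ) :
    soloStep V σ (withComm V V.blank v) r =
      if V.status r.1 = Status.non then emit V σ v r else 0 := by
  refine if_congr Iff.rfl ?_ rfl
  rw [Fintype.sum_prod_type, emit]
  refine Finset.sum_congr rfl fun q _ => ?_
  simp [withComm_apply]

/-- The inner state vectors from which the verifier never queries. -/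
noncomputable def quietSub : Submodule ℂ (EuclideanSpace ℂ V.Q) where
  carrier := {v | ∀ (w : List α) (r : V.Q × V.Γ), r.2 ≠ V.blank →
    soloWord V (w.map TapeSym.letter) (withComm V V.blank v) r = 0}
  zero_mem' := by intro w r _; simp
  add_mem' := by
    intro u v hu hv w r hr
    rw [map_add, map_add, Pi.add_apply, hu w r hr, hv w r hr, add_zero]
  smul_mem' := by
    intro c v hv w r hr
    rw [map_smul, map_smul, Pi.smul_apply, hv w r hr, smul_zero]

/-- The inner state vectors from which the verifier never queries, whatever symbol the
communication cell holds at first. -/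
noncomputable def repliedSub : Submodule ℂ (EuclideanSpace ℂ V.Q) where
  carrier := {v | ∀ (γ : V.Γ) (a : α) (w : List α) (r : V.Q × V.Γ), r.2 ≠ V.blank →
    soloWord V ((a :: w).map TapeSym.letter) (withComm V γ v) r = 0}
  zero_mem' := by intro γ a w r _; simp
  add_mem' := by
    intro u v hu hv γ a w r hr
    rw [map_add, map_add, Pi.add_apply, hu γ a w r hr, hv γ a w r hr, add_zero]
  smul_mem' := by
    intro c v hv γ a w r hr
    rw [map_smul, map_smul, Pi.smul_apply, hv γ a w r hr, smul_zero]

/-- The amplitudes of inner state and communication cell for given contents of the private tape. -/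
def tapeSlice {V : Verifier α} {P : Prover α V.Γ} (Ψ : Config V P →₀ ℂ) (y : P.PTape) :
    V.Q × V.Γ → ℂ := fun r => Ψ (r.1, r.2, y)

lemma tapeSlice_move {P : Prover α V.Γ} (σ : TapeSym α) (Ψ : Config V P →₀ ℂ) (y : P.PTape) :
    tapeSlice (nonHaltingPart V P (verifierOp V P σ Ψ)) y = soloStep V σ (tapeSlice Ψ y) := by
  funext r
  rw [tapeSlice, nonHaltingPart, Finsupp.filter_apply, verifierOp_apply]
  rfl

end Solo

/-! ### A prover that marks the replies to one query -/

section Mark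

variable {α Γ : Type}

/-- The tape whose only non-blank cell holds `γ` at position `t`. -/
def markTape (blank : Γ) (t : ℕ) (γ : Γ) : Tape Γ blank :=
  ⟨fun j => if j = t then γ else blank, (Set.finite_singleton t).subset fun j hj => by
    by_contra hne
    exact hj (if_neg hne)⟩

lemma tapePerm_eq_self {blank : Γ} {m : ℕ} {π : Equiv.Perm (Γ × (Fin m → Γ))}
    {c : Γ × Tape Γ blank} (h : π (c.1, c.2.initial m) = (c.1, c.2.initial m)) :
    tapePerm blank π c = c := by
  rw [tapePerm_apply, h, Tape.overwrite_initial]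

lemma tapePerm_one (blank : Γ) {m : ℕ} (c : Γ × Tape Γ blank) :
    tapePerm blank (1 : Equiv.Perm (Γ × (Fin m → Γ))) c = c := tapePerm_eq_self rfl

variable [DecidableEq Γ]

/-- Reply `γ'` to the query `γ`, and mark the tape. -/
def replyPerm (blank γ γ' : Γ) (t : ℕ) : Equiv.Perm (Γ × (Fin (t + 1) → Γ)) :=
  Equiv.swap (γ, fun _ => blank) (γ', fun j => if j = Fin.last t then γ else blank)

lemma tapePerm_replyPerm (blank γ γ' : Γ) (t : ℕ) :
    tapePerm blank (replyPerm blank γ γ' t) (γ, Tape.allBlank Γ blank) =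
      (γ', markTape blank t γ) := by
  have h : replyPerm blank γ γ' t (γ, (Tape.allBlank Γ blank).initial (t + 1)) =
      (γ', fun j => if j = Fin.last t then γ else blank) := Equiv.swap_apply_left _ _
  rw [tapePerm_apply, h]
  refine Prod.ext rfl (Tape.ext' fun j => ?_)
  change (if h : j < t + 1 then (if (⟨j, h⟩ : Fin (t + 1)) = Fin.last t then γ else blank)
    else blank) = if j = t then γ else blank
  by_cases hj : j = t
  · subst hj
    rw [dif_pos (Nat.lt_succ_self _), if_pos rfl]
    exact if_pos rfl
  · rw [if_neg hj]
    split_ifs with h1 h2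
    · exact absurd (congrArg Fin.val h2) hj
    · rfl
    · rfl

/-- The reply acts on tapes that are blank from cell `t` on only by answering the query `γ`. -/
lemma tapePerm_replyPerm_cases {blank γ : Γ} (γ' : Γ) {t : ℕ} (hγ : γ ≠ blank)
    {c : Γ × Tape Γ blank} (hc : ∀ j, t ≤ j → c.2.1 j = blank) :
    c = (γ, Tape.allBlank Γ blank) ∨ tapePerm blank (replyPerm blank γ γ' t) c = c := by
  by_cases h1 : (c.1, c.2.initial (t + 1)) = (γ, fun _ => blank)
  · left
    refine Prod.ext (Prod.mk.inj h1).1 (Tape.ext' fun j => ?_)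
    by_cases hj : j < t + 1
    · exact congrFun (Prod.mk.inj h1).2 ⟨j, hj⟩
    · exact hc j (by omega)
  · right
    refine tapePerm_eq_self (Equiv.swap_apply_of_ne_of_ne h1 fun h2 => ?_)
    have h3 := congrFun (congrArg Prod.snd h2) (Fin.last t)
    simp only [if_true] at h3
    exact hγ (h3.symm.trans (hc t le_rfl))

/-- The mark certifies its origin: it arises only from the query `γ` asked with a blank tape.
Distinct branches thus cannot interfere with the marked one. -/
lemma eq_of_tapePerm_replyPerm {blank γ γ' : Γ} {t : ℕ} (hγ : γ ≠ blank)
    {c : Γ × Tape Γ blank} (hc : ∀ j, t ≤ j → c.2.1 j = blank)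
    (h : (tapePerm blank (replyPerm blank γ γ' t) c).2 = markTape blank t γ) :
    c = (γ, Tape.allBlank Γ blank) := by
  rcases tapePerm_replyPerm_cases γ' hγ hc with h1 | h1
  · exact h1
  · rw [h1] at h
    have h2 := hc t le_rfl
    rw [h] at h2
    exact absurd ((if_pos rfl).symm.trans h2) hγ

/-- Archive before round `t`, reply in round `t`, and do nothing afterwards. -/
def markPerm (blank γ γ' : Γ) (t i : ℕ) : Equiv.Perm (Γ × (Fin (i + 1) → Γ)) :=
  if i < t then archive i else if i = t then replyPerm blank γ γ' i else 1

lemma markPerm_of_lt (blank γ γ' : Γ) {t i : ℕ} (h : i < t) :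
    markPerm blank γ γ' t i = archive i := if_pos h

lemma markPerm_self (blank γ γ' : Γ) (t : ℕ) :
    markPerm blank γ γ' t t = replyPerm blank γ γ' t := by
  rw [markPerm, if_neg (lt_irrefl t), if_pos rfl]

lemma markPerm_of_gt (blank γ γ' : Γ) {t i : ℕ} (h : t < i) : markPerm blank γ γ' t i = 1 := by
  rw [markPerm, if_neg (by omega), if_neg (by omega)]

variable [Fintype Γ]

/-- The prover that archives all queries before round `t`, and then replies `γ'` to the query `γ`
with a mark on his tape. -/
abbrev markProver (α : Type) (blank γ γ' : Γ) (t : ℕ) : Prover α Γ :=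
  permProver α blank (markPerm blank γ γ' t)

lemma markProver_tape {blank γ γ' : Γ} {t : ℕ} (x : List α) {i : ℕ} (hi : i ≤ t)
    {y : Tape Γ blank} (hy : y ∈ (markProver α blank γ γ' t).reachable x i) :
    ∀ j, i ≤ j → y.1 j = blank :=
  reachable_of_archive x (fun _ hj => markPerm_of_lt blank γ γ' (lt_of_lt_of_le hj hi)) hy

/-- The reply exchanges two contents: one shows `γ ≠ blank` in the communication cell, the other has
a non-blank cell `t`, which is still fresh in round `t`. Neither is a blank symbol with an
admissible tape. -/
lemma markProver_committed {blank γ : Γ} (γ' : Γ) (hγ : γ ≠ blank) (t : ℕ) :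
    (markProver α blank γ γ' t).Committed blank := by
  refine permProver_committed fun x i y hy => ?_
  rcases lt_trichotomy i t with h | h | h
  · rw [markPerm_of_lt _ _ _ h, tapePerm_archive_fst]
    exact markProver_tape x h.le hy i le_rfl
  · subst h
    rw [markPerm_self]
    rcases tapePerm_replyPerm_cases γ' hγ (c := (blank, y)) (markProver_tape x le_rfl hy) with h | h
    · exact absurd (congrArg Prod.fst h).symm hγ
    · rw [h]
  · rw [markPerm_of_gt _ _ _ h, tapePerm_one]

end Mark

/-! ### The branch singled out by the mark -/

section MarkedRun

variable {α : Type} {V : Verifier α} {γ γ' : V.Γ} {t : ℕ} {x : List α}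

lemma blankComm_stateBefore_of_le {i : ℕ} (hi : i ≤ t) :
    BlankComm (stateBefore V (markProver α V.blank γ γ' t) x i) := by
  rcases i with _ | i
  · classical
    intro c hc
    rw [stateBefore, Finsupp.single_apply] at hc
    have : initialConfig V (markProver α V.blank γ γ' t) = c := by
      by_contra hne; exact hc (if_neg hne)
    rw [← this]
    rfl
  · rintro ⟨q, c⟩ hc
    rw [stateBefore, permProver_proverOp] at hc
    set d := (tapePerm V.blank (markPerm V.blank γ γ' t i)).symm c with hd
    have h4 := (((tapeIn_stateBefore V (markProver α V.blank γ γ' t) x i).verifier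
      (scanned x i)).filter (fun c => V.status c.1 = Status.non)) (q, d) hc
    have h5 := markProver_tape x (by omega) h4 i le_rfl
    have h6 : tapePerm V.blank (markPerm V.blank γ γ' t i) d = c := by simp [hd]
    change c.1 = _
    rw [← h6, markPerm_of_lt _ _ _ hi, tapePerm_archive_fst]
    exact h5

/-- Before round `t`, the branch without queries is the one with a blank tape. -/
lemma tapeSlice_allBlank {i : ℕ} (hi : i ≤ t) :
    tapeSlice (stateBefore V (markProver α V.blank γ γ' t) x i) (Tape.allBlank V.Γ V.blank) =
      withComm V V.blank (wordOp (silent V) ((List.range i).map (scanned x))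
        (EuclideanSpace.single V.q₀ 1)) := by
  classical
  induction i with
  | zero =>
    funext ⟨q, g⟩
    rw [tapeSlice, stateBefore, Finsupp.single_apply, withComm_apply]
    change (if initialConfig V _ = _ then _ else _) =
      if g = V.blank then (EuclideanSpace.single V.q₀ (1 : ℂ)) q else 0
    rw [initialConfig]
    by_cases hg : g = V.blank
    · by_cases hq : q = V.q₀
      · subst hq hg
        simp
      · rw [if_neg, if_pos hg]
        · simp [hq]
        · rintro ⟨⟩
          exact hq rfl
    · rw [if_neg, if_neg hg]
      rintro ⟨⟩
      exact hg rfl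
  | succ i ih =>
    funext ⟨q, g⟩
    rw [withComm_apply]
    by_cases hg : g = V.blank
    · subst hg
      -- Archiving a non-blank symbol leaves it on the tape, so a blank cell with a blank tape has
      -- only itself as predecessor.
      have h1 : (tapePerm V.blank (markPerm V.blank γ γ' t i)).symm
          (V.blank, Tape.allBlank V.Γ V.blank) = (V.blank, Tape.allBlank V.Γ V.blank) := by
        rw [Equiv.symm_apply_eq, markPerm_of_lt _ _ _ hi]
        refine Prod.ext ?_ (Tape.ext' fun j => ?_)
        · rw [tapePerm_archive_fst]
          rfl
        · rw [tapePerm_archive_snd]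
          exact (ite_self _).symm
      rw [if_pos rfl, tapeSlice, stateBefore, permProver_proverOp, h1]
      have h2 := congrFun (tapeSlice_move V (scanned x i)
        (stateBefore V (markProver α V.blank γ γ' t) x i) (Tape.allBlank V.Γ V.blank)) (q, V.blank)
      rw [ih (by omega), soloStep_withComm_blank] at h2
      refine h2.trans ?_
      rw [List.range_succ, List.map_append, wordOp_append]
      rfl
    · rw [if_neg hg]
      by_contra hne
      exact hg (blankComm_stateBefore_of_le hi (q, g, Tape.allBlank V.Γ V.blank) hne)

/-- The amplitudes of a query `γ` in round `t`, in the branch without earlier queries. -/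
noncomputable def queryVector (V : Verifier α) (x : List α) (t : ℕ) (γ : V.Γ) :
    EuclideanSpace ℂ V.Q :=
  block V (scanned x t) γ (fun q => V.status q = Status.non)
    (wordOp (silent V) ((List.range t).map (scanned x)) (EuclideanSpace.single V.q₀ 1))

/-- The branch in which the query `γ` of round `t` is answered by `γ'` is the one with the mark. -/
lemma tapeSlice_markTape (hγ : γ ≠ V.blank) (j : ℕ) :
    tapeSlice (stateBefore V (markProver α V.blank γ γ' t) x (t + 1 + j))
        (markTape V.blank t γ) =
      soloWord V ((List.range' (t + 1) j).map (scanned x))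
        (withComm V γ' (queryVector V x t γ)) := by
  induction j with
  | zero =>
    funext ⟨q, g⟩
    change tapeSlice (stateBefore V (markProver α V.blank γ γ' t) x (t + 1))
        (markTape V.blank t γ) (q, g) = withComm V γ' (queryVector V x t γ) (q, g)
    rw [tapeSlice, stateBefore, permProver_proverOp, markPerm_self, withComm_apply]
    set d := (tapePerm V.blank (replyPerm V.blank γ γ' t)).symm (g, markTape V.blank t γ) with hd
    have hd' : tapePerm V.blank (replyPerm V.blank γ γ' t) d = (g, markTape V.blank t γ) := by
      simp [hd]
    by_cases hg : g = γ'
    · have h1 : d = (γ, Tape.allBlank V.Γ V.blank) := by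
        rw [hd, Equiv.symm_apply_eq, tapePerm_replyPerm, hg]
      rw [if_pos hg, h1]
      have h2 := congrFun (tapeSlice_move V (scanned x t)
        (stateBefore V (markProver α V.blank γ γ' t) x t) (Tape.allBlank V.Γ V.blank)) (q, γ)
      rw [tapeSlice_allBlank le_rfl, soloStep_withComm_blank] at h2
      exact h2
    · rw [if_neg hg]
      by_contra hne
      have h4 := (((tapeIn_stateBefore V (markProver α V.blank γ γ' t) x t).verifier
        (scanned x t)).filter (fun c => V.status c.1 = Status.non)) (q, d) hne
      have h5 : d = _ := eq_of_tapePerm_replyPerm hγ (markProver_tape x le_rfl h4)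
        (congrArg Prod.snd hd')
      rw [h5, tapePerm_replyPerm] at hd'
      exact hg (congrArg Prod.fst hd').symm
  | succ j ih =>
    rw [List.range'_concat, List.map_append, soloWord_append, ← ih]
    simp only [one_mul, List.map_cons, List.map_nil]
    refine Eq.trans ?_ (tapeSlice_move V (scanned x (t + 1 + j)) _ _)
    funext r
    change stateBefore V (markProver α V.blank γ γ' t) x (t + 1 + j + 1) (r.1, r.2, _) = _
    rw [stateBefore, permProver_proverOp, markPerm_of_gt _ _ _ (by omega : t < t + 1 + j)]
    have h1 : (tapePerm V.blank (1 : Equiv.Perm (V.Γ × (Fin (t + 1 + j + 1) → V.Γ)))).symm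
        (r.2, markTape V.blank t γ) = (r.2, markTape V.blank t γ) := by
      rw [Equiv.symm_apply_eq, tapePerm_one]
    rw [h1]
    rfl

/-- If the prover that marks the reply causes at most one interaction, then the verifier makes no
query after the reply. -/
lemma soloWord_queryVector_eq_zero (hγ : γ ≠ V.blank)
    (hb : interactions V (markProver α V.blank γ γ' t) x ≤ (1 : ℕ)) (j : ℕ)
    {r : V.Q × V.Γ} (hr : r.2 ≠ V.blank) :
    soloWord V ((List.range' (t + 1) (j + 1)).map (scanned x))
      (withComm V γ' (queryVector V x t γ)) r = 0 := by
  by_contra hne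
  set P := markProver α V.blank γ γ' t with hP
  -- A second query on the marked tape would have non-zero amplitude in the actual superposition,
  -- hence would lie on a computation path.
  have hmeas : stateMeasured V P x (t + 1 + j) (r.1, r.2, markTape V.blank t γ) ≠ 0 := by
    intro h0
    apply hne
    rw [List.range'_concat, List.map_append, soloWord_append, ← tapeSlice_markTape hγ]
    simp only [one_mul, List.map_cons, List.map_nil]
    change soloStep V (scanned x (t + 1 + j)) _ r = 0
    rw [← tapeSlice_move]
    exact h0
  obtain ⟨p, hrounds, hafter⟩ := exists_computationPath V P x _ hmeas
  have hverif : ∀ s < p.rounds, (p.after s).2.2 = (p.before s).2.2 := by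
    intro s hs
    have h1 := p.verifier_move s hs
    rw [verifierOp_single_apply] at h1
    by_contra hne'
    exact h1 (if_neg (Ne.symm hne'))
  have hprov : ∀ s, s + 1 < p.rounds →
      tapePerm V.blank (markPerm V.blank γ γ' t s) (p.after s).2 = (p.before (s + 1)).2 := by
    intro s hs
    have h1 := p.prover_move s hs
    rw [← permProver_U_single (α := α) (π := markPerm V.blank γ γ' t) x s]
    intro h0
    apply h1
    rw [show p.before (s + 1) = ((p.before (s + 1)).1, (p.before (s + 1)).2) from rfl,
      show p.after s = ((p.after s).1, (p.after s).2) from rfl, proverOp_single]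
    rw [h0, mul_zero, ite_self]
  -- After round `t` the prover does nothing and the verifier never touches the tape, so the mark
  -- can be traced back to the reply of round `t`.
  have htape : ∀ k ≤ j, (p.after (t + 1 + k)).2.2 = (p.before (t + 1)).2.2 := by
    intro k hk
    induction k with
    | zero => exact hverif (t + 1) (by omega)
    | succ k ih =>
      have h1 := hprov (t + 1 + k) (by omega)
      rw [markPerm_of_gt _ _ _ (by omega : t < t + 1 + k), tapePerm_one] at h1
      rw [show t + 1 + (k + 1) = t + 1 + k + 1 by omega, hverif _ (by omega), ← h1]
      exact ih (by omega)
  have hquery : (p.after t).2.1 = γ := by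
    have h1 := hprov t (by omega)
    have h2 : (p.before (t + 1)).2.2 = markTape V.blank t γ := by
      rw [← htape j le_rfl, hafter]
    have h3 : (p.after t).2.2 ∈ P.reachable x t :=
      (((tapeIn_stateBefore V P x t).verifier (scanned x t)).filter
        (fun c => V.status c.1 = Status.non)) (p.after t) (p.after_ne_zero t (by omega))
    rw [markPerm_self] at h1
    have h4 := eq_of_tapePerm_replyPerm hγ (markProver_tape x le_rfl h3)
      ((congrArg Prod.snd h1).trans h2)
    rw [h4]
  have h1 : ((p.queries : ℕ) : ℕ∞) ≤ ((1 : ℕ) : ℕ∞) :=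
    (le_iSup (fun p : ComputationPath V P x => (p.queries : ℕ∞)) p).trans hb
  have h2 : p.queries ≤ 1 := by exact_mod_cast h1
  have h3 : 1 < p.queries := by
    refine Finset.one_lt_card.2 ⟨t, ?_, t + 1 + j, ?_, by omega⟩
    · rw [Finset.mem_filter, Finset.mem_range, hquery]
      exact ⟨by omega, hγ⟩
    · rw [Finset.mem_filter, Finset.mem_range, hafter]
      exact ⟨by omega, hr⟩
  omega

end MarkedRun

/-- If the verifier of a system for `zeroLang` makes at most one interaction on all words outside
the language, then he never queries after the reply to a query. -/
lemma block_mem_repliedSub {V : Verifier (Fin 2)}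
    (hV : ∀ x ∉ zeroLang, ∀ P : Prover (Fin 2) V.Γ, P.Committed V.blank →
      interactions V P x ≤ (1 : ℕ))
    {u : List (TapeSym (Fin 2))} {σ : TapeSym (Fin 2)} {w₀ : List (Fin 2)}
    (hu : u ++ [σ] = TapeSym.left :: w₀.map TapeSym.letter) {γ : V.Γ} (hγ : γ ≠ V.blank) :
    block V σ γ (fun q => V.status q = Status.non)
      (wordOp (silent V) u (EuclideanSpace.single V.q₀ 1)) ∈ repliedSub V := by
  intro γ' a w r hr
  -- The final `1` puts `x` outside the language, whatever `w₀` and `w` are; it is scanned only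
  -- after the moves considered here.
  set x : List (Fin 2) := w₀ ++ a :: w ++ [1] with hx
  have hxL : x ∉ zeroLang := by
    rintro ⟨v, hv⟩
    rw [hx] at hv
    have := (List.append_inj' hv rfl).2
    simp at this
  have hlen : u.length = w₀.length := by
    have := congrArg List.length hu
    simpa using this
  have hsymb : u ++ [σ] = (List.range (u.length + 1)).map (scanned x) := by
    rw [hu]
    refine List.ext_getElem (by simp [hlen]) fun t h1 h2 => ?_
    rw [List.getElem_map, List.getElem_range]
    rcases t with _ | t
    · rfl
    · simp only [List.length_cons, List.length_map] at h1
      have ht : t < w₀.length := by omega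
      rw [scanned_of_lt (by simp [hx]; omega), List.getElem_cons_succ, List.getElem_map]
      simp only [hx, List.append_assoc]
      rw [List.getElem_append_left ht]
  rw [List.range_succ, List.map_append] at hsymb
  obtain ⟨hu', hσ⟩ := List.append_inj' hsymb rfl
  have hσ' : σ = scanned x u.length := by simpa using hσ
  have hw : (List.range' (u.length + 1) (w.length + 1)).map (scanned x) =
      (a :: w).map TapeSym.letter := by
    refine List.ext_getElem (by simp) fun t h1 h2 => ?_
    simp only [List.length_map, List.length_cons] at h2
    rw [List.getElem_map, List.getElem_range', List.getElem_map,
      show u.length + 1 + 1 * t = (w₀.length + t) + 1 by omega,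
      scanned_of_lt (by simp [hx]; omega)]
    congr 1
    simp only [hx, List.append_assoc]
    rw [List.getElem_append_right (by omega), List.getElem_append_left (by simp; omega)]
    congr 1
    omega
  have key := soloWord_queryVector_eq_zero (V := V) (γ' := γ') (t := u.length) (x := x) hγ
    (hV x hxL _ (markProver_committed γ' hγ _)) w.length hr
  rw [hw, queryVector, ← hσ', ← hu'] at key
  exact key

end QIPSharp

namespace QIPSharp

/-! ### The language `zeroLang` needs more than one interaction -/

lemma l2_neg {ι : Type*} (f : ι →₀ ℂ) : l2 (-f) = l2 f := by
  rw [l2, l2, normSq_eq_sum (-f) (Finsupp.support_neg f).le, normSq_eq_sum f subset_rfl]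
  simp

lemma l2_le_of_normSq_le {ι κ : Type*} {f : ι →₀ ℂ} {g : κ →₀ ℂ} (h : normSq f ≤ normSq g) :
    l2 f ≤ l2 g := Real.sqrt_le_sqrt h

lemma l2_sub_le {ι : Type*} (f g : ι →₀ ℂ) : l2 (f - g) ≤ l2 f + l2 g := by
  rw [sub_eq_add_neg, ← l2_neg g]
  exact l2_add_le f (-g)

lemma wordOp_map {H ι κ : Type*} [NormedAddCommGroup H] [InnerProductSpace ℂ H]
    (T : κ → H →L[ℂ] H) (g : ι → κ) (w : List ι) :
    wordOp T (w.map g) = wordOp (fun a => T (g a)) w := by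
  induction w with
  | nil => rfl
  | cons a w ih => simp only [List.map_cons, wordOp, ih]

/-! ### Evolution of superpositions that cause no more queries -/

section Quiet

variable {α : Type} {V : Verifier α} {P : Prover α V.Γ} {x : List α}

lemma IsLocal.comp {R R' : (Config V P →₀ ℂ) → (Config V P →₀ ℂ)} (hR : IsLocal R)
    (hR' : IsLocal R') : IsLocal fun Ψ => R (R' Ψ) where
  comm A Ψ := by rw [hR.comm, hR'.comm]
  norm Ψ := by rw [hR.norm, hR'.norm]

lemma IsLocal.l2 {R : (Config V P →₀ ℂ) → (Config V P →₀ ℂ)} (hR : IsLocal R)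
    (Ψ : Config V P →₀ ℂ) : l2 (R Ψ) = l2 Ψ := by
  rw [QIPSharp.l2, QIPSharp.l2, hR.norm]

lemma tapeSlice_eq_sum (Ψ : Config V P →₀ ℂ) (y : P.PTape) :
    tapeSlice Ψ y = ∑ γ, withComm V γ (slice Ψ (γ, y)) := by
  funext ⟨q, g⟩
  rw [Finset.sum_apply]
  simp only [withComm_apply]
  rw [Finset.sum_ite_eq Finset.univ g]
  simp [slice_apply, tapeSlice]

lemma BlankComm.tapeSlice_eq {Ψ : Config V P →₀ ℂ} (h : BlankComm Ψ) (y : P.PTape) :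
    tapeSlice Ψ y = withComm V V.blank (slice Ψ (V.blank, y)) := by
  rw [tapeSlice_eq_sum, Fintype.sum_eq_single V.blank]
  intro γ hγ
  rw [h.slice_eq_zero hγ, map_zero]

/-- The superpositions from which the verifier does not query, with a blank communication cell. -/
structure IsQuiet (x : List α) (C : Submodule ℂ (EuclideanSpace ℂ V.Q)) (i : ℕ)
    (Ψ : Config V P →₀ ℂ) : Prop where
  blank : BlankComm Ψ
  slices : SlicesIn C Ψ
  tape : TapeIn x i Ψ

lemma IsQuiet.add {C : Submodule ℂ (EuclideanSpace ℂ V.Q)} {i : ℕ} {Ψ Φ : Config V P →₀ ℂ}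
    (h : IsQuiet x C i Ψ) (h' : IsQuiet x C i Φ) : IsQuiet x C i (Ψ + Φ) :=
  ⟨h.blank.add h'.blank, h.slices.add h'.slices, h.tape.add h'.tape⟩

lemma IsQuiet.prover (hP : P.Committed V.blank) {C : Submodule ℂ (EuclideanSpace ℂ V.Q)} {i : ℕ}
    {Ψ : Config V P →₀ ℂ} (h : IsQuiet x C i Ψ) : IsQuiet x C (i + 1) (proverOp V P x i Ψ) :=
  ⟨h.blank.prover hP h.tape, h.slices.prover i, h.tape.prover⟩

lemma IsQuiet.lift {C D : Submodule ℂ (EuclideanSpace ℂ V.Q)} {i : ℕ} {Ψ : Config V P →₀ ℂ}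
    (h : IsQuiet x C i Ψ) {A : EuclideanSpace ℂ V.Q →L[ℂ] EuclideanSpace ℂ V.Q}
    (hA : ∀ v ∈ C, A v ∈ D) : IsQuiet x D i (liftQ V P A Ψ) :=
  ⟨h.blank.lift A, fun c => by rw [slice_liftQ]; exact hA _ (h.slices c), h.tape.lift A⟩

lemma IsQuiet.mono {C D : Submodule ℂ (EuclideanSpace ℂ V.Q)} {i : ℕ} {Ψ : Config V P →₀ ℂ}
    (h : IsQuiet x C i Ψ) (hCD : C ≤ D) : IsQuiet x D i Ψ :=
  ⟨h.blank, h.slices.mono hCD, h.tape⟩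

/-- The silent moves for the input letters. -/
noncomputable abbrev silentLetter (V : Verifier α) (a : α) :
    EuclideanSpace ℂ V.Q →L[ℂ] EuclideanSpace ℂ V.Q := silent V (TapeSym.letter a)

lemma norm_silentLetter_le (V : Verifier α) (a : α) (v : EuclideanSpace ℂ V.Q) :
    ‖silentLetter V a v‖ ≤ ‖v‖ := norm_silent_le V _ v

lemma soloStep_of_quiet {v : EuclideanSpace ℂ V.Q} (hv : v ∈ quietSub V) (a : α) :
    soloStep V (TapeSym.letter a) (withComm V V.blank v) =
      withComm V V.blank (silentLetter V a v) := by
  funext ⟨q, g⟩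
  rw [withComm_apply]
  by_cases hg : g = V.blank
  · subst hg
    rw [if_pos rfl, soloStep_withComm_blank]
    rfl
  · rw [if_neg hg]
    exact hv [a] (q, g) hg

lemma silentLetter_mem_quietSub {v : EuclideanSpace ℂ V.Q} (hv : v ∈ quietSub V) (a : α) :
    silentLetter V a v ∈ quietSub V := by
  intro w r hr
  rw [← soloStep_of_quiet hv]
  exact hv (a :: w) r hr

lemma IsQuiet.nonHaltingPart {i : ℕ} {Ψ : Config V P →₀ ℂ} (h : IsQuiet x (quietSub V) i Ψ)
    (a : α) : nonHaltingPart V P (verifierOp V P (TapeSym.letter a) Ψ) =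
      liftQ V P (silentLetter V a) Ψ := by
  refine nonHaltingPart_eq_liftQ h.blank ?_
  rintro ⟨q, g, y⟩ hc
  by_contra hg
  apply hc
  have h1 := congrFun (tapeSlice_move V (TapeSym.letter a) Ψ y) (q, g)
  rw [h.blank.tapeSlice_eq] at h1
  exact h1.trans (h.slices _ [a] (q, g) hg)

lemma IsQuiet.rounds (hP : P.Committed V.blank) {C : Submodule ℂ (EuclideanSpace ℂ V.Q)}
    (hC : C ≤ quietSub V) (hstep : ∀ a, ∀ v ∈ C, silentLetter V a v ∈ C) (w : List α) {i : ℕ}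
    {Ψ : Config V P →₀ ℂ} (h : IsQuiet x C i Ψ) :
    ∃ R, IsLocal R ∧ rounds V P x i (w.map TapeSym.letter) Ψ =
        R (liftQ V P (wordOp (silentLetter V) w) Ψ) ∧
      IsQuiet x C (i + w.length) (rounds V P x i (w.map TapeSym.letter) Ψ) := by
  induction w generalizing i Ψ with
  | nil =>
    refine ⟨_, IsLocal.id, ?_, h⟩
    exact slice_ext fun c => by rw [slice_liftQ]; rfl
  | cons a w ih =>
    have h1 : round V P x i (TapeSym.letter a) Ψ =
        proverOp V P x i (liftQ V P (silentLetter V a) Ψ) := by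
      rw [round, (h.mono hC).nonHaltingPart]
    have h2 : IsQuiet x C (i + 1) (round V P x i (TapeSym.letter a) Ψ) := by
      rw [h1]
      exact (h.lift (hstep a)).prover hP
    obtain ⟨R, hR, hRe, hq⟩ := ih h2
    refine ⟨fun Φ => R (proverOp V P x i Φ), hR.comp (IsLocal.id.prover i), ?_, ?_⟩
    · simp only [List.map_cons, QIPSharp.rounds]
      rw [hRe, h1, liftQ_proverOp, ← liftQ_comp]
      rfl
    · simp only [List.map_cons, QIPSharp.rounds, List.length_cons]
      rw [show i + (w.length + 1) = i + 1 + w.length by omega]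
      exact hq

/-- After the reply to a query, the verifier's next move leads to quiet superpositions. -/
lemma isQuiet_of_replied {i : ℕ} {X : Config V P →₀ ℂ} (hX : SlicesIn (repliedSub V) X)
    (ht : TapeIn x i X) (a : α) :
    IsQuiet x (quietSub V) i (nonHaltingPart V P (verifierOp V P (TapeSym.letter a) X)) := by
  have h1 : ∀ (w : List α) (y : P.PTape) (r : V.Q × V.Γ), r.2 ≠ V.blank →
      soloWord V (w.map TapeSym.letter)
        (tapeSlice (nonHaltingPart V P (verifierOp V P (TapeSym.letter a) X)) y) r = 0 := by
    intro w y r hr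
    rw [tapeSlice_move, tapeSlice_eq_sum, map_sum, map_sum, Finset.sum_apply]
    exact Finset.sum_eq_zero fun γ _ => hX (γ, y) γ a w r hr
  have hb : BlankComm (nonHaltingPart V P (verifierOp V P (TapeSym.letter a) X)) := by
    rintro ⟨q, g, y⟩ hc
    by_contra hg
    exact hc (h1 [] y (q, g) hg)
  refine ⟨hb, ?_, (ht.verifier _).filter _⟩
  rintro ⟨g, y⟩
  by_cases hg : g = V.blank
  · subst hg
    intro w r hr
    rw [← hb.tapeSlice_eq]
    exact h1 w y r hr
  · rw [hb.slice_eq_zero hg]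
    exact Submodule.zero_mem _

/-- The move of a superposition without queries splits into the silent part and the queries. -/
lemma exists_queryPart {σ : TapeSym α} {φ : EuclideanSpace ℂ V.Q} {i : ℕ} {Φ : Config V P →₀ ℂ}
    (h : IsQuiet x (Submodule.span ℂ {φ}) i Φ)
    (hφ : ∀ γ, γ ≠ V.blank →
      block V σ γ (fun q => V.status q = Status.non) φ ∈ repliedSub V) :
    ∃ X, nonHaltingPart V P (verifierOp V P σ Φ) = liftQ V P (silent V σ) Φ + X ∧
      SlicesIn (repliedSub V) X ∧ TapeIn x i X := by
  refine ⟨(nonHaltingPart V P (verifierOp V P σ Φ)).filter fun c => c.2.1 ≠ V.blank, ?_, ?_,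
    ((h.tape.verifier σ).filter _).filter _⟩
  · ext ⟨q, g, y⟩
    rw [Finsupp.add_apply, Finsupp.filter_apply]
    by_cases hg : g = V.blank
    · subst hg
      rw [if_neg (fun h => h rfl), add_zero, ← slice_apply (liftQ V P _ Φ), slice_liftQ,
        silent_apply, ← h.blank.verifierOp_apply]
      rfl
    · rw [if_pos hg, ← slice_apply (liftQ V P _ Φ), slice_liftQ, h.blank.slice_eq_zero hg, map_zero]
      simp
  · rintro ⟨g, y⟩
    by_cases hg : g = V.blank
    · have h0 : slice ((nonHaltingPart V P (verifierOp V P σ Φ)).filter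
          fun c => c.2.1 ≠ V.blank) (g, y) = 0 := by
        ext q
        rw [slice_apply, Finsupp.filter_apply, if_neg (fun hne => hne hg)]
        rfl
      rw [h0]
      exact Submodule.zero_mem _
    · have h0 : slice ((nonHaltingPart V P (verifierOp V P σ Φ)).filter
          fun c => c.2.1 ≠ V.blank) (g, y) =
          block V σ g (fun q => V.status q = Status.non) (slice Φ (V.blank, y)) := by
        ext q
        rw [slice_apply, Finsupp.filter_apply, if_pos hg, block_apply,
          ← h.blank.verifierOp_apply]
        rfl
      obtain ⟨c, hc⟩ := Submodule.mem_span_singleton.1 (h.slices (V.blank, y))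
      rw [h0, ← hc, map_smul]
      exact Submodule.smul_mem _ _ (hφ g hg)

/-- Vectors whose norm is preserved forever never cause a query. -/
lemma isoSub_le_quietSub :
    isoSub (silentLetter V) (norm_silentLetter_le V) ≤ quietSub V := by
  have hstep : ∀ v ∈ isoSub (silentLetter V) (norm_silentLetter_le V), ∀ a,
      soloStep V (TapeSym.letter a) (withComm V V.blank v) =
        withComm V V.blank (silentLetter V a v) := by
    intro v hv a
    funext ⟨q, g⟩
    rw [withComm_apply, soloStep_withComm_blank]
    by_cases hg : g = V.blank
    · subst hg
      rw [if_pos rfl]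
      rfl
    · rw [if_neg hg, emit_eq_zero_of_norm_silent V (norm_apply_of_mem_isoSub hv a)
        (fun h => hg h.2), ite_self]
  intro v hv w
  induction w generalizing v with
  | nil =>
    intro r hr
    exact if_neg hr
  | cons a w ih =>
    intro r hr
    have h1 := ih (apply_mem_isoSub hv a) r hr
    rw [← hstep v hv a] at h1
    exact h1

/-- The silent move already carries the whole norm, so nothing is left for halting. -/
lemma statusPart_eq_zero_of_iso {i : ℕ} {Ψ : Config V P →₀ ℂ}
    (h : IsQuiet x (isoSub (silentLetter V) (norm_silentLetter_le V)) i Ψ) (a : α) {s : Status}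
    (hs : s ≠ Status.non) : statusPart V P s (verifierOp V P (TapeSym.letter a) Ψ) = 0 := by
  ext ⟨q, g, y⟩
  rw [statusPart, Finsupp.filter_apply]
  split_ifs with hq
  · rw [h.blank.verifierOp_apply]
    refine emit_eq_zero_of_norm_silent V (norm_apply_of_mem_isoSub (h.slices _) a) fun h' => hs ?_
    rw [← hq]
    exact h'.1
  · rfl

lemma l2_statusPart_le (s : Status) (σ : TapeSym α) (Ψ : Config V P →₀ ℂ) :
    l2 (statusPart V P s (verifierOp V P σ Ψ)) ≤ l2 Ψ := by
  refine l2_le_of_normSq_le ?_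
  rw [← normSq_verifierOp V P σ Ψ]
  exact normSq_filter_le _ _

/-- The isometric part never halts on letters, so by linearity every halting component comes from
`E`. -/
lemma weight_add_iso (hP : P.Committed V.blank) {s : Status} (hs : s ≠ Status.non) (w : List α)
    {i : ℕ} {Ψ : Config V P →₀ ℂ}
    (h : IsQuiet x (isoSub (silentLetter V) (norm_silentLetter_le V)) i Ψ)
    (E : Config V P →₀ ℂ) :
    weight V P x s i (w.map TapeSym.letter) (Ψ + E) =
      weight V P x s i (w.map TapeSym.letter) E := by
  induction w generalizing i Ψ E with
  | nil => rfl
  | cons a w ih =>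
    have h1 : statusPart V P s (verifierOp V P (TapeSym.letter a) (Ψ + E)) =
        statusPart V P s (verifierOp V P (TapeSym.letter a) E) := by
      have h0 := statusPart_eq_zero_of_iso h a hs
      rw [statusPart] at h0
      rw [map_add, statusPart, Finsupp.filter_add, h0, zero_add, statusPart]
    have h2 : IsQuiet x (isoSub (silentLetter V) (norm_silentLetter_le V)) (i + 1)
        (round V P x i (TapeSym.letter a) Ψ) := by
      rw [round, (h.mono isoSub_le_quietSub).nonHaltingPart]
      exact (h.lift fun v hv => apply_mem_isoSub hv a).prover hP
    simp only [List.map_cons, weight]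
    rw [h1, round_add, ih h2]

lemma weight_le_normSq {s : Status} (hs : s ≠ Status.non) (i : ℕ) (w : List (TapeSym α))
    (E : Config V P →₀ ℂ) : weight V P x s i w E ≤ normSq E := by
  have h1 := weight_add_weight_add_normSq V P x i w E
  have h2 := weight_nonneg V P x Status.acc i w E
  have h3 := weight_nonneg V P x Status.rej i w E
  have h4 := normSq_nonneg (rounds V P x i w E)
  rcases s
  · exact absurd rfl hs
  · linarith
  · linarith

/-- The halting weight of the rest of the input, for a perturbed isometric superposition. -/
lemma weight_tail_le (hP : P.Committed V.blank) {s : Status} (hs : s ≠ Status.non) (w : List α)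
    {i : ℕ} {Ψ : Config V P →₀ ℂ}
    (h : IsQuiet x (isoSub (silentLetter V) (norm_silentLetter_le V)) i Ψ)
    (E : Config V P →₀ ℂ) {δ : ℝ} (hδ : 0 ≤ δ)
    (hw : ∀ v ∈ isoSub (silentLetter V) (norm_silentLetter_le V),
      ‖wordOp (silentLetter V) w v - v‖ ≤ δ * ‖v‖) :
    weight V P x s i (w.map TapeSym.letter ++ [TapeSym.right]) (Ψ + E) ≤
      normSq (statusPart V P s (verifierOp V P TapeSym.right Ψ)) +
        (2 * l2 Ψ * (δ * l2 Ψ) + (δ * l2 Ψ) ^ 2) + (2 * l2 Ψ * l2 E + l2 E ^ 2) := by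
  obtain ⟨R, hR, hRe, hq⟩ := h.rounds hP isoSub_le_quietSub
    (fun a v hv => apply_mem_isoSub hv a) w
  have hE := weight_le_normSq (x := x) hs i (w.map TapeSym.letter ++ [TapeSym.right]) E
  rw [weight_append] at hE ⊢
  rw [weight_add_iso hP hs w h, rounds_add]
  simp only [weight, add_zero] at hE ⊢
  set Ψ' := rounds V P x i (w.map TapeSym.letter) Ψ with hΨ'
  set E' := rounds V P x i (w.map TapeSym.letter) E with hE'
  have h1 : normSq (statusPart V P s (verifierOp V P TapeSym.right (Ψ' + E'))) ≤
      normSq (statusPart V P s (verifierOp V P TapeSym.right Ψ')) + 2 * l2 Ψ * l2 E +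
        normSq (statusPart V P s (verifierOp V P TapeSym.right E')) := by
    have e : statusPart V P s (verifierOp V P TapeSym.right (Ψ' + E')) =
        statusPart V P s (verifierOp V P TapeSym.right Ψ') +
          statusPart V P s (verifierOp V P TapeSym.right E') := by
      rw [map_add]
      exact Finsupp.filter_add
    rw [e]
    exact normSq_add_le _ _ ((l2_statusPart_le _ _ _).trans (l2_rounds_le V P x _ _ _))
      ((l2_statusPart_le _ _ _).trans (l2_rounds_le V P x _ _ _))
  set A := wordOp (silentLetter V) w with hA
  -- The prover's operations during `w` amount to a local isometry, which cannot affect the final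
  -- measurement; what remains is the verifier's own word operator.
  have h2 : normSq (statusPart V P s (verifierOp V P TapeSym.right Ψ')) =
      normSq (statusPart V P s (verifierOp V P TapeSym.right (liftQ V P A Ψ))) := by
    rw [hRe]
    exact hR.normSq_filter_verifierOp (h.blank.lift A) (hRe ▸ hq.blank) TapeSym.right
      fun r => V.status r.1 = s
  -- By recurrence `A` is `δ`-close to the identity on all slices of `Ψ`, so `D` is a small error.
  set D := liftQ V P (A - ContinuousLinearMap.id ℂ _) Ψ with hD
  have h3 : liftQ V P A Ψ = Ψ + D := by
    refine slice_ext fun c => ?_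
    rw [slice_add, hD, slice_liftQ, slice_liftQ]
    simp
  have h4 : l2 D ≤ δ * l2 Ψ := l2_liftQ_le V P _ Ψ hδ fun c => hw _ (h.slices c)
  have h5 : normSq (statusPart V P s (verifierOp V P TapeSym.right (Ψ + D))) ≤
      normSq (statusPart V P s (verifierOp V P TapeSym.right Ψ)) + 2 * l2 Ψ * (δ * l2 Ψ) +
        (δ * l2 Ψ) ^ 2 := by
    have e : statusPart V P s (verifierOp V P TapeSym.right (Ψ + D)) =
        statusPart V P s (verifierOp V P TapeSym.right Ψ) +
          statusPart V P s (verifierOp V P TapeSym.right D) := by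
      rw [map_add]
      exact Finsupp.filter_add
    rw [e]
    refine (normSq_add_le _ _ (l2_statusPart_le _ _ _)
      ((l2_statusPart_le _ _ _).trans h4)).trans ?_
    have h6 := pow_le_pow_left₀ (l2_nonneg _) ((l2_statusPart_le s TapeSym.right D).trans h4) 2
    rw [l2_sq] at h6
    linarith
  rw [h2, h3] at h1
  rw [l2_sq E]
  linarith

end Quiet

/-! ### Using the prover's strategy for one input on another input -/

section Freeze

variable {α : Type} {V : Verifier α}

/-- The prover that acts on every input as on the input `x`. -/
abbrev Prover.freeze {Γ : Type} [Fintype Γ] [DecidableEq Γ] (P : Prover α Γ) (x : List α) :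
    Prover α Γ where
  Δ := P.Δ
  blank := P.blank
  cells _ i := P.cells x i
  S _ i := P.S x i

lemma Prover.freeze_reachable {Γ : Type} [Fintype Γ] [DecidableEq Γ] (P : Prover α Γ)
    (x y : List α) (i : ℕ) : (P.freeze x).reachable y i = P.reachable x i := by
  induction i with
  | zero => rfl
  | succ i ih =>
    rw [Prover.reachable, ih]
    rfl

/-- Soundness ranges over all committed provers, so the honest strategy for a word in the language
may be played on a word outside it. -/
lemma Prover.freeze_committed {Γ : Type} [Fintype Γ] [DecidableEq Γ] {P : Prover α Γ} {b : Γ}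
    (hP : P.Committed b) (x : List α) : (P.freeze x).Committed b := by
  intro y i z hz
  rw [Prover.freeze_reachable] at hz
  exact hP x i z hz

lemma weight_freeze (P : Prover α V.Γ) (x y : List α) (s : Status) (i : ℕ)
    (w : List (TapeSym α)) (Ψ : Config V P →₀ ℂ) :
    weight V (P.freeze x) y s i w Ψ = weight V P x s i w Ψ := by
  induction w generalizing i Ψ with
  | nil => rfl
  | cons σ w ih => exact congrArg _ (ih (i + 1) (round V P x i σ Ψ))

end Freeze

/-! ### Splitting the superposition by the time since the last query -/

section ZeroLang

variable {V : Verifier (Fin 2)} {P : Prover (Fin 2) V.Γ} {x : List (Fin 2)}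

/-- After the left endmarker and a word, the superposition consists of a part without queries, of
replies to queries of the last round, and of a quiet part. -/
lemma rounds_decomposition (hP : P.Committed V.blank)
    (hV : ∀ x ∉ zeroLang, ∀ P : Prover (Fin 2) V.Γ, P.Committed V.blank →
      interactions V P x ≤ (1 : ℕ)) (z : List (Fin 2)) :
    ∃ (R : (Config V P →₀ ℂ) → (Config V P →₀ ℂ)) (X Y : Config V P →₀ ℂ), IsLocal R ∧
      rounds V P x 0 (TapeSym.left :: z.map TapeSym.letter)
          (Finsupp.single (initialConfig V P) 1) =
        R (liftQ V P (wordOp (silent V) (TapeSym.left :: z.map TapeSym.letter))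
          (Finsupp.single (initialConfig V P) 1)) + X + Y ∧
      IsQuiet x (Submodule.span ℂ {wordOp (silent V) (TapeSym.left :: z.map TapeSym.letter)
        (EuclideanSpace.single V.q₀ 1)}) (z.length + 1)
        (R (liftQ V P (wordOp (silent V) (TapeSym.left :: z.map TapeSym.letter))
          (Finsupp.single (initialConfig V P) 1))) ∧
      SlicesIn (repliedSub V) X ∧ TapeIn x (z.length + 1) X ∧
      IsQuiet x (quietSub V) (z.length + 1) Y := by
  -- One round turns the query-free part into the next query-free part plus the replies to the new
  -- queries. Its slices are multiples of a single vector, so `block_mem_repliedSub` applies to all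
  -- of them.
  have step : ∀ (u : List (TapeSym (Fin 2))) (σ : TapeSym (Fin 2)) (w₀ : List (Fin 2))
      (R : (Config V P →₀ ℂ) → (Config V P →₀ ℂ)) (i : ℕ),
      u ++ [σ] = TapeSym.left :: w₀.map TapeSym.letter → IsLocal R →
      IsQuiet x (Submodule.span ℂ {wordOp (silent V) u (EuclideanSpace.single V.q₀ 1)}) i
        (R (liftQ V P (wordOp (silent V) u) (Finsupp.single (initialConfig V P) 1))) →
      ∃ X, round V P x i σ (R (liftQ V P (wordOp (silent V) u)
          (Finsupp.single (initialConfig V P) 1))) =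
        proverOp V P x i (R (liftQ V P (wordOp (silent V) (u ++ [σ]))
          (Finsupp.single (initialConfig V P) 1))) + X ∧
        IsQuiet x (Submodule.span ℂ {wordOp (silent V) (u ++ [σ])
          (EuclideanSpace.single V.q₀ 1)}) (i + 1)
          (proverOp V P x i (R (liftQ V P (wordOp (silent V) (u ++ [σ]))
            (Finsupp.single (initialConfig V P) 1)))) ∧
        SlicesIn (repliedSub V) X ∧ TapeIn x (i + 1) X := by
    intro u σ w₀ R i hu hR hq
    obtain ⟨X, hX, hXs, hXt⟩ := exists_queryPart hq
      fun γ hγ => block_mem_repliedSub hV hu hγ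
    have hcomp : wordOp (silent V) (u ++ [σ]) = (silent V σ).comp (wordOp (silent V) u) :=
      ContinuousLinearMap.ext fun v => wordOp_append _ _ _ v
    have hlift : R (liftQ V P (wordOp (silent V) (u ++ [σ]))
        (Finsupp.single (initialConfig V P) 1)) =
        liftQ V P (silent V σ) (R (liftQ V P (wordOp (silent V) u)
          (Finsupp.single (initialConfig V P) 1))) := by
      rw [hcomp, liftQ_comp, hR.comm]
    refine ⟨proverOp V P x i X, ?_, ?_, hXs.prover i, hXt.prover⟩
    · rw [round, hX, map_add, hlift]
    · rw [hlift, hcomp]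
      refine (hq.lift fun v hv => ?_).prover hP
      obtain ⟨c, rfl⟩ := Submodule.mem_span_singleton.1 hv
      rw [map_smul]
      exact Submodule.smul_mem _ _ (Submodule.mem_span_singleton_self _)
  have hbegin : IsQuiet x (Submodule.span ℂ {wordOp (silent V) ([] : List (TapeSym (Fin 2)))
      (EuclideanSpace.single V.q₀ 1)}) 0 (liftQ V P (wordOp (silent V) [])
        (Finsupp.single (initialConfig V P) 1)) := by
    classical
    have e : liftQ V P (wordOp (silent V) []) (Finsupp.single (initialConfig V P) 1) =
        Finsupp.single (initialConfig V P) 1 :=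
      slice_ext fun c => by rw [slice_liftQ]; rfl
    rw [e]
    have h2 : ∀ c, (Finsupp.single (initialConfig V P) 1 : Config V P →₀ ℂ) c ≠ 0 →
        c = initialConfig V P := by
      intro c hc
      rw [Finsupp.single_apply] at hc
      by_contra hne
      exact hc (if_neg (Ne.symm hne))
    refine ⟨fun c hc => by rw [h2 c hc]; rfl, fun c => ?_, fun c hc => by rw [h2 c hc]; rfl⟩
    rw [Submodule.mem_span_singleton]
    refine ⟨if (initialConfig V P).2 = c then 1 else 0, ?_⟩
    ext q
    change (if (initialConfig V P).2 = c then (1 : ℂ) else 0) *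
      (EuclideanSpace.single V.q₀ (1 : ℂ)) q = Finsupp.single (initialConfig V P) 1 (q, c)
    rw [Finsupp.single_apply]
    by_cases hq : q = V.q₀
    · subst hq
      by_cases hc : (initialConfig V P).2 = c
      · have hpos : initialConfig V P = (V.q₀, c) := Prod.ext rfl hc
        rw [if_pos hc, if_pos hpos]
        simp
      · rw [if_neg hc, if_neg fun h => hc (congrArg Prod.snd h), zero_mul]
    · have hne : initialConfig V P ≠ (q, c) := fun h => hq (congrArg Prod.fst h).symm
      rw [if_neg hne]
      simp [hq]
  induction z using List.reverseRecOn with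
  | nil =>
    obtain ⟨X, hX, hq, hXs, hXt⟩ := step [] TapeSym.left [] (fun Ψ => Ψ) 0 rfl IsLocal.id hbegin
    have e : liftQ V P (wordOp (silent V) []) (Finsupp.single (initialConfig V P) 1) =
        Finsupp.single (initialConfig V P) 1 :=
      slice_ext fun c => by rw [slice_liftQ]; rfl
    rw [e] at hX
    refine ⟨_, X, 0, IsLocal.id.prover (x := x) 0, ?_, hq, hXs, hXt, ?_⟩
    · rw [add_zero]
      exact hX
    · exact ⟨fun c hc => absurd rfl hc, fun c => Submodule.zero_mem _, fun c hc => absurd rfl hc⟩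
  | append_singleton z a ih =>
    obtain ⟨R, X, Y, hR, hΨ, hq, hXs, hXt, hY⟩ := ih
    have hu : (TapeSym.left :: z.map TapeSym.letter) ++ [TapeSym.letter a] =
        TapeSym.left :: (z ++ [a]).map TapeSym.letter := by simp
    obtain ⟨X', hX', hq', hXs', hXt'⟩ := step _ _ _ R (z.length + 1) hu hR hq
    rw [hu] at hX' hq'
    refine ⟨_, X', round V P x (z.length + 1) (TapeSym.letter a) (X + Y),
      hR.prover (x := x) (z.length + 1),
      ?_, ?_, hXs', ?_, ?_⟩
    · rw [← hu, rounds_append, hΨ, add_assoc, rounds_add, hu]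
      have hl : 0 + (TapeSym.left :: z.map (TapeSym.letter (α := Fin 2))).length =
          z.length + 1 := by
        simp
      rw [hl]
      simp only [rounds]
      rw [hX']
    · simpa using hq'
    · simpa using hXt'
    -- One letter after a reply, the replied part has become quiet and joins the older quiet part.
    · have h1 := (isQuiet_of_replied hXs hXt a).prover hP
      have h2 := (hY.lift fun v hv => silentLetter_mem_quietSub hv a).prover hP
      rw [← hY.nonHaltingPart] at h2
      rw [round_add]
      simpa [round] using h1.add h2

end ZeroLang

end QIPSharp

namespace QIPSharp

/-! ### Near-isometry after `z0z`, and the contradiction -/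

section ZeroLang

variable {V : Verifier (Fin 2)} {P : Prover (Fin 2) V.Γ} {x : List (Fin 2)}

/-- After the left endmarker and the word `z0z`, where `z` is small outside the isometric subspace,
the superposition is close to an isometric one. -/
lemma exists_iso_approximation (hP : P.Committed V.blank)
    (hV : ∀ x ∉ zeroLang, ∀ P : Prover (Fin 2) V.Γ, P.Committed V.blank →
      interactions V P x ≤ (1 : ℕ)) {z : List (Fin 2)} {δ : ℝ} (hδ : 0 < δ) (hδ1 : δ ≤ 1)
    (hz : ∀ v, ‖wordOp (silentLetter V) z
      (v - isoProj (silentLetter V) (norm_silentLetter_le V) v)‖ ≤ δ * ‖v‖) :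
    ∃ Ψ E : Config V P →₀ ℂ,
      rounds V P x 0 (TapeSym.left :: (z ++ 0 :: z).map TapeSym.letter)
        (Finsupp.single (initialConfig V P) 1) = Ψ + E ∧
      IsQuiet x (isoSub (silentLetter V) (norm_silentLetter_le V)) ((z ++ 0 :: z).length + 1) Ψ ∧
      l2 E ≤ 3 * δ := by
  set T := silentLetter V with hT
  set e := isoProj T (norm_silentLetter_le V) with he
  set Φ₀ : Config V P →₀ ℂ := Finsupp.single (initialConfig V P) 1 with hbegin
  have hΦ₀ : l2 Φ₀ = 1 := by rw [l2, hbegin, normSq_single]; simp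
  obtain ⟨R, X, Y, hR, hΨ, hq, hXs, hXt, hY⟩ := rounds_decomposition (x := x) hP hV z
  set A := wordOp (silent V) (TapeSym.left :: z.map TapeSym.letter) with hA
  have hAv : ∀ v, A v = wordOp T z (silent V TapeSym.left v) := by
    intro v
    rw [hA, wordOp, wordOp_map]
    rfl
  have hsplit : ∀ Φ : Config V P →₀ ℂ, Φ = liftQ V P e Φ +
      liftQ V P (ContinuousLinearMap.id ℂ _ - e) Φ := by
    intro Φ
    refine slice_ext fun c => ?_
    rw [slice_add, slice_liftQ, slice_liftQ]
    simp
  set Φ := R (liftQ V P A Φ₀) with hΦ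
  set E₀ := liftQ V P (ContinuousLinearMap.id ℂ _ - e) Φ with hE₀
  -- The first `z` makes the query-free part nearly isometric, and isometric vectors never query.
  have hE₀l : l2 E₀ ≤ δ := by
    rw [hE₀, hΦ, hR.comm, hR.l2, ← liftQ_comp]
    refine (l2_liftQ_le V P _ Φ₀ hδ.le fun c => ?_).trans (by rw [hΦ₀, mul_one])
    change ‖A (slice Φ₀ c) - e (A (slice Φ₀ c))‖ ≤ _
    rw [hAv, wordOp_sub_isoProj]
    refine (hz _).trans ?_
    gcongr
    exact norm_silent_le V _ _
  have hF : IsQuiet x (quietSub V) (z.length + 1) (liftQ V P e Φ) :=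
    hq.lift fun v _ => isoSub_le_quietSub (isoProj_mem v)
  set n := z.length + 1 with hn
  -- The middle letter gives the verifier one move on the fresh replies `X`, after which they are
  -- quiet too; all but `E₀` becomes quiet.
  set Y₁ := round V P x n (TapeSym.letter 0) (liftQ V P e Φ + X + Y) with hY₁
  have hY₁q : IsQuiet x (quietSub V) (n + 1) Y₁ := by
    have h1 := (isQuiet_of_replied hXs hXt 0).prover hP
    have h2 := ((hF.add hY).lift fun v hv => silentLetter_mem_quietSub hv 0).prover hP
    rw [← (hF.add hY).nonHaltingPart] at h2
    have h3 : Y₁ = round V P x n (TapeSym.letter 0) X +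
        round V P x n (TapeSym.letter 0) (liftQ V P e Φ + Y) := by
      rw [← round_add, hY₁]
      congr 1
      abel
    rw [h3]
    exact h1.add h2
  set u : List (TapeSym (Fin 2)) := TapeSym.left :: z.map TapeSym.letter with hu
  have hul : 0 + u.length = n := by simp [hu, hn]
  set E₁ := round V P x n (TapeSym.letter 0) E₀ with hE₁
  have hE₁l : l2 E₁ ≤ δ := (l2_rounds_le V P x n [TapeSym.letter 0] E₀).trans hE₀l
  have hstate : rounds V P x 0 (u ++ [TapeSym.letter 0]) Φ₀ = Y₁ + E₁ := by
    rw [rounds_append, hul, hΨ]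
    change round V P x n (TapeSym.letter 0) _ = _
    rw [hY₁, hE₁, ← round_add]
    congr 1
    conv_lhs => rw [hsplit Φ, ← hE₀]
    abel
  have hY₁l : l2 Y₁ ≤ 1 + δ := by
    have h1 : Y₁ = rounds V P x 0 (u ++ [TapeSym.letter 0]) Φ₀ - E₁ := by
      rw [hstate, add_sub_cancel_right]
    rw [h1]
    refine (l2_sub_le _ _).trans (add_le_add ?_ hE₁l)
    rw [← hΦ₀]
    exact l2_rounds_le V P x _ _ _
  -- On the quiet superposition the second `z` acts silently and makes it nearly isometric. This
  -- costs at most `δ(1 + δ) ≤ 2δ`, in addition to the earlier error `δ`.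
  obtain ⟨R', hR', hR'e, hq'⟩ := hY₁q.rounds hP le_rfl
    (fun a v hv => silentLetter_mem_quietSub hv a) z
  set Y₂ := rounds V P x (n + 1) (z.map TapeSym.letter) Y₁ with hY₂
  refine ⟨liftQ V P e Y₂, liftQ V P (ContinuousLinearMap.id ℂ _ - e) Y₂ +
    rounds V P x (n + 1) (z.map TapeSym.letter) E₁, ?_, ?_, ?_⟩
  · rw [← add_assoc, ← hsplit Y₂, hY₂, ← rounds_add, ← hstate]
    have h1 : TapeSym.left :: (z ++ 0 :: z).map TapeSym.letter =
        (u ++ [TapeSym.letter 0]) ++ z.map TapeSym.letter := by simp [hu]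
    rw [h1, rounds_append]
    congr 1
    simp [hu, hn]
  · have h1 := hq'.lift (A := e) (D := isoSub T (norm_silentLetter_le V))
      fun v _ => isoProj_mem v
    have h2 : (z ++ 0 :: z).length + 1 = n + 1 + z.length := by
      simp only [List.length_append, List.length_cons, hn]
      omega
    rw [h2]
    exact h1
  · have h1 : l2 (liftQ V P (ContinuousLinearMap.id ℂ _ - e) Y₂) ≤ δ * l2 Y₁ := by
      rw [hR'e, hR'.comm, hR'.l2, ← liftQ_comp]
      refine l2_liftQ_le V P _ Y₁ hδ.le fun c => ?_
      change ‖wordOp T z (slice Y₁ c) - e (wordOp T z (slice Y₁ c))‖ ≤ _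
      rw [wordOp_sub_isoProj]
      exact hz _
    have h2 := (l2_rounds_le V P x (n + 1) (z.map TapeSym.letter) E₁).trans hE₁l
    have h3 : δ * l2 Y₁ ≤ δ * 2 := by
      gcongr
      linarith
    refine (l2_add_le _ _).trans ?_
    linarith

lemma weight_right_add_le (Ψ : Config V P →₀ ℂ) (σ : TapeSym (Fin 2)) :
    normSq (statusPart V P Status.acc (verifierOp V P σ Ψ)) +
      normSq (statusPart V P Status.rej (verifierOp V P σ Ψ)) ≤ normSq Ψ := by
  have h1 := normSq_round V P [] 0 σ Ψ
  have h2 := normSq_nonneg (round V P [] 0 σ Ψ)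
  linarith

end ZeroLang

/-- The constant: `m² ≤ s² + 2c + c² ≤ s² + 9δ`, and the bracket is below `8δ + 4δ/3 + 12δ + 3δ <
25δ`. -/
lemma perturbation_bound {δ m c s : ℝ} (hδ : 0 ≤ δ) (hδ1 : δ ≤ 1 / 3) (hm : 0 ≤ m) (hc : 0 ≤ c)
    (hcδ : c ≤ 3 * δ) (hs : 0 ≤ s) (hs1 : s ≤ 1) (hms : m ≤ s + c) :
    m ^ 2 + 2 * ((2 * m * (δ * m) + (δ * m) ^ 2) + (2 * m * c + c ^ 2)) ≤ s ^ 2 + 59 * δ := by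
  have hm2 : m ≤ 2 := by linarith
  have hmm : m ^ 2 ≤ 4 := by nlinarith
  have e1 : m ^ 2 ≤ s ^ 2 + 2 * c + c ^ 2 := by nlinarith
  have e2 : c ^ 2 ≤ 3 * δ := by nlinarith
  have e3 : m * c ≤ 2 * (3 * δ) := mul_le_mul hm2 hcδ hc (by norm_num)
  have e4 : δ * m ^ 2 ≤ δ * 4 := mul_le_mul_of_nonneg_left hmm hδ
  have e5 : δ * (δ * m ^ 2) ≤ 1 / 3 * (δ * 4) := mul_le_mul hδ1 e4 (by positivity) (by norm_num)
  linarith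

/-- After the common prefix `z0z` the superposition is nearly isometric. The blocks of zeros and of
ones return it nearly to itself, so the right endmarker finds almost the same state for a word in
the language and for one outside it. -/
theorem zeroLang_notMem_QIPsharpBounded : zeroLang ∉ QIPsharpBounded 1 (Fin 2) := by
  rintro ⟨V, P, ε, hε, ⟨hP, hacc, hrej⟩, -, hout⟩
  set T := silentLetter V with hT
  -- `1 / 3` is what `perturbation_bound` requires, and `ε / 50` makes `59δ < 2ε`.
  set δ : ℝ := min (1 / 3) (ε / 50) with hδdef
  have hδ : 0 < δ := lt_min (by norm_num) (by positivity)
  have hδ1 : δ ≤ 1 / 3 := min_le_left _ _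
  have hδε : δ ≤ ε / 50 := min_le_right _ _
  obtain ⟨z, hz⟩ := exists_wordOp_uniformly_small (T := T) (hT := norm_silentLetter_le V) hδ
  obtain ⟨k, hk0, hk⟩ := exists_replicate_recurrent (T := T) (hT := norm_silentLetter_le V) 0 hδ
  obtain ⟨l, hl0, hl⟩ := exists_replicate_recurrent (T := T) (hT := norm_silentLetter_le V) 1 hδ
  set p : List (Fin 2) := z ++ 0 :: z with hp
  set x := p ++ List.replicate k 0 with hx
  set y := p ++ List.replicate l 1 with hy
  have hxL : x ∈ zeroLang := by
    obtain ⟨k', rfl⟩ := Nat.exists_eq_succ_of_ne_zero hk0.ne'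
    exact ⟨p ++ List.replicate k' 0, by rw [hx, List.replicate_succ', ← List.append_assoc]⟩
  have hyL : y ∉ zeroLang := by
    rintro ⟨v, hv⟩
    obtain ⟨l', rfl⟩ := Nat.exists_eq_succ_of_ne_zero hl0.ne'
    rw [hy, List.replicate_succ', ← List.append_assoc] at hv
    have := (List.append_inj' hv rfl).2
    simp at this
  have h1 := hacc x hxL
  have h2 := hrej y hyL (P.freeze x) (Prover.freeze_committed hP x)
  rw [accProb_eq_weight] at h1
  rw [rejProb_eq_weight] at h2
  replace h2 : 1 / 2 + ε ≤ weight V P x Status.rej 0 (tapeWord y)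
      (Finsupp.single (initialConfig V P) 1) := by
    rw [← weight_freeze P x y]
    exact h2
  set Φ₀ : Config V P →₀ ℂ := Finsupp.single (initialConfig V P) 1 with hbegin
  obtain ⟨Ψ, E, hsum, hq, hE⟩ := exists_iso_approximation (x := x) hP hout hδ (by linarith) hz
  set u : List (TapeSym (Fin 2)) := TapeSym.left :: p.map TapeSym.letter with hu
  have hword : ∀ w : List (Fin 2), tapeWord (p ++ w) =
      u ++ (w.map TapeSym.letter ++ [TapeSym.right]) := by
    intro w
    simp [tapeWord, hu]
  have hul : 0 + u.length = p.length + 1 := by simp [hu]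
  rw [hx, hword, weight_append, hul, hsum, ← hx] at h1
  rw [hy, hword, weight_append, hul, hsum] at h2
  have h3 := weight_tail_le hP (s := Status.acc) (by simp) (List.replicate k 0) hq E hδ.le hk
  have h4 := weight_tail_le hP (s := Status.rej) (by simp) (List.replicate l 1) hq E hδ.le hl
  have h5 := weight_add_weight_add_normSq V P x 0 u Φ₀
  rw [hsum, hbegin, normSq_single, norm_one, one_pow, ← hbegin] at h5
  have h6 := weight_right_add_le Ψ TapeSym.right
  set m := l2 Ψ with hm
  set c := l2 E with hc
  have hm0 : 0 ≤ m := l2_nonneg Ψ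
  have hc0 : 0 ≤ c := l2_nonneg E
  set s := l2 (Ψ + E) with hs
  have hs0 : 0 ≤ s := l2_nonneg _
  have hs1 : s ^ 2 = normSq (Ψ + E) := l2_sq _
  have hm2 : m ^ 2 = normSq Ψ := l2_sq _
  have hsle : s ≤ 1 := by
    have ha := weight_nonneg V P x Status.acc 0 u Φ₀
    have hb := weight_nonneg V P x Status.rej 0 u Φ₀
    nlinarith
  have hms : m ≤ s + c := by
    have : Ψ = (Ψ + E) - E := by rw [add_sub_cancel_right]
    rw [hm, this]
    exact l2_sub_le _ _
  have hbound : m ^ 2 + 2 * ((2 * m * (δ * m) + (δ * m) ^ 2) + (2 * m * c + c ^ 2)) ≤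
      s ^ 2 + 59 * δ := perturbation_bound hδ.le hδ1 hm0 hc0 hE hs0 hsle hms
  -- Adding the acceptance bound for `x` to the rejection bound for `y` gives `1 + 2ε ≤ (1 - s²) +
  -- m² + 2(…) ≤ 1 + 59δ`: the prefix has halted with total weight `1 - s²`, and the two verdicts on
  -- `Ψ` together weigh at most `m²`.
  linarith

end QIPSharp

theorem mainTheorem5 :
    (∀ (α : Type) [Finite α],
      QIPSharp.QIPsharpBounded 0 α ⊆ QIPSharp.QIPsharpBounded 1 α ∧
      QIPSharp.QIPsharpBounded 1 α ⊆ QIPSharp.QIPsharp α) ∧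
    QIPSharp.QIPsharpBounded 0 (Fin 2) ⊂ QIPSharp.QIPsharpBounded 1 (Fin 2) ∧
    QIPSharp.QIPsharpBounded 1 (Fin 2) ⊂ QIPSharp.QIPsharp (Fin 2) ∧
    (QIPSharp.oddLang ∈ QIPSharp.QIPsharpBounded 1 (Fin 2) ∧
      QIPSharp.oddLang ∉ QIPSharp.QIPsharpBounded 0 (Fin 2) ∧
      QIPSharp.oddLang ∉ QIPSharp.OneQFA (Fin 2)) ∧
    (QIPSharp.zeroLang ∈ QIPSharp.QIPsharp (Fin 2) ∧
      QIPSharp.zeroLang ∉ QIPSharp.QIPsharpBounded 1 (Fin 2)) := by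
  have hincl : ∀ α : Type, QIPSharp.QIPsharpBounded 0 α ⊆ QIPSharp.QIPsharpBounded 1 α ∧
      QIPSharp.QIPsharpBounded 1 α ⊆ QIPSharp.QIPsharp α := by
    intro α
    constructor
    · rintro L ⟨V, P, ε, hε, hrec, hin, hout⟩
      exact ⟨V, P, ε, hε, hrec, fun x hx => (hin x hx).trans (by simp),
        fun x hx P' hP' => (hout x hx P' hP').trans (by simp)⟩
    · rintro L ⟨V, P, ε, hε, hrec, -⟩
      exact ⟨V, P, ε, hε, hrec⟩
  have hodd : QIPSharp.oddLang ∉ QIPSharp.QIPsharpBounded 0 (Fin 2) := fun h =>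
    QIPSharp.oddLang_notMem_OneQFA (QIPSharp.QIPsharpBounded_zero_subset_OneQFA _ h)
  refine ⟨fun α _ => hincl α, ⟨(hincl _).1, fun h => hodd (h QIPSharp.oddLang_mem_QIPsharpBounded)⟩,
    ⟨(hincl _).2, fun h => QIPSharp.zeroLang_notMem_QIPsharpBounded
      (h QIPSharp.zeroLang_mem_QIPsharp)⟩,
    ⟨QIPSharp.oddLang_mem_QIPsharpBounded, hodd, QIPSharp.oddLang_notMem_OneQFA⟩,
    QIPSharp.zeroLang_mem_QIPsharp, QIPSharp.zeroLang_notMem_QIPsharpBounded⟩
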